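/- Let $\Omega\subset\mathbb R^2=\mathbb C$ be a bounded domain. For $K\ge 1$ let $M_K(\Omega)$ be the set of $\sigma\in L^\infty(\Omega;\mathbb R^{2\times 2})$ such that $\frac1K|\xi|^2\le \sigma(x)\xi\cdot\xi\le K|\xi|^2$ for a.e. $x\in\Omega$ and all $\xi\in\mathbb R^2$. For $\sigma\in M_K(\Omega)$ let $L_\sigma u=-\nabla\cdot(\sigma\nabla u)$, regarded as an operator $H^1_0(\Omega)\to H^{-1}(\Omega)$ through the form $\ell_\sigma(u,v)=\int_\Omega\langle\sigma\nabla u,\nabla v\rangle$ (real-valued functions). Let $\lambda(K)=\lambda(K,\Omega)$ be the largest number with $\ell_\sigma(u,u)\ge\lambda(K)\|u\|_{L^2(\Omega)}^2$ for all $\sigma\in M_K(\Omega)$ and $u\in H^1_0(\Omega)$; it is positive. For $\sigma_n,\sigma\in M_K(\Omega)$, say that $\sigma_n$ G-converges to $\sigma$ (in $M_K(\Omega)$) if $(L_{\sigma_n}-\lambda)^{-1}f\rightharpoonup(L_\sigma-\lambda)^{-1}f$ weakly in $H^1_0(\Omega)$ for every $f\in H^{-1}(\Omega)$ and every real $\lambda<\lambda(K)$.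 Let $K'\ge1$ and let $F:\mathbb C\to\mathbb C$ be a $K'$-quasiconformal map, that is, a homeomorphism in $W^{1,2}_{\mathrm{loc}}$ with $\|DF(x)\|^2\le K'J_F(x)$ for a.e. $x$, where $\|\cdot\|$ is the operator norm and $J_F=\det DF$. Assume that $F(\Omega)=\Omega$ and $F(x)=x$ for all $x\in\partial\Omega$. The push-forward of $\sigma$ is $$F_*(\sigma)(y)=J_F(x)^{-1}\,DF(x)\,\sigma(x)\,DF(x)^{t},\qquad x=F^{-1}(y).$$ **Lemma.** Let $K\ge 1$ and $\sigma_n,\sigma\in M_K(\Omega)$, $n\in\mathbb N$. Then $F_*(\sigma_n),F_*(\sigma)\in M_{KK'}(\Omega)$, and $\sigma_n$ G-converges to $\sigma$ in $M_K(\Omega)$ if and only if $F_*(\sigma_n)$ G-converges to $F_*(\sigma)$ in $M_{KK'}(\Omega)$. -/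

import Mathlib

open MeasureTheory Filter Topology Set
open scoped ContDiff ENNReal RealInnerProductSpace

noncomputable section

/-- The plane `ℝ² = ℂ` with its Euclidean norm and Lebesgue measure. -/
abbrev Plane : Type := EuclideanSpace ℝ (Fin 2)

/-- Real `2 × 2` matrices, as linear maps of the plane, with the operator norm. -/
abbrev PlaneMat : Type := Plane →L[ℝ] Plane

/-- `φ ∈ C_c^∞(Ω)`. -/
structure IsTestFun (Ω : Set Plane) (φ : Plane → ℝ) : Prop where
  smooth : ContDiff ℝ ∞ φ
  compact : HasCompactSupport φ
  support_subset : tsupport φ ⊆ Ω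

lemma IsTestFun.zero (Ω : Set Plane) : IsTestFun Ω (fun _ => 0) :=
  ⟨contDiff_const, HasCompactSupport.zero, by simp [tsupport]⟩

lemma IsTestFun.add {Ω : Set Plane} {φ ψ : Plane → ℝ} (hφ : IsTestFun Ω φ)
    (hψ : IsTestFun Ω ψ) : IsTestFun Ω (fun x => φ x + ψ x) :=
  ⟨hφ.smooth.add hψ.smooth, hφ.compact.add hψ.compact,
    (tsupport_add φ ψ).trans (union_subset hφ.support_subset hψ.support_subset)⟩

lemma IsTestFun.const_mul {Ω : Set Plane} {φ : Plane → ℝ} (hφ : IsTestFun Ω φ) (c : ℝ) :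
    IsTestFun Ω (fun x => c * φ x) :=
  ⟨contDiff_const.mul hφ.smooth, hφ.compact.mul_left,
    (tsupport_mul_subset_right (f := fun _ => c) (g := φ)).trans hφ.support_subset⟩

/-- The Hilbert space `L²(Ω) × L²(Ω; ℝ²)`. A function `u ∈ H¹(Ω)` is represented by the pair
`(u, ∇u)`, whose norm here is the `H¹(Ω)`-norm of `u`. -/
abbrev L2Pair (Ω : Set Plane) : Type :=
  WithLp 2 (Lp ℝ 2 (volume.restrict Ω : Measure Plane) ×
    Lp Plane 2 (volume.restrict Ω : Measure Plane))

/-- The pairs `(φ, ∇φ)` with `φ ∈ C_c^∞(Ω)`. -/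
def testPairs (Ω : Set Plane) : Submodule ℝ (L2Pair Ω) where
  carrier := {w | ∃ φ : Plane → ℝ, IsTestFun Ω φ ∧
    w.fst =ᵐ[volume.restrict Ω] φ ∧ w.snd =ᵐ[volume.restrict Ω] gradient φ}
  zero_mem' := by
    refine ⟨fun _ => 0, IsTestFun.zero Ω, Lp.coeFn_zero _ _ _, ?_⟩
    filter_upwards [Lp.coeFn_zero Plane 2 (volume.restrict Ω : Measure Plane)] with x hx
    simpa [gradient] using hx
  add_mem' := by
    rintro a b ⟨φ, hφ, h1, h2⟩ ⟨ψ, hψ, h3, h4⟩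
    refine ⟨fun x => φ x + ψ x, hφ.add hψ, ?_, ?_⟩
    · filter_upwards [Lp.coeFn_add a.fst b.fst, h1, h3] with x hx h1 h3
      rw [WithLp.add_fst, hx, Pi.add_apply, h1, h3]
    · filter_upwards [Lp.coeFn_add a.snd b.snd, h2, h4] with x hx h2 h4
      rw [WithLp.add_snd, hx, Pi.add_apply, h2, h4]
      have e : fderiv ℝ (fun x => φ x + ψ x) x = fderiv ℝ φ x + fderiv ℝ ψ x :=
        fderiv_fun_add (hφ.smooth.differentiable (by simp) x)
          (hψ.smooth.differentiable (by simp) x)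
      simp [gradient, e]
  smul_mem' := by
    rintro c a ⟨φ, hφ, h1, h2⟩
    refine ⟨fun x => c * φ x, hφ.const_mul c, ?_, ?_⟩
    · filter_upwards [Lp.coeFn_smul c a.fst, h1] with x hx h1
      rw [WithLp.smul_fst, hx, Pi.smul_apply, h1, smul_eq_mul]
    · filter_upwards [Lp.coeFn_smul c a.snd, h2] with x hx h2
      rw [WithLp.smul_snd, hx, Pi.smul_apply, h2]
      have e : fderiv ℝ (fun x => c * φ x) x = c • fderiv ℝ φ x :=
        fderiv_const_mul (hφ.smooth.differentiable (by simp) x) c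
      simp [gradient, e]

/-- `H¹₀(Ω)`: the closure of `C_c^∞(Ω)` in the `H¹(Ω)`-norm. -/
def H10 (Ω : Set Plane) : Submodule ℝ (L2Pair Ω) := (testPairs Ω).topologicalClosure

/-- The function underlying an element of `H¹₀(Ω)`. -/
def H10val {Ω : Set Plane} (u : H10 Ω) : Plane → ℝ := (u : L2Pair Ω).fst

/-- The weak gradient of an element of `H¹₀(Ω)`. -/
def H10grad {Ω : Set Plane} (u : H10 Ω) : Plane → Plane := (u : L2Pair Ω).snd

/-- `H⁻¹(Ω)`, the dual of `H¹₀(Ω)`. -/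
abbrev Hneg1 (Ω : Set Plane) : Type := StrongDual ℝ (H10 Ω)

/-- Weak convergence in `H¹₀(Ω)`. -/
def WeakTendsto {Ω : Set Plane} (u : ℕ → H10 Ω) (v : H10 Ω) : Prop :=
  ∀ g : Hneg1 Ω, Tendsto (fun n => g (u n)) atTop (𝓝 (g v))

/-- The class `M_K(Ω)` of bounded conductivities with ellipticity constant `K`. -/
def MK (K : ℝ) (Ω : Set Plane) : Set (Plane → PlaneMat) :=
  {σ | MemLp σ ∞ (volume.restrict Ω) ∧
    ∀ᵐ x ∂(volume.restrict Ω), ∀ ξ : Plane,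
      K⁻¹ * ‖ξ‖ ^ 2 ≤ ⟪σ x ξ, ξ⟫ ∧ ⟪σ x ξ, ξ⟫ ≤ K * ‖ξ‖ ^ 2}

/-- The form `l_σ(u, v) = ∫_Ω ⟨σ ∇u, ∇v⟩` on `H¹₀(Ω)`. -/
def energyForm {Ω : Set Plane} (σ : Plane → PlaneMat) (u v : H10 Ω) : ℝ :=
  ∫ x in Ω, ⟪σ x (H10grad u x), H10grad v x⟫

/-- `u ∈ H¹₀(Ω)` is the weak solution of `(L_σ - lam) u = f`, where `L_σ u = -∇·(σ ∇u)`; that is,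
`u = (L_σ - lam)⁻¹ f`. -/
def IsWeakSol {Ω : Set Plane} (σ : Plane → PlaneMat) (lam : ℝ) (f : Hneg1 Ω) (u : H10 Ω) : Prop :=
  ∀ v : H10 Ω, energyForm σ u v - lam * ∫ x in Ω, H10val u x * H10val v x = f v

/-- `Λ` is a common lower bound for the operators `L_σ`, `σ ∈ M_K(Ω)`, in `L²(Ω)`, so that no
`L_σ` has spectrum in `(-∞, Λ)`. -/
def IsSpectralLowerBound (K : ℝ) (Ω : Set Plane) (Λ : ℝ) : Prop :=
  ∀ σ ∈ MK K Ω, ∀ u : H10 Ω, Λ * ∫ x in Ω, H10val u x ^ 2 ≤ energyForm σ u u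

/-- G-convergence of `σ_n ∈ M_K(Ω)` to `σ ∈ M_K(Ω)`: for all `lam` below the spectra of the
operators `L_τ`, `τ ∈ M_K(Ω)` (`lam = 0` is one of them if `Ω` is bounded), and for all
`f ∈ H⁻¹(Ω)`, `(L_{σ_n} - lam)⁻¹ f` converges to `(L_σ - lam)⁻¹ f` weakly in `H¹₀(Ω)`. -/
def GConverges (K : ℝ) (Ω : Set Plane) (σn : ℕ → Plane → PlaneMat) (σ : Plane → PlaneMat) : Prop :=
  ∀ Λ : ℝ, IsSpectralLowerBound K Ω Λ → ∀ lam < Λ, ∀ f : Hneg1 Ω,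
    ∃ (u : ℕ → H10 Ω) (v : H10 Ω),
      (∀ n, IsWeakSol (σn n) lam f (u n)) ∧ IsWeakSol σ lam f v ∧ WeakTendsto u v

/-- `F ∈ W^{1,2}_loc(ℝ²; ℝ²)` with weak differential `DF`. -/
structure HasW12locDeriv (F : Plane → Plane) (DF : Plane → PlaneMat) : Prop where
  memLp : ∀ S : Set Plane, IsCompact S → MemLp F 2 (volume.restrict S)
  memLp_deriv : ∀ S : Set Plane, IsCompact S → MemLp DF 2 (volume.restrict S)
  integral_eq : ∀ φ : Plane → ℝ, IsTestFun univ φ → ∀ v : Plane,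
    ∫ x, (fderiv ℝ φ x v) • F x = -∫ x, φ x • DF x v

/-- The homeomorphism `F` of the plane is `K`-quasiconformal, with weak differential `DF`. -/
structure IsQuasiconformal (K : ℝ) (F : Plane ≃ₜ Plane) (DF : Plane → PlaneMat) : Prop where
  one_le : 1 ≤ K
  sobolev : HasW12locDeriv F DF
  distortion : ∀ᵐ x, ‖DF x‖ ^ 2 ≤ K * (DF x).det

/-- The push-forward `F_* σ (y) = J_F(x)⁻¹ DF(x) σ(x) DF(x)ᵗ`, where `x = F⁻¹(y)`. -/
def pushForward (F : Plane ≃ₜ Plane) (DF : Plane → PlaneMat) (σ : Plane → PlaneMat) :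
    Plane → PlaneMat :=
  fun y => (DF (F.symm y)).det⁻¹ •
    (DF (F.symm y) ∘L σ (F.symm y) ∘L ContinuousLinearMap.adjoint (DF (F.symm y)))

end

/-! Composition with F is an isomorphism T of H¹₀(Ω). It acts on gradients by w ↦ DF(x)ᵗ w(F(x)),
and the factor J_F⁻¹ in the push-forward is what the change of variables y = F(x) needs in order
that ℓ_{F_*σ}(u, v) = ℓ_σ(Tu, Tv) (`IsQCSelfMap.energyForm_pushForward`). Hence u solves L_{F_*σ} u
= f exactly when Tu solves L_σ(Tu) = f ∘ T⁻¹, and a bounded isomorphism preserves weak convergence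
in both directions.

This treats only the spectral parameter 0, since T does not preserve the L² inner product. By
`gConverges_iff` that is enough. Let v solve (L_σ - lam)v = f, and let w_n solve L_{σ_n} w_n = f +
lam v. Convergence at 0 gives w_n ⇀ v, so w_n → v in L² by Rellich. The solutions u_n of (L_{σ_n} -
lam)u_n = f satisfy (L_{σ_n} - lam)(w_n - u_n) = lam(v - w_n), and uniform coercivity yields w_n -
u_n → 0 in norm.

The remaining work is the construction of T, which rests on weak derivatives alone; neither
quasiconformality of F⁻¹ nor positivity of J_F almost everywhere is invoked. Since F(x) - x vanishes
on ∂Ω, on Ω the map F is a uniform limit of smooth maps Φ_n that are the identity near the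
complement of Ω, with DΦ_n → DF in L² (`HasW12locDeriv.exists_smooth_approx`). The Jacobian is
quadratic in dimension two, so Jacobians converge in L¹, and the identities expressing that
cofactors are divergence free pass to the limit. One of them, tested with sines and cosines, says
that F maps J_F dx to Lebesgue measure on Ω (`HasW12locDeriv.map_withDensity_det`). Another is the
weak chain rule for ψ ∘ F⁻¹. Where J_F = 0 the distortion inequality forces DF = 0, so that set
contributes nothing.

A continuous function with L² gradient that vanishes on ∂Ω is a limit of test functions
(`HasWeakGradient.exists_isTestFun`); this places ψ ∘ F⁻¹ in H¹₀(Ω). Pull-back and push-forward are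
first bounded operators on L² vector fields. By Poincaré's inequality the gradient embeds H¹₀(Ω)
with closed range, so operators preserving gradients lift to H¹₀(Ω) (`IsQCSelfMap.exists_equiv`). -/

noncomputable section

/-! ### Linear algebra of the plane -/

/-- The standard basis vectors of the plane. -/
abbrev planeBasis (i : Fin 2) : Plane := EuclideanSpace.single i 1

lemma plane_eq_sum (v : Plane) : v = v 0 • planeBasis 0 + v 1 • planeBasis 1 := by
  ext i; fin_cases i <;> simp

lemma plane_inner (v w : Plane) : ⟪v, w⟫ = v 0 * w 0 + v 1 * w 1 := by
  simp [PiLp.inner_apply, Fin.sum_univ_two, mul_comm]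

/-- The rotation of the plane by a right angle. -/
def planeRot : PlaneMat := Matrix.toEuclideanCLM (𝕜 := ℝ) (n := Fin 2) !![0, -1; 1, 0]

@[simp] lemma planeRot_zero (v : Plane) : planeRot v 0 = -v 1 := by
  simp [planeRot, Matrix.ofLp_toEuclideanCLM, Matrix.mulVec, dotProduct, Fin.sum_univ_two]

@[simp] lemma planeRot_one (v : Plane) : planeRot v 1 = v 0 := by
  simp [planeRot, Matrix.ofLp_toEuclideanCLM, Matrix.mulVec, dotProduct, Fin.sum_univ_two]

@[simp] lemma norm_planeRot (v : Plane) : ‖planeRot v‖ = ‖v‖ := by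
  simp [EuclideanSpace.norm_eq, Fin.sum_univ_two, add_comm]

/-- The adjugate (transposed cofactor matrix) of a `2 × 2` matrix. -/
def planeAdj (A : PlaneMat) : PlaneMat :=
  -(planeRot ∘L ContinuousLinearMap.adjoint A ∘L planeRot)

lemma planeAdj_apply (A : PlaneMat) (v : Plane) :
    planeAdj A v = -planeRot (ContinuousLinearMap.adjoint A (planeRot v)) := rfl

lemma adjoint_apply_coord (A : PlaneMat) (v : Plane) (i : Fin 2) :
    ContinuousLinearMap.adjoint A v i = A (planeBasis i) 0 * v 0 + A (planeBasis i) 1 * v 1 := by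
  have h := ContinuousLinearMap.adjoint_inner_left A (planeBasis i) v
  rw [plane_inner v] at h
  rw [show ContinuousLinearMap.adjoint A v i
    = ⟪ContinuousLinearMap.adjoint A v, planeBasis i⟫ by fin_cases i <;> simp [plane_inner], h]
  ring

lemma apply_coord (A : PlaneMat) (v : Plane) (i : Fin 2) :
    A v i = v 0 * A (planeBasis 0) i + v 1 * A (planeBasis 1) i := by
  conv_lhs => rw [plane_eq_sum v]
  simp

lemma plane_det_eq (A : PlaneMat) :
    A.det = A (planeBasis 0) 0 * A (planeBasis 1) 1 - A (planeBasis 1) 0 * A (planeBasis 0) 1 := by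
  rw [ContinuousLinearMap.det, ← LinearMap.det_toMatrix (EuclideanSpace.basisFun (Fin 2) ℝ).toBasis,
    Matrix.det_fin_two]
  simp [LinearMap.toMatrix_apply]

lemma apply_planeAdj (A : PlaneMat) (v : Plane) : A (planeAdj A v) = A.det • v := by
  ext i
  rw [apply_coord]
  fin_cases i <;> simp [planeAdj_apply, adjoint_apply_coord, plane_det_eq] <;> ring

lemma planeAdj_apply_apply (A : PlaneMat) (v : Plane) : planeAdj A (A v) = A.det • v := by
  ext i
  have := apply_coord A v
  fin_cases i <;> simp [planeAdj_apply, adjoint_apply_coord, plane_det_eq, apply_coord A v] <;> ring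

lemma norm_adjoint_apply_le (A : PlaneMat) (v : Plane) :
    ‖ContinuousLinearMap.adjoint A v‖ ≤ ‖A‖ * ‖v‖ := by
  simpa using (ContinuousLinearMap.adjoint A).le_opNorm v

lemma norm_planeAdj_apply_le (A : PlaneMat) (v : Plane) : ‖planeAdj A v‖ ≤ ‖A‖ * ‖v‖ := by
  rw [planeAdj_apply, norm_neg, norm_planeRot]
  simpa using norm_adjoint_apply_le A (planeRot v)

lemma planeAdj_sub (A B : PlaneMat) : planeAdj (A - B) = planeAdj A - planeAdj B := by
  ext1 v; simp [planeAdj_apply]; abel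

lemma continuous_planeAdj : Continuous planeAdj := by
  unfold planeAdj
  have h : Continuous fun A : PlaneMat => ContinuousLinearMap.adjoint A :=
    ContinuousLinearMap.adjoint.continuous
  exact (continuous_const.clm_comp (h.clm_comp continuous_const)).neg

lemma adjoint_planeAdj_apply (A : PlaneMat) (v : Plane) :
    ContinuousLinearMap.adjoint (planeAdj A) v = planeAdj (ContinuousLinearMap.adjoint A) v := by
  refine ext_inner_right ℝ fun w => ?_
  rw [ContinuousLinearMap.adjoint_inner_left]
  simp only [plane_inner, planeAdj_apply, PiLp.neg_apply, planeRot_zero, planeRot_one,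
    adjoint_apply_coord, ContinuousLinearMap.adjoint_adjoint, apply_coord A (planeRot v)]
  ring

lemma continuous_plane_det : Continuous fun A : PlaneMat => A.det := by
  simp_rw [plane_det_eq]
  fun_prop

/-- The adjugate is linear in dimension two, so A adj(A) - B adj(B) telescopes as A adj(A - B) + (A
- B) adj(B). This is the source of the L¹ convergence of Jacobians. -/
lemma abs_det_sub_det_le (A B : PlaneMat) : |A.det - B.det| ≤ ‖A - B‖ * (‖A‖ + ‖B‖) := by
  have h : (A.det - B.det) • planeBasis 0
      = A (planeAdj (A - B) (planeBasis 0)) + (A - B) (planeAdj B (planeBasis 0)) := by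
    rw [planeAdj_sub]
    simp [sub_smul, ← apply_planeAdj]
  have e : ‖planeBasis 0‖ = 1 := by simp
  calc |A.det - B.det| = ‖(A.det - B.det) • planeBasis 0‖ := by rw [norm_smul, e]; simp
    _ ≤ ‖A‖ * (‖A - B‖ * 1) + ‖A - B‖ * (‖B‖ * 1) := by
      rw [h, ← e]
      refine (norm_add_le _ _).trans (add_le_add ?_ ?_)
      · exact (A.le_opNorm _).trans (by gcongr; exact norm_planeAdj_apply_le _ _)
      · exact ((A - B).le_opNorm _).trans (by gcongr; exact norm_planeAdj_apply_le _ _)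
    _ = _ := by ring

lemma planeMat_det_adjoint (A : PlaneMat) : (ContinuousLinearMap.adjoint A).det = A.det := by
  rw [plane_det_eq, plane_det_eq]
  simp [adjoint_apply_coord]; ring

/-- The adjugate of Aᵗ undoes Aᵗ up to the determinant and has norm at most ‖A‖. Together with the
distortion inequality this bounds Aᵗ from below, which gives the lower ellipticity bound of the
push-forward. -/
lemma abs_det_mul_norm_le (A : PlaneMat) (v : Plane) :
    |A.det| * ‖v‖ ≤ ‖A‖ * ‖ContinuousLinearMap.adjoint A v‖ := by
  have h := planeAdj_apply_apply (ContinuousLinearMap.adjoint A) v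
  rw [planeMat_det_adjoint] at h
  have := norm_planeAdj_apply_le (ContinuousLinearMap.adjoint A) (ContinuousLinearMap.adjoint A v)
  rw [h, norm_smul] at this
  simpa using this

lemma inner_gradient (φ : Plane → ℝ) (x v : Plane) : ⟪gradient φ x, v⟫ = fderiv ℝ φ x v := by
  simp [gradient]

lemma norm_gradient (φ : Plane → ℝ) (x : Plane) : ‖gradient φ x‖ = ‖fderiv ℝ φ x‖ := by
  simp [gradient]

end
noncomputable section

/-! ### Integration by parts for smooth functions -/

/-- One integration by parts moves the derivative of b onto s; the second derivative of s is
symmetric. -/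
lemma integral_fderiv_mul_fderiv_comm {b s : Plane → ℝ} (hb : ContDiff ℝ 1 b)
    (hbc : HasCompactSupport b) (hs : ContDiff ℝ 2 s) (v w : Plane) :
    ∫ x, fderiv ℝ b x v * fderiv ℝ s x w = ∫ x, fderiv ℝ b x w * fderiv ℝ s x v := by
  have hs' : ContDiff ℝ 1 (fderiv ℝ s) := hs.fderiv_right (by norm_num)
  have hb' : Continuous (fderiv ℝ b) := hb.continuous_fderiv (by norm_num)
  have hs'' : Continuous (fderiv ℝ (fderiv ℝ s)) := hs'.continuous_fderiv (by norm_num)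
  have hd : ∀ x v w, fderiv ℝ (fun x => fderiv ℝ s x w) x v = fderiv ℝ (fderiv ℝ s) x v w := by
    intro x v w
    have := ((hs'.differentiable (by norm_num) x).hasFDerivAt.clm_apply
      (hasFDerivAt_const w x)).fderiv
    rw [this]; simp
  have key : ∀ v w, ∫ x, fderiv ℝ b x v * fderiv ℝ s x w
      = - ∫ x, b x * fderiv ℝ (fderiv ℝ s) x v w := by
    intro v w
    have h := integral_mul_fderiv_eq_neg_fderiv_mul_of_integrable (μ := (volume : Measure Plane))
      (f := b) (g := fun x => fderiv ℝ s x w) (v := v) ?_ ?_ ?_ ?_ ?_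
    · simp_rw [hd] at h
      rw [h, neg_neg]
    · exact Continuous.integrable_of_hasCompactSupport
        ((hb'.clm_apply continuous_const).mul (hs'.continuous.clm_apply continuous_const))
        (hbc.fderiv_apply ℝ v).mul_right
    · simp_rw [hd]
      exact Continuous.integrable_of_hasCompactSupport
        (hb.continuous.mul ((hs''.clm_apply continuous_const).clm_apply continuous_const))
        hbc.mul_right
    · exact Continuous.integrable_of_hasCompactSupport
        (hb.continuous.mul (hs'.continuous.clm_apply continuous_const)) hbc.mul_right
    · exact fun x _ => hb.differentiable (by norm_num) x
    · exact fun x _ => (hs'.clm_apply contDiff_const).differentiable (by norm_num) x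
  rw [key, key]
  congr 1
  refine integral_congr_ae (.of_forall fun x => ?_)
  have : IsSymmSndFDerivAt ℝ s x := hs.contDiffAt.isSymmSndFDerivAt (by simp)
  simp only [this.eq v w]

/-- The columns of the cofactor matrix of a differential are divergence free. -/
lemma integral_fderiv_planeAdj_fderiv {Φ : Plane → Plane} (hΦ : ContDiff ℝ 2 Φ) {b : Plane → ℝ}
    (hb : ContDiff ℝ 1 b) (hbc : HasCompactSupport b) (v : Plane) :
    ∫ x, fderiv ℝ b x (planeAdj (fderiv ℝ Φ x) v) = 0 := by
  -- Since adj(DΦ)v is minus the rotated gradient of s, the integrand is the Jacobian determinant of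
  -- (b, s).
  set s : Plane → ℝ := fun x => ⟪Φ x, planeRot v⟫ with hs_def
  have hs : ContDiff ℝ 2 s := hΦ.inner ℝ contDiff_const
  have hb' : Continuous (fderiv ℝ b) := hb.continuous_fderiv (by norm_num)
  have hs' : Continuous (fderiv ℝ s) := hs.continuous_fderiv (by norm_num)
  have hds : ∀ x w, fderiv ℝ s x w = ⟪fderiv ℝ Φ x w, planeRot v⟫ := by
    intro x w
    have h := (hΦ.differentiable (by norm_num) x).hasFDerivAt.inner ℝ
      (hasFDerivAt_const (planeRot v) x)
    rw [h.fderiv]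
    simp
  have hpt : ∀ x, fderiv ℝ b x (planeAdj (fderiv ℝ Φ x) v)
      = fderiv ℝ b x (planeBasis 0) * fderiv ℝ s x (planeBasis 1)
        - fderiv ℝ b x (planeBasis 1) * fderiv ℝ s x (planeBasis 0) := by
    intro x
    rw [plane_eq_sum (planeAdj (fderiv ℝ Φ x) v), map_add, map_smul, map_smul, hds, hds,
      plane_inner, plane_inner, planeAdj_apply]
    simp [adjoint_apply_coord]
    ring
  have hint : ∀ v w, Integrable fun x => fderiv ℝ b x v * fderiv ℝ s x w := fun v w =>
    Continuous.integrable_of_hasCompactSupport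
      ((hb'.clm_apply continuous_const).mul (hs'.clm_apply continuous_const))
      (hbc.fderiv_apply ℝ v).mul_right
  simp_rw [hpt]
  rw [integral_sub (hint _ _) (hint _ _), integral_fderiv_mul_fderiv_comm hb hbc hs, sub_self]

/-- Divergence-freeness of the cofactors is applied to the product a · (φ ∘ Φ). The product rule
gives two terms, and DΦ adj(DΦ) = det DΦ turns the one containing φ' into the Jacobian. -/
lemma integral_mul_fderiv_comp_mul_det {Φ : Plane → Plane} (hΦ : ContDiff ℝ 2 Φ) {a : Plane → ℝ}
    (ha : ContDiff ℝ 1 a) (hac : HasCompactSupport a) {φ : Plane → ℝ} (hφ : ContDiff ℝ 1 φ)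
    (v : Plane) :
    ∫ x, a x * (fderiv ℝ φ (Φ x) v * (fderiv ℝ Φ x).det)
      = -∫ x, φ (Φ x) * fderiv ℝ a x (planeAdj (fderiv ℝ Φ x) v) := by
  have hΦ1 : ContDiff ℝ 1 Φ := hΦ.of_le (by norm_num)
  have hφΦ : ContDiff ℝ 1 fun x => φ (Φ x) := hφ.comp hΦ1
  have h := integral_fderiv_planeAdj_fderiv hΦ (ha.mul hφΦ) hac.mul_right v
  have ha' : Continuous (fderiv ℝ a) := ha.continuous_fderiv (by norm_num)
  have hφ' : Continuous (fderiv ℝ φ) := hφ.continuous_fderiv (by norm_num)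
  have hΦ' : Continuous (fderiv ℝ Φ) := hΦ.continuous_fderiv (by norm_num)
  have hpt : ∀ x, fderiv ℝ (fun x => a x * φ (Φ x)) x (planeAdj (fderiv ℝ Φ x) v)
      = a x * (fderiv ℝ φ (Φ x) v * (fderiv ℝ Φ x).det)
        + φ (Φ x) * fderiv ℝ a x (planeAdj (fderiv ℝ Φ x) v) := by
    intro x
    have h2 : HasFDerivAt (fun x => φ (Φ x)) ((fderiv ℝ φ (Φ x)).comp (fderiv ℝ Φ x)) x :=
      (hφ.differentiable (by norm_num) _).hasFDerivAt.comp x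
        (hΦ1.differentiable (by norm_num) x).hasFDerivAt
    rw [((ha.differentiable (by norm_num) x).hasFDerivAt.fun_mul h2).fderiv]
    simp only [add_apply, smul_apply, ContinuousLinearMap.comp_apply, apply_planeAdj, map_smul,
      smul_eq_mul]
    ring
  simp_rw [hpt] at h
  rw [integral_add] at h
  · linarith
  · refine Continuous.integrable_of_hasCompactSupport ?_ hac.mul_right
    exact ha.continuous.mul (((hφ'.comp hΦ.continuous).clm_apply continuous_const).mul
      (continuous_plane_det.comp hΦ'))
  · refine Continuous.integrable_of_hasCompactSupport ?_ ?_
    · exact (hφ.continuous.comp hΦ.continuous).mul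
        (ha'.clm_apply ((continuous_planeAdj.comp hΦ').clm_apply continuous_const))
    · refine HasCompactSupport.mul_left ((hac.fderiv ℝ).mono fun x hx => ?_)
      rw [Function.mem_support] at hx ⊢
      contrapose! hx
      simp [hx]

/-- The change of variables formula for smooth maps that are the identity near the complement of a
bounded open set. -/
lemma setIntegral_fderiv_comp_mul_det {Ω : Set Plane} (hΩo : IsOpen Ω)
    (hΩb : Bornology.IsBounded Ω) {Φ : Plane → Plane} (hΦ : ContDiff ℝ 2 Φ)
    (hsupp : tsupport (fun x => Φ x - x) ⊆ Ω) {φ : Plane → ℝ} (hφ : ContDiff ℝ 1 φ) (v : Plane) :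
    ∫ x in Ω, fderiv ℝ φ (Φ x) v * (fderiv ℝ Φ x).det = ∫ x in Ω, fderiv ℝ φ x v := by
  obtain ⟨R, hR0, hR⟩ := hΩb.subset_ball_lt 0 0
  -- The weight χ equals 1 on Ω, so Dχ lives outside Ω, where Φ is the identity. The terms with Dχ
  -- therefore agree for Φ and for the identity map, and so do the integrals against χ.
  let χ : ContDiffBump (0 : Plane) := ⟨R, R + 1, hR0, by linarith⟩
  have hχ1 : ∀ x ∈ Ω, χ x = 1 := fun x hx =>
    χ.one_of_mem_closedBall (Metric.ball_subset_closedBall (hR hx))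
  have hχ' : ∀ x ∈ Ω, fderiv ℝ χ x = 0 := by
    intro x hx
    have : (χ : Plane → ℝ) =ᶠ[𝓝 x] fun _ => 1 := by
      filter_upwards [hΩo.mem_nhds hx] with y hy using hχ1 y hy
    rw [this.fderiv_eq]; simp
  have hid : ∀ x ∉ Ω, Φ x = x ∧ fderiv ℝ Φ x = ContinuousLinearMap.id ℝ Plane := by
    intro x hx
    have h : (fun x => Φ x - x) =ᶠ[𝓝 x] 0 := notMem_tsupport_iff_eventuallyEq.1 fun h => hx (hsupp h)
    have h' : Φ =ᶠ[𝓝 x] id := by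
      filter_upwards [h] with y hy using sub_eq_zero.1 hy
    exact ⟨h'.eq_of_nhds, by rw [h'.fderiv_eq, fderiv_id]⟩
  have hχC : ContDiff ℝ 1 χ := χ.contDiff
  have hχc : HasCompactSupport χ := χ.hasCompactSupport
  have e1 := integral_mul_fderiv_comp_mul_det hΦ hχC hχc hφ v
  have e2 := integral_mul_fderiv_comp_mul_det contDiff_id hχC hχc hφ v
  have e3 : ∫ x, φ (Φ x) * fderiv ℝ χ x (planeAdj (fderiv ℝ Φ x) v)
      = ∫ x, φ (id x) * fderiv ℝ χ x (planeAdj (fderiv ℝ id x) v) := by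
    refine integral_congr_ae (.of_forall fun x => ?_)
    by_cases hx : x ∈ Ω
    · simp [hχ' x hx]
    · simp [hid x hx]
  rw [e3, ← e2] at e1
  have hφ' : Continuous (fderiv ℝ φ) := hφ.continuous_fderiv (by norm_num)
  have hΦ' : Continuous (fderiv ℝ Φ) := hΦ.continuous_fderiv (by norm_num)
  have c1 : Continuous fun x => fderiv ℝ φ (Φ x) v * (fderiv ℝ Φ x).det :=
    ((hφ'.comp hΦ.continuous).clm_apply continuous_const).mul (continuous_plane_det.comp hΦ')
  have c2 : Continuous fun x => fderiv ℝ φ x v := hφ'.clm_apply continuous_const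
  have hcl : IsCompact (closure Ω) := hΩb.isCompact_closure
  have i1 := (c1.continuousOn.integrableOn_compact (μ := volume) hcl).mono_set subset_closure
  have i2 := (c2.continuousOn.integrableOn_compact (μ := volume) hcl).mono_set subset_closure
  rw [← sub_eq_zero, ← integral_sub i1 i2]
  rw [← sub_eq_zero, ← integral_sub] at e1
  · rw [← e1, ← integral_indicator hΩo.measurableSet]
    refine integral_congr_ae (.of_forall fun x => ?_)
    by_cases hx : x ∈ Ω
    · simp [hx, hχ1 x hx, ContinuousLinearMap.det]
    · simp [hx, hid x hx]
  · exact (hχC.continuous.mul c1).integrable_of_hasCompactSupport hχc.mul_right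
  · refine Continuous.integrable_of_hasCompactSupport (hχC.continuous.mul ?_) hχc.mul_right
    simpa [ContinuousLinearMap.det] using c2

/-- Poincaré's inequality for test functions. -/
lemma IsTestFun.poincare {Ω : Set Plane} {R : ℝ} (hR : ∀ x ∈ Ω, ‖x‖ ≤ R)
    {φ : Plane → ℝ} (hφ : IsTestFun Ω φ) :
    ∫ x, φ x ^ 2 ≤ (2 * R) ^ 2 * ∫ x, ‖gradient φ x‖ ^ 2 := by
  have hφ1 : ContDiff ℝ 1 φ := hφ.smooth.of_le (by simp)
  have hφ' : Continuous (fderiv ℝ φ) := hφ1.continuous_fderiv (by norm_num)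
  have hφd := hφ1.differentiable (by norm_num)
  have hφc := hφ.compact
  -- The first coordinate p has derivative 1 along e₀ and is at most R in modulus on Ω; integrating
  -- ∫ φ² ∂₀p by parts gives ∫ φ² = -∫ 2 φ ∂₀φ p.
  let p : Plane →L[ℝ] ℝ := innerSL ℝ (planeBasis 0)
  have hp : ∀ x, |p x| ≤ ‖x‖ := fun x => by
    simpa [p] using abs_real_inner_le_norm (planeBasis 0) x
  have hd : ∀ x, fderiv ℝ (fun x => φ x * φ x) x (planeBasis 0)
      = 2 * φ x * fderiv ℝ φ x (planeBasis 0) := fun x => by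
    rw [((hφd x).hasFDerivAt.fun_mul (hφd x).hasFDerivAt).fderiv]; simp; ring
  have hib := integral_mul_fderiv_eq_neg_fderiv_mul_of_integrable (μ := (volume : Measure Plane))
      (f := fun x => φ x * φ x) (g := p) (v := planeBasis 0) ?_ ?_ ?_ ?_ ?_
  rotate_left
  · simp_rw [hd]
    exact Continuous.integrable_of_hasCompactSupport (by fun_prop)
      hφc.mul_left.mul_right.mul_right
  · simp only [ContinuousLinearMap.fderiv]
    exact Continuous.integrable_of_hasCompactSupport (by have := hφ1.continuous; fun_prop)
      hφc.mul_right.mul_right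
  · exact Continuous.integrable_of_hasCompactSupport (by have := hφ1.continuous; fun_prop)
      hφc.mul_right.mul_right
  · exact fun x _ => (hφd x).mul (hφd x)
  · exact fun x _ => p.differentiableAt
  have hi1 : Integrable fun x => φ x ^ 2 :=
    Continuous.integrable_of_hasCompactSupport (by have := hφ1.continuous; fun_prop)
      (hφc.comp_left (g := fun t : ℝ => t ^ 2) (by simp))
  have hi2 : Integrable fun x => ‖gradient φ x‖ ^ 2 := by
    simp_rw [norm_gradient]
    exact Continuous.integrable_of_hasCompactSupport (by fun_prop)
      ((hφc.fderiv ℝ).comp_left (g := fun t => ‖t‖ ^ 2) (by simp))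
  -- Young's inequality with weights chosen so that half of ∫ φ² is absorbed on the left; the
  -- constant left over is 4R².
  have hpt : ∀ x, -(2 * φ x * fderiv ℝ φ x (planeBasis 0) * p x)
      ≤ φ x ^ 2 / 2 + 2 * R ^ 2 * ‖gradient φ x‖ ^ 2 := by
    intro x
    by_cases hx : x ∈ Ω
    · have h1 : |fderiv ℝ φ x (planeBasis 0)| ≤ ‖gradient φ x‖ := by
        rw [norm_gradient]; simpa using (fderiv ℝ φ x).le_opNorm (planeBasis 0)
      have h2 := (hp x).trans (hR x hx)
      have h3 : -(2 * φ x * fderiv ℝ φ x (planeBasis 0) * p x)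
          ≤ 2 * |φ x| * (‖gradient φ x‖ * R) := by
        refine (neg_le_abs _).trans ?_
        rw [abs_mul, abs_mul, abs_mul, abs_two, mul_assoc]
        gcongr
      have h4 := sq_nonneg (|φ x| - 2 * R * ‖gradient φ x‖)
      rw [← sq_abs (φ x)]
      nlinarith
    · have : φ x = 0 := image_eq_zero_of_notMem_tsupport fun h => hx (hφ.support_subset h)
      simp only [this]
      simp
      positivity
  have hmain : ∫ x, φ x ^ 2 ≤ (∫ x, φ x ^ 2) / 2 + 2 * R ^ 2 * ∫ x, ‖gradient φ x‖ ^ 2 := by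
    calc ∫ x, φ x ^ 2 = ∫ x, -(2 * φ x * fderiv ℝ φ x (planeBasis 0) * p x) := by
          simp_rw [hd] at hib
          rw [integral_neg, ← hib]
          refine integral_congr_ae (.of_forall fun x => ?_)
          simp only [ContinuousLinearMap.fderiv]
          simp [p, pow_two]
      _ ≤ ∫ x, (φ x ^ 2 / 2 + 2 * R ^ 2 * ‖gradient φ x‖ ^ 2) := by
          refine integral_mono ?_ ((hi1.div_const 2).add (hi2.const_mul _)) hpt
          exact (Continuous.integrable_of_hasCompactSupport (by have := hφ1.continuous; fun_prop)
            hφc.mul_left.mul_right.mul_right).neg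
      _ = _ := by
          rw [integral_add (hi1.div_const 2) (hi2.const_mul _), integral_div, integral_const_mul]
  linarith

end
noncomputable section

/-! ### Mollification -/

/-! ### Square norms as lower integrals, and dominated convergence in L² -/

section L2

variable {α E : Type*} [MeasurableSpace α] [NormedAddCommGroup E]

lemma eLpNorm_two_sq (f : α → E) (μ : Measure α) :
    eLpNorm f 2 μ ^ 2 = ∫⁻ x, ‖f x‖ₑ ^ 2 ∂μ := by
  have := eLpNorm_nnreal_pow_eq_lintegral (μ := μ) (f := f) (p := 2) (by norm_num)
  simpa using this

lemma eLpNorm_two_le_iff (f : α → E) (μ : Measure α) (C : ℝ≥0∞) :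
    eLpNorm f 2 μ ≤ C ↔ ∫⁻ x, ‖f x‖ₑ ^ 2 ∂μ ≤ C ^ 2 := by
  rw [← eLpNorm_two_sq, ENNReal.pow_le_pow_left_iff two_ne_zero]

lemma sq_lintegral_le {ν : Measure α} [IsProbabilityMeasure ν] {f : α → ℝ≥0∞}
    (hf : AEMeasurable f ν) : (∫⁻ x, f x ∂ν) ^ 2 ≤ ∫⁻ x, f x ^ 2 ∂ν := by
  have h := eLpNorm_le_eLpNorm_of_exponent_le (p := 1) (q := 2) (μ := ν) (by norm_num)
    hf.aestronglyMeasurable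
  have h2 := eLpNorm_nnreal_pow_eq_lintegral (μ := ν) (f := f) (p := 2) (by norm_num)
  rw [eLpNorm_one_eq_lintegral_enorm] at h
  simp only [enorm_eq_self, ENNReal.coe_ofNat, NNReal.coe_ofNat, ENNReal.rpow_ofNat] at h h2
  rw [← h2]
  gcongr

/-- Dominated convergence in `L²`. -/
lemma tendsto_eLpNorm_two_of_dominated {μ : Measure α} {f : ℕ → α → E} {b : α → ℝ}
    (hf : ∀ i, AEStronglyMeasurable (f i) μ) (hb : MemLp b 2 μ)
    (hle : ∀ i, ∀ᵐ x ∂μ, ‖f i x‖ ≤ b x)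
    (hlim : ∀ᵐ x ∂μ, Tendsto (fun i => f i x) atTop (𝓝 0)) :
    Tendsto (fun i => eLpNorm (f i) 2 μ) atTop (𝓝 0) := by
  have h2 : Tendsto (fun i => ∫⁻ x, ‖f i x‖ₑ ^ 2 ∂μ) atTop (𝓝 0) := by
    have := tendsto_lintegral_of_dominated_convergence' (μ := μ)
      (F := fun i x => ‖f i x‖ₑ ^ 2) (f := fun _ => 0) (fun x => ‖b x‖ₑ ^ 2)
      (fun i => (hf i).enorm.pow_const 2) ?_ ?_ ?_
    · simpa using this
    · intro i
      filter_upwards [hle i] with x hx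
      gcongr
      exact enorm_le_iff_norm_le.2 (hx.trans (le_abs_self _))
    · rw [← eLpNorm_two_sq]
      exact (ENNReal.pow_lt_top hb.2).ne
    · filter_upwards [hlim] with x hx
      have h0 : Tendsto (fun i => ‖f i x‖ₑ ^ 2) atTop (𝓝 (‖(0 : E)‖ₑ ^ 2)) := by
        exact (ENNReal.continuous_pow 2).continuousAt.tendsto.comp hx.enorm
      simpa using h0
  have h3 : Tendsto (fun i => (∫⁻ x, ‖f i x‖ₑ ^ 2 ∂μ) ^ (1 / 2 : ℝ)) atTop (𝓝 0) := by
    have := (ENNReal.continuous_rpow_const (y := (1 / 2 : ℝ))).continuousAt.tendsto.comp h2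
    rw [ENNReal.zero_rpow_of_pos (by norm_num)] at this
    exact this
  refine h3.congr fun i => ?_
  rw [← eLpNorm_two_sq, ← ENNReal.rpow_natCast, ← ENNReal.rpow_mul]
  norm_num

end L2

open scoped Convolution
open ContinuousLinearMap (lsmul)

variable {E : Type*} [NormedAddCommGroup E] [NormedSpace ℝ E]

lemma lintegral_enorm_normed (ρ : ContDiffBump (0 : Plane)) :
    ∫⁻ t, ‖ρ.normed volume t‖ₑ = 1 := by
  have h := ofReal_integral_eq_lintegral_ofReal (μ := (volume : Measure Plane))
    ρ.integrable_normed (.of_forall ρ.nonneg_normed)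
  rw [ρ.integral_normed] at h
  rw [← ENNReal.ofReal_one, h]
  refine lintegral_congr fun x => ?_
  rw [Real.enorm_eq_ofReal (ρ.nonneg_normed x)]

/-- Young's inequality for the convolution with a probability density. -/
lemma eLpNorm_normed_convolution_le (ρ : ContDiffBump (0 : Plane)) {g : Plane → E}
    (hg : AEStronglyMeasurable g volume) :
    eLpNorm (ρ.normed volume ⋆[lsmul ℝ ℝ, volume] g) 2 volume ≤ eLpNorm g 2 volume := by
  wlog hm : StronglyMeasurable g generalizing g
  · rw [convolution_congr (lsmul ℝ ℝ) (ae_eq_refl (ρ.normed volume)) hg.ae_eq_mk,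
      eLpNorm_congr_ae hg.ae_eq_mk]
    exact this hg.stronglyMeasurable_mk.aestronglyMeasurable hg.stronglyMeasurable_mk
  set w : Plane → ℝ≥0∞ := fun t => ‖ρ.normed volume t‖ₑ with hw
  have hwm : Measurable w := ρ.continuous_normed.measurable.enorm
  -- With the bump as a probability density, the square of the average is at most the average of the
  -- squares, and Tonelli with translation invariance finishes.
  let ν : Measure Plane := volume.withDensity w
  have : IsProbabilityMeasure ν := ⟨by
    rw [withDensity_apply _ .univ, Measure.restrict_univ]; exact lintegral_enorm_normed ρ⟩
  have hgm : Measurable fun y => ‖g y‖ₑ := hm.enorm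
  rw [eLpNorm_two_le_iff, eLpNorm_two_sq]
  have hpt : ∀ x, ‖(ρ.normed volume ⋆[lsmul ℝ ℝ, volume] g) x‖ₑ ^ 2
      ≤ ∫⁻ t, ‖g (x - t)‖ₑ ^ 2 ∂ν := by
    intro x
    have hx : Measurable fun t => ‖g (x - t)‖ₑ := hgm.comp (measurable_const.sub measurable_id)
    refine le_trans ?_ (sq_lintegral_le hx.aemeasurable)
    gcongr
    rw [lintegral_withDensity_eq_lintegral_mul _ hwm hx, convolution_def]
    refine (enorm_integral_le_lintegral_enorm _).trans (le_of_eq (lintegral_congr fun t => ?_))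
    simp [hw, enorm_smul]
  have hprod : Measurable fun p : Plane × Plane => ‖g (p.1 - p.2)‖ₑ ^ 2 :=
    (hgm.comp (measurable_fst.sub measurable_snd)).pow_const 2
  calc ∫⁻ x, ‖(ρ.normed volume ⋆[lsmul ℝ ℝ, volume] g) x‖ₑ ^ 2
      ≤ ∫⁻ x, ∫⁻ t, ‖g (x - t)‖ₑ ^ 2 ∂ν := lintegral_mono hpt
    _ = ∫⁻ t, (∫⁻ x, ‖g (x - t)‖ₑ ^ 2) ∂ν := lintegral_lintegral_swap hprod.aemeasurable
    _ = ∫⁻ t, (∫⁻ x, ‖g x‖ₑ ^ 2) ∂ν := by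
      refine lintegral_congr fun t => ?_
      exact lintegral_sub_right_eq_self (fun x => ‖g x‖ₑ ^ 2) t
    _ = ∫⁻ x, ‖g x‖ₑ ^ 2 := by simp

lemma normed_convolution_congr_of_ball {ρ : ContDiffBump (0 : Plane)} {f g : Plane → E}
    {x : Plane} (h : ∀ y ∈ Metric.ball x ρ.rOut, f y = g y) :
    (ρ.normed volume ⋆[lsmul ℝ ℝ, volume] f) x = (ρ.normed volume ⋆[lsmul ℝ ℝ, volume] g) x := by
  rw [convolution_def, convolution_def]
  refine integral_congr_ae (.of_forall fun t => ?_)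
  by_cases ht : t ∈ Metric.ball (0 : Plane) ρ.rOut
  · simp only
    rw [h (x - t)]
    simpa [dist_eq_norm] using ht
  · rw [← ρ.support_normed_eq (μ := volume), Function.notMem_support] at ht
    simp [ht]

variable [CompleteSpace E]

/-- Mollifications of an `L²` function converge in `L²`. -/
lemma exists_eLpNorm_normed_convolution_sub_le {g : Plane → E} (hg : MemLp g 2 volume) {η : ℝ≥0∞}
    (hη : η ≠ 0) : ∃ r > 0, ∀ ρ : ContDiffBump (0 : Plane), ρ.rOut ≤ r →
      eLpNorm (ρ.normed volume ⋆[lsmul ℝ ℝ, volume] g - g) 2 volume ≤ η := by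
  have hη3 : η / 3 ≠ 0 := by simpa using hη
  obtain ⟨c, hcc, hgc, hcont, hcL⟩ := hg.exists_hasCompactSupport_eLpNorm_sub_le (by simp) hη3
  obtain ⟨M, hM0, hM⟩ := hcc.isCompact.isBounded.subset_ball_lt 0 0
  have hvol : volume (Metric.ball (0 : Plane) (M + 1)) ≠ ⊤ := measure_ball_lt_top.ne
  -- The approximant c and its mollification at radius at most 1 both vanish outside the ball of
  -- radius M + 1, so a uniform error ε costs at most η / 3 in L².
  obtain ⟨ε, hε0, hε⟩ : ∃ ε : ℝ, 0 < ε ∧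
      volume (Metric.ball (0 : Plane) (M + 1)) ^ (2 : ℝ≥0∞).toReal⁻¹ * ENNReal.ofReal ε ≤ η / 3 := by
    have ht : Tendsto (fun ε : ℝ => volume (Metric.ball (0 : Plane) (M + 1))
        ^ (2 : ℝ≥0∞).toReal⁻¹ * ENNReal.ofReal ε) (𝓝[>] 0) (𝓝 0) := by
      have : Tendsto (fun ε : ℝ => ENNReal.ofReal ε) (𝓝[>] 0) (𝓝 0) := by
        simpa using (ENNReal.continuous_ofReal.tendsto 0).mono_left nhdsWithin_le_nhds
      simpa using ENNReal.Tendsto.const_mul this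
        (.inr (ENNReal.rpow_ne_top_of_nonneg (by positivity) hvol))
    obtain ⟨ε, h1, h2⟩ := ((ht.eventually (ge_mem_nhds (pos_iff_ne_zero.2 hη3))).and
      self_mem_nhdsWithin).exists
    exact ⟨ε, h2, h1⟩
  obtain ⟨r, hr0, hr⟩ := Metric.uniformContinuous_iff_le.1
    (hcc.uniformContinuous_of_continuous hcont) ε hε0
  refine ⟨min r 1, by positivity, fun ρ hρ => ?_⟩
  have hloc : ∀ f : Plane → E, MemLp f 2 volume → LocallyIntegrable f volume := fun f hf =>
    hf.locallyIntegrable (by norm_num)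
  have hce : ∀ f : Plane → E, MemLp f 2 volume →
      ConvolutionExists (ρ.normed volume) f (lsmul ℝ ℝ) volume := fun f hf =>
    ρ.hasCompactSupport_normed.convolutionExists_left _ ρ.continuous_normed (hloc f hf)
  have hsplit : ρ.normed volume ⋆[lsmul ℝ ℝ, volume] g - g
      = ρ.normed volume ⋆[lsmul ℝ ℝ, volume] (g - c)
        + (ρ.normed volume ⋆[lsmul ℝ ℝ, volume] c - c) + (c - g) := by
    have h := (hce _ (hg.sub hcL)).distrib_add (hce _ hcL)
    rw [sub_add_cancel] at h
    rw [h]; abel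
  have hmid : eLpNorm (ρ.normed volume ⋆[lsmul ℝ ℝ, volume] c - c) 2 volume ≤ η / 3 := by
    have hs : Function.support (ρ.normed volume ⋆[lsmul ℝ ℝ, volume] c - c)
        ⊆ Metric.ball (0 : Plane) (M + 1) := by
      intro x hx
      by_contra hxM
      apply hx
      have hz : ∀ y ∈ Metric.ball x ρ.rOut, c y = (0 : Plane → E) y := by
        intro y hy
        refine image_eq_zero_of_notMem_tsupport fun hy' => hxM ?_
        have h1 := hM hy'
        rw [mem_ball_zero_iff] at h1 ⊢
        rw [Metric.mem_ball, dist_comm, dist_eq_norm] at hy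
        have := norm_add_le (x - y) y
        rw [sub_add_cancel] at this
        have := hρ.trans (min_le_right _ _)
        linarith
      rw [Pi.sub_apply, normed_convolution_congr_of_ball hz,
        hz x (Metric.mem_ball_self ρ.rOut_pos), convolution_zero]
      simp
    rw [← eLpNorm_restrict_eq_of_support_subset hs]
    refine (eLpNorm_le_of_ae_bound (C := ε) (.of_forall fun x => ?_)).trans ?_
    · rw [Pi.sub_apply, ← dist_eq_norm]
      refine ContDiffBump.dist_normed_convolution_le hcont.aestronglyMeasurable fun y hy => ?_
      exact hr (hy.le.trans (hρ.trans (min_le_left _ _)))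
    · rwa [Measure.restrict_apply_univ]
  have hcv : ∀ f : Plane → E, MemLp f 2 volume →
      Continuous (ρ.normed volume ⋆[lsmul ℝ ℝ, volume] f) := fun f hf =>
    ρ.hasCompactSupport_normed.continuous_convolution_left _ ρ.continuous_normed (hloc f hf)
  have m1 := (hcv _ (hg.sub hcL)).aestronglyMeasurable (μ := volume)
  have m2 := ((hcv _ hcL).sub hcont).aestronglyMeasurable (μ := volume)
  rw [hsplit]
  calc _ ≤ η / 3 + η / 3 + η / 3 := by
        refine (eLpNorm_add_le (m1.add m2) (hcL.1.sub hg.1) (by norm_num)).trans ?_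
        refine add_le_add ((eLpNorm_add_le m1 m2 (by norm_num)).trans (add_le_add ?_ hmid)) ?_
        · exact (eLpNorm_normed_convolution_le ρ (hg.1.sub hcL.1)).trans hgc
        · rwa [eLpNorm_sub_comm]
    _ = η := ENNReal.add_thirds η

/-- Mollifications of a locally `L²` function converge in `L²` on bounded sets. -/
lemma exists_eLpNorm_restrict_normed_convolution_sub_le {g : Plane → E}
    (hg : ∀ S : Set Plane, IsCompact S → MemLp g 2 (volume.restrict S)) {Ω : Set Plane}
    (hΩ : MeasurableSet Ω) (hΩb : Bornology.IsBounded Ω) {η : ℝ≥0∞} (hη : η ≠ 0) :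
    ∃ r > 0, ∀ ρ : ContDiffBump (0 : Plane), ρ.rOut ≤ r →
      eLpNorm (ρ.normed volume ⋆[lsmul ℝ ℝ, volume] g - g) 2 (volume.restrict Ω) ≤ η := by
  obtain ⟨M, hM0, hM⟩ := hΩb.subset_ball_lt 0 0
  -- Mollification at radius at most 1 evaluated on Ω sees only values on this ball, so g may be
  -- replaced by its truncation, which is globally in L².
  set S := Metric.closedBall (0 : Plane) (M + 1)
  have hS : MeasurableSet S := measurableSet_closedBall
  have hg' : MemLp (S.indicator g) 2 volume :=
    (memLp_indicator_iff_restrict hS).2 (hg S (isCompact_closedBall _ _))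
  obtain ⟨r, hr0, hr⟩ := exists_eLpNorm_normed_convolution_sub_le hg' hη
  refine ⟨min r 1, by positivity, fun ρ hρ => ?_⟩
  refine le_trans ?_ ((eLpNorm_mono_measure _ (Measure.restrict_le_self (s := Ω))).trans
    (hr ρ (hρ.trans (min_le_left _ _))))
  refine (eLpNorm_congr_ae ?_).le
  filter_upwards [ae_restrict_mem hΩ] with x hx
  have h1 := mem_ball_zero_iff.1 (hM hx)
  have hxS : ∀ y ∈ Metric.ball x ρ.rOut, g y = S.indicator g y := by
    intro y hy
    rw [indicator_of_mem]
    rw [mem_closedBall_zero_iff]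
    rw [Metric.mem_ball, dist_eq_norm] at hy
    have := norm_add_le (y - x) x
    rw [sub_add_cancel] at this
    have := hρ.trans (min_le_right _ _)
    linarith
  rw [Pi.sub_apply, Pi.sub_apply, normed_convolution_congr_of_ball hxS,
    hxS x (Metric.mem_ball_self ρ.rOut_pos)]

/-- Mollifications of a continuous function converge uniformly on bounded sets. -/
lemma exists_dist_normed_convolution_le {h : Plane → E} (hh : Continuous h) {Ω : Set Plane}
    (hΩb : Bornology.IsBounded Ω) {η : ℝ} (hη : 0 < η) :
    ∃ r > 0, ∀ ρ : ContDiffBump (0 : Plane), ρ.rOut ≤ r → ∀ x ∈ Ω,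
      dist ((ρ.normed volume ⋆[lsmul ℝ ℝ, volume] h) x) (h x) ≤ η := by
  obtain ⟨M, hM0, hM⟩ := hΩb.subset_ball_lt 0 0
  have huc := (isCompact_closedBall (0 : Plane) (M + 1)).uniformContinuousOn_of_continuous
    hh.continuousOn
  obtain ⟨r, hr0, hr⟩ := Metric.uniformContinuousOn_iff_le.1 huc η hη
  refine ⟨min r 1, by positivity, fun ρ hρ x hx => ?_⟩
  have h1 := mem_ball_zero_iff.1 (hM hx)
  refine ContDiffBump.dist_normed_convolution_le hh.aestronglyMeasurable fun y hy => ?_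
  refine hr y ?_ x ?_ (hy.le.trans (hρ.trans (min_le_left _ _)))
  · rw [mem_closedBall_zero_iff]
    rw [Metric.mem_ball, dist_eq_norm] at hy
    have := norm_add_le (y - x) x
    rw [sub_add_cancel] at this
    have := hρ.trans (min_le_right _ _)
    linarith
  · rw [mem_closedBall_zero_iff]; linarith

/-- `h` is a continuous function with locally square integrable weak gradient `g`. -/
structure HasWeakGradient (h : Plane → ℝ) (g : Plane → Plane) : Prop where
  continuous : Continuous h
  memLp : ∀ S : Set Plane, IsCompact S → MemLp g 2 (volume.restrict S)
  integral_eq : ∀ φ : Plane → ℝ, IsTestFun univ φ → ∀ v : Plane,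
    ∫ x, fderiv ℝ φ x v * h x = -∫ x, φ x * ⟪g x, v⟫

lemma HasWeakGradient.locallyIntegrable {h : Plane → ℝ} {g : Plane → Plane}
    (H : HasWeakGradient h g) : LocallyIntegrable g volume := by
  rw [locallyIntegrable_iff]
  intro S hS
  have : IsFiniteMeasure (volume.restrict S) := ⟨by simpa using hS.measure_lt_top⟩
  exact (H.memLp S hS).integrable (by norm_num)

lemma HasWeakGradient.contDiff_convolution {h : Plane → ℝ} {g : Plane → Plane}
    (H : HasWeakGradient h g) (ρ : ContDiffBump (0 : Plane)) :
    ContDiff ℝ ∞ (ρ.normed volume ⋆[lsmul ℝ ℝ, volume] h) :=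
  ρ.hasCompactSupport_normed.contDiff_convolution_left _ ρ.contDiff_normed
    H.continuous.locallyIntegrable

/-- The weak gradient identity is tested with t ↦ ρ(x - t); the sign from the chain rule cancels the
one from integration by parts. -/
lemma HasWeakGradient.gradient_convolution {h : Plane → ℝ} {g : Plane → Plane}
    (H : HasWeakGradient h g) (ρ : ContDiffBump (0 : Plane)) (x : Plane) :
    gradient (ρ.normed volume ⋆[lsmul ℝ ℝ, volume] h) x
      = (ρ.normed volume ⋆[lsmul ℝ ℝ, volume] g) x := by
  have hρ1 : ContDiff ℝ 1 (ρ.normed volume) := ρ.contDiff_normed (n := 1)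
  have hρc := ρ.hasCompactSupport_normed (μ := volume)
  have hd := hρc.hasFDerivAt_convolution_left (μ := volume) (lsmul ℝ ℝ) hρ1
    H.continuous.locallyIntegrable x
  have hg := hρc.convolutionExists_left (μ := volume) (lsmul ℝ ℝ) hρ1.continuous H.locallyIntegrable x
  refine ext_inner_right ℝ fun v => ?_
  rw [inner_gradient, hd.fderiv, real_inner_comm, convolution_def, convolution_def,
    ← integral_inner hg, ContinuousLinearMap.integral_apply]
  · have ht : IsTestFun univ fun t => ρ.normed volume (x - t) :=
      ⟨(ρ.contDiff_normed (μ := volume)).comp (contDiff_const.sub contDiff_id),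
        hρc.comp_homeomorph (Homeomorph.subLeft x), subset_univ _⟩
    have h1 := H.integral_eq _ ht v
    have h2 : ∀ t, fderiv ℝ (fun t => ρ.normed volume (x - t)) t v
        = -fderiv ℝ (ρ.normed volume) (x - t) v := by
      intro t
      have : HasFDerivAt (fun t => ρ.normed volume (x - t))
          ((fderiv ℝ (ρ.normed volume) (x - t)).comp (-ContinuousLinearMap.id ℝ Plane)) t :=
        (hρ1.differentiable (by norm_num) _).hasFDerivAt.comp t
          ((hasFDerivAt_id t).const_sub x)
      rw [this.fderiv]; simp
    simp_rw [h2] at h1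
    rw [← integral_sub_left_eq_self _ _ x]
    rw [← integral_sub_left_eq_self (fun t => ⟪v, (lsmul ℝ ℝ (ρ.normed volume t)) (g (x - t))⟫) _ x]
    simp only [neg_mul, integral_neg, neg_inj] at h1
    simp only [sub_sub_cancel]
    simpa [real_inner_smul_right, real_inner_comm v, real_inner_comm] using h1
  · exact (hρc.fderiv ℝ).convolutionExists_left _
      (hρ1.continuous_fderiv (by norm_num)) H.continuous.locallyIntegrable x

end
noncomputable section

/-! ### Approximation by test functions -/

open scoped Convolution
open ContinuousLinearMap (lsmul)

/-- A smooth approximation of the identity that vanishes near `0`. -/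
def softCut (s : ℝ) : ℝ := s * Real.smoothTransition (s ^ 2 - 1)

lemma softCut_contDiff : ContDiff ℝ ∞ softCut :=
  contDiff_id.mul (Real.smoothTransition.contDiff.comp ((contDiff_id.pow 2).sub contDiff_const))

lemma softCut_eq_zero {s : ℝ} (hs : |s| ≤ 1) : softCut s = 0 := by
  have : s ^ 2 ≤ 1 := by rw [← sq_abs]; exact pow_le_one₀ (abs_nonneg s) hs
  rw [softCut, Real.smoothTransition.zero_of_nonpos (by linarith), mul_zero]

lemma softCut_eq_self {s : ℝ} (hs : 2 ≤ s ^ 2) : softCut s = s := by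
  rw [softCut, Real.smoothTransition.one_of_one_le (by linarith), mul_one]

lemma abs_softCut_sub_le (s : ℝ) : |softCut s - s| ≤ 2 := by
  rcases le_or_gt 2 (s ^ 2) with h | h
  · simp [softCut_eq_self h]
  · have h1 := Real.smoothTransition.nonneg (s ^ 2 - 1)
    have h2 := Real.smoothTransition.le_one (s ^ 2 - 1)
    have h3 : |s| ≤ 2 := abs_le_of_sq_le_sq (by linarith) (by norm_num)
    have h4 : softCut s - s = s * (Real.smoothTransition (s ^ 2 - 1) - 1) := by rw [softCut]; ring
    rw [h4, abs_mul]
    have h5 : |Real.smoothTransition (s ^ 2 - 1) - 1| ≤ 1 := by rw [abs_le]; constructor <;> linarith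
    calc |s| * |Real.smoothTransition (s ^ 2 - 1) - 1| ≤ 2 * 1 := by gcongr
      _ = 2 := by norm_num

lemma continuous_deriv_softCut : Continuous (deriv softCut) :=
  softCut_contDiff.continuous_deriv (by simp)

lemma deriv_softCut_zero : deriv softCut 0 = 0 := by
  have : softCut =ᶠ[𝓝 0] fun _ => 0 := by
    filter_upwards [Metric.closedBall_mem_nhds (0 : ℝ) one_pos] with s hs
    exact softCut_eq_zero (by simpa using hs)
  rw [this.deriv_eq]; simp

lemma deriv_softCut_of_two_le {s : ℝ} (hs : 2 ≤ |s|) : deriv softCut s = 1 := by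
  have : softCut =ᶠ[𝓝 s] id := by
    have hc : Continuous fun t : ℝ => t ^ 2 := by fun_prop
    have h2 : 2 < s ^ 2 := by rw [← sq_abs]; nlinarith
    filter_upwards [(hc.isOpen_preimage _ isOpen_Ioi).mem_nhds (show s ∈ _ from h2)] with t ht
    exact softCut_eq_self (le_of_lt ht)
  rw [this.deriv_eq]; simp

lemma exists_abs_deriv_softCut_le : ∃ C : ℝ, 1 ≤ C ∧ ∀ s, |deriv softCut s| ≤ C := by
  obtain ⟨C, hC⟩ := (isCompact_Icc (a := (-2 : ℝ)) (b := 2)).exists_bound_of_continuousOn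
    continuous_deriv_softCut.continuousOn
  refine ⟨max C 1, le_max_right _ _, fun s => ?_⟩
  rcases le_or_gt 2 |s| with h | h
  · simp [deriv_softCut_of_two_le h]
  · exact (hC s (abs_le.1 h.le)).trans (le_max_left _ _)

/-- A sequence of bump functions with supports shrinking to the origin. -/
def bumpSeq (n : ℕ) : ContDiffBump (0 : Plane) where
  rIn := 1 / (2 * (n + 1))
  rOut := 1 / (n + 1)
  rIn_pos := by positivity
  rIn_lt_rOut := by
    have : (0 : ℝ) < n + 1 := by positivity
    exact one_div_lt_one_div_of_lt this (by linarith)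

lemma tendsto_bumpSeq_rOut : Tendsto (fun n => (bumpSeq n).rOut) atTop (𝓝 0) :=
  tendsto_one_div_add_atTop_nhds_zero_nat

lemma eventually_bumpSeq_rOut_le {r : ℝ} (hr : 0 < r) : ∀ᶠ n in atTop, (bumpSeq n).rOut ≤ r :=
  tendsto_bumpSeq_rOut.eventually (ge_mem_nhds hr)

/-- The truncation below the level `δ` of a function that is small near the boundary of `Ω`. -/
def cutFun (Ω : Set Plane) (δ : ℝ) (f : Plane → ℝ) : Plane → ℝ :=
  Ω.indicator fun x => δ * softCut (f x / δ)

/-! ### Truncation of a smooth function near the zero set of a continuous one -/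

section Cut

variable {Ω : Set Plane} {δ : ℝ} {h f : Plane → ℝ}

/-- Where the truncation is nonzero, |f| > δ and hence |h| > δ/2. The part of the closure of Ω with
|h| ≥ δ/2 is compact, and it avoids ∂Ω because h vanishes there. -/
lemma isTestFun_cutFun (hΩo : IsOpen Ω) (hΩb : Bornology.IsBounded Ω) (hδ : 0 < δ)
    (hh : Continuous h) (hf : ContDiff ℝ ∞ f) (h0 : ∀ x ∈ frontier Ω, h x = 0)
    (hfh : ∀ x ∈ Ω, dist (f x) (h x) ≤ δ / 2) : IsTestFun Ω (cutFun Ω δ f) := by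
  set S := closure Ω ∩ {x | δ / 2 ≤ |h x|} with hS
  have hScl : IsClosed S := isClosed_closure.inter (isClosed_le continuous_const hh.abs)
  have hSc : IsCompact S := hΩb.isCompact_closure.of_isClosed_subset hScl inter_subset_left
  have hSΩ : S ⊆ Ω := by
    rintro x ⟨hx, hx'⟩
    by_contra hxΩ
    have : x ∈ frontier Ω := by rw [hΩo.frontier_eq]; exact ⟨hx, hxΩ⟩
    simp only [mem_ofPred_eq, h0 x this, abs_zero] at hx'
    linarith
  have hz : ∀ x ∉ S, cutFun Ω δ f x = 0 := by
    intro x hx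
    by_cases hxΩ : x ∈ Ω
    · rw [cutFun, indicator_of_mem hxΩ, softCut_eq_zero, mul_zero]
      have h1 : |h x| < δ / 2 := by
        by_contra hc
        exact hx ⟨subset_closure hxΩ, not_lt.1 hc⟩
      have h2 := hfh x hxΩ
      rw [Real.dist_eq] at h2
      rw [abs_div, abs_of_pos hδ, div_le_one hδ]
      have h3 := abs_add_le (f x - h x) (h x)
      rw [sub_add_cancel] at h3
      linarith
    · rw [cutFun, indicator_of_notMem hxΩ]
  have hsupp : Function.support (cutFun Ω δ f) ⊆ S := fun x hx => by
    by_contra h; exact hx (hz x h)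
  refine ⟨contDiff_iff_contDiffAt.2 fun x => ?_, HasCompactSupport.intro hSc hz,
    (hScl.closure_subset_iff.2 hsupp).trans hSΩ⟩
  by_cases hx : x ∈ Ω
  · have : cutFun Ω δ f =ᶠ[𝓝 x] fun x => δ * softCut (f x / δ) := by
      filter_upwards [hΩo.mem_nhds hx] with y hy using indicator_of_mem hy _
    exact ((contDiff_const.mul
      (softCut_contDiff.comp (hf.div_const δ))).contDiffAt).congr_of_eventuallyEq this
  · have : cutFun Ω δ f =ᶠ[𝓝 x] fun _ => 0 := by
      filter_upwards [hScl.isOpen_compl.mem_nhds fun h => hx (hSΩ h)] with y hy using hz y hy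
    exact contDiffAt_const.congr_of_eventuallyEq this

lemma gradient_cutFun (hΩo : IsOpen Ω) (hδ : 0 < δ) (hf : ContDiff ℝ ∞ f) {x : Plane}
    (hx : x ∈ Ω) : gradient (cutFun Ω δ f) x = deriv softCut (f x / δ) • gradient f x := by
  have : cutFun Ω δ f =ᶠ[𝓝 x] fun x => δ * softCut (f x / δ) := by
    filter_upwards [hΩo.mem_nhds hx] with y hy using indicator_of_mem hy _
  refine ext_inner_right ℝ fun v => ?_
  rw [inner_gradient, this.fderiv_eq, real_inner_smul_left, inner_gradient]
  have hd : HasFDerivAt f (fderiv ℝ f x) x := (hf.differentiable (by simp) x).hasFDerivAt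
  have hd2 : HasFDerivAt (fun x => f x / δ) (δ⁻¹ • fderiv ℝ f x) x := by
    simpa [div_eq_inv_mul] using hd.const_mul δ⁻¹
  have hs := (softCut_contDiff.differentiable (by simp) (f x / δ)).hasDerivAt.comp_hasFDerivAt x hd2
  have hs' : HasFDerivAt (fun x => δ * softCut (f x / δ))
    (δ • deriv softCut (f x / δ) • δ⁻¹ • fderiv ℝ f x) x := hs.const_mul δ
  rw [hs'.fderiv]
  simp
  field_simp

lemma abs_cutFun_sub_le (hδ : 0 < δ) {x : Plane} (hx : x ∈ Ω) : |cutFun Ω δ f x - f x| ≤ 2 * δ := by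
  rw [cutFun, indicator_of_mem hx]
  have : δ * softCut (f x / δ) - f x = δ * (softCut (f x / δ) - f x / δ) := by field_simp
  rw [this, abs_mul, abs_of_pos hδ, mul_comm]
  gcongr
  exact abs_softCut_sub_le _

end Cut

/-- A continuous function with locally square integrable weak gradient vanishing on the boundary of
a bounded open set can be approximated there by test functions. -/
lemma HasWeakGradient.exists_isTestFun_indicator {h : Plane → ℝ} {g : Plane → Plane}
    (H : HasWeakGradient h g) {Ω : Set Plane} (hΩo : IsOpen Ω) (hΩb : Bornology.IsBounded Ω)
    (h0 : ∀ x ∈ frontier Ω, h x = 0) {η : ℝ} (hη : 0 < η) :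
    ∃ ψ, IsTestFun Ω ψ ∧ (∀ x ∈ Ω, |ψ x - h x| ≤ η) ∧
      eLpNorm (gradient ψ - {x | h x ≠ 0}.indicator g) 2 (volume.restrict Ω) ≤ ENNReal.ofReal η := by
  obtain ⟨C, hC1, hC⟩ := exists_abs_deriv_softCut_le
  set μ : Measure Plane := volume.restrict Ω
  have hcl : IsCompact (closure Ω) := hΩb.isCompact_closure
  have hgL : MemLp g 2 μ := (H.memLp _ hcl).mono_measure (Measure.restrict_mono subset_closure le_rfl)
  have hη3 : ENNReal.ofReal (η / 3) ≠ 0 := by simpa using (by positivity : 0 < η / 3)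
  have hNm : MeasurableSet {x | h x ≠ 0} :=
    (isOpen_ne_fun H.continuous continuous_const).measurableSet
  have hb : ∀ c : ℝ, MemLp (fun x => c * ‖g x‖) 2 μ := fun c => hgL.norm.const_mul c
  -- As δ → 0 the factor softCut'(h/δ) tends to 1 where h ≠ 0 and stays 0 where h = 0. This is why
  -- the indicator of {h ≠ 0} appears in the limit gradient.
  obtain ⟨δ, hδ0, hδη, hδ⟩ : ∃ δ : ℝ, 0 < δ ∧ 2 * δ ≤ η / 2 ∧
      eLpNorm (fun x => deriv softCut (h x / δ) • g x - {x | h x ≠ 0}.indicator g x) 2 μ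
        ≤ ENNReal.ofReal (η / 3) := by
    have ht : Tendsto (fun n : ℕ => eLpNorm (fun x => deriv softCut (h x / (1 / ((n : ℝ) + 1))) • g x
        - {x | h x ≠ 0}.indicator g x) 2 μ) atTop (𝓝 0) := by
      refine tendsto_eLpNorm_two_of_dominated (b := fun x => (C + 1) * ‖g x‖) (fun n => ?_)
        (hb _) (fun n => .of_forall fun x => ?_) (.of_forall fun x => ?_)
      · exact ((continuous_deriv_softCut.comp
          (H.continuous.div_const _)).aestronglyMeasurable.smul hgL.1).sub (hgL.1.indicator hNm)
      · refine (norm_sub_le _ _).trans ?_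
        rw [add_mul, one_mul, norm_smul]
        refine add_le_add ?_ (norm_indicator_le_norm_self _ _)
        gcongr
        exact hC _
      · by_cases hx : h x = 0
        · simp [hx, deriv_softCut_zero]
        · refine tendsto_const_nhds.congr' ?_
          have hlim : Tendsto (fun n : ℕ => |h x| * ((n : ℝ) + 1)) atTop atTop :=
            (tendsto_atTop_add_const_right _ _ tendsto_natCast_atTop_atTop).const_mul_atTop
              (abs_pos.2 hx)
          filter_upwards [hlim.eventually_ge_atTop 2] with n hn
          have hn0 : (0 : ℝ) < n + 1 := by positivity
          rw [deriv_softCut_of_two_le, indicator_of_mem (by exact hx), one_smul, sub_self]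
          rw [one_div, div_inv_eq_mul, abs_mul, abs_of_pos hn0]
          exact hn
    have h1 := ht.eventually (ge_mem_nhds (pos_iff_ne_zero.2 hη3))
    have h2 := tendsto_one_div_add_atTop_nhds_zero_nat (𝕜 := ℝ) |>.eventually
      (ge_mem_nhds (by positivity : 0 < η / 4))
    obtain ⟨n, h1, h2⟩ := (h1.and h2).exists
    exact ⟨1 / ((n : ℝ) + 1), by positivity, by linarith, h1⟩
  set hn : ℕ → Plane → ℝ := fun n => (bumpSeq n).normed volume ⋆[lsmul ℝ ℝ, volume] h with hhn
  set gn : ℕ → Plane → Plane := fun n => (bumpSeq n).normed volume ⋆[lsmul ℝ ℝ, volume] g with hgn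
  have hnC : ∀ n, ContDiff ℝ ∞ (hn n) := fun n => H.contDiff_convolution _
  have hgnC : ∀ n, Continuous (gn n) := fun n =>
    (bumpSeq n).hasCompactSupport_normed.continuous_convolution_left _
      (bumpSeq n).continuous_normed H.locallyIntegrable
  obtain ⟨r1, hr1, hr1'⟩ := exists_dist_normed_convolution_le H.continuous hΩb
    (by positivity : 0 < min (δ / 2) (η / 2))
  have hC0 : 0 < C := by linarith
  obtain ⟨r2, hr2, hr2'⟩ := exists_eLpNorm_restrict_normed_convolution_sub_le H.memLp
    hΩo.measurableSet hΩb (η := ENNReal.ofReal (η / 3 / C)) (by simpa using by positivity)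
  -- The level δ is now fixed and only the mollification parameter moves.
  have hmid : Tendsto (fun n : ℕ => eLpNorm (fun x => (deriv softCut (hn n x / δ)
      - deriv softCut (h x / δ)) • g x) 2 μ) atTop (𝓝 0) := by
    refine tendsto_eLpNorm_two_of_dominated (b := fun x => (C + C) * ‖g x‖) (fun n => ?_)
        (hb _) (fun n => .of_forall fun x => ?_) (.of_forall fun x => ?_)
    · exact ((continuous_deriv_softCut.comp ((hnC n).continuous.div_const _)).sub
        (continuous_deriv_softCut.comp (H.continuous.div_const _))).aestronglyMeasurable.smul hgL.1
    · rw [norm_smul]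
      gcongr
      exact (norm_sub_le _ _).trans (add_le_add (hC _) (hC _))
    · have hl : Tendsto (fun n => hn n x) atTop (𝓝 (h x)) :=
        ContDiffBump.convolution_tendsto_right_of_continuous tendsto_bumpSeq_rOut H.continuous x
      have hl2 := (continuous_deriv_softCut.tendsto _).comp (hl.div_const δ)
      have hl3 := (hl2.sub_const (deriv softCut (h x / δ))).smul_const (g x)
      simpa using hl3
  obtain ⟨n, ⟨hn1, hn2⟩, hn3⟩ := (((eventually_bumpSeq_rOut_le hr1).and
    (eventually_bumpSeq_rOut_le hr2)).and
      (hmid.eventually (ge_mem_nhds (pos_iff_ne_zero.2 hη3)))).exists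
  have hclose := hr1' _ hn1
  refine ⟨cutFun Ω δ (hn n), isTestFun_cutFun hΩo hΩb hδ0 H.continuous (hnC n) h0
    fun x hx => (hclose x hx).trans (min_le_left _ _), fun x hx => ?_, ?_⟩
  · have h1 := abs_cutFun_sub_le (f := hn n) hδ0 hx
    have h2 := (hclose x hx).trans (min_le_right _ _)
    rw [Real.dist_eq] at h2
    have h3 := abs_sub_le (cutFun Ω δ (hn n) x) (hn n x) (h x)
    linarith
  -- Three errors of size η / 3: mollifying g, mollifying h inside the derivative of the cut-off,
  -- and the cut-off itself.
  · have hsplit : (gradient (cutFun Ω δ (hn n)) - {x | h x ≠ 0}.indicator g) =ᵐ[μ]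
        ((fun x => deriv softCut (hn n x / δ) • (gn n x - g x))
          + (fun x => (deriv softCut (hn n x / δ) - deriv softCut (h x / δ)) • g x))
          + fun x => deriv softCut (h x / δ) • g x - {x | h x ≠ 0}.indicator g x := by
      filter_upwards [ae_restrict_mem hΩo.measurableSet] with x hx
      simp only [Pi.sub_apply, Pi.add_apply]
      rw [gradient_cutFun hΩo hδ0 (hnC n) hx, H.gradient_convolution]
      simp only [smul_sub, sub_smul, hgn]
      abel
    have d1 : Continuous fun x => deriv softCut (hn n x / δ) :=
      continuous_deriv_softCut.comp ((hnC n).continuous.div_const _)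
    have d2 : Continuous fun x => deriv softCut (h x / δ) :=
      continuous_deriv_softCut.comp (H.continuous.div_const _)
    have m1 : AEStronglyMeasurable (fun x => deriv softCut (hn n x / δ) • (gn n x - g x)) μ :=
      d1.aestronglyMeasurable.smul ((hgnC n).aestronglyMeasurable.sub hgL.1)
    have m2 : AEStronglyMeasurable (fun x => (deriv softCut (hn n x / δ)
        - deriv softCut (h x / δ)) • g x) μ := (d1.sub d2).aestronglyMeasurable.smul hgL.1
    have m3 : AEStronglyMeasurable (fun x => deriv softCut (h x / δ) • g x
        - {x | h x ≠ 0}.indicator g x) μ :=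
      (d2.aestronglyMeasurable.smul hgL.1).sub (hgL.1.indicator hNm)
    rw [eLpNorm_congr_ae hsplit]
    refine (eLpNorm_add_le (m1.add m2) m3 (by norm_num)).trans ?_
    refine (add_le_add_left (eLpNorm_add_le m1 m2 (by norm_num)) _).trans ?_
    have e1 : eLpNorm (fun x => deriv softCut (hn n x / δ) • (gn n x - g x)) 2 μ
        ≤ ENNReal.ofReal (η / 3) := by
      refine (eLpNorm_le_mul_eLpNorm_of_ae_le_mul (c := C) (g := gn n - g)
        (.of_forall fun x => ?_) 2).trans ?_
      · rw [norm_smul]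
        exact mul_le_mul_of_nonneg_right (hC _) (norm_nonneg _)
      · refine (mul_le_mul_right (hr2' _ hn2) _).trans ?_
        rw [← ENNReal.ofReal_mul hC0.le]
        exact ENNReal.ofReal_le_ofReal (by field_simp; rfl)
    refine (add_le_add (add_le_add e1 hn3) hδ).trans ?_
    rw [← ENNReal.ofReal_add (by positivity) (by positivity),
      ← ENNReal.ofReal_add (by positivity) (by positivity)]
    exact ENNReal.ofReal_le_ofReal (by linarith)

end
noncomputable section

/-! ### The space `H¹₀(Ω)` -/

variable {Ω : Set Plane}

lemma IsTestFun.continuous_gradient {φ : Plane → ℝ} (hφ : IsTestFun Ω φ) :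
    Continuous (gradient φ) :=
  (InnerProductSpace.toDual ℝ Plane).symm.continuous.comp (hφ.smooth.continuous_fderiv (by simp))

lemma IsTestFun.hasCompactSupport_gradient {φ : Plane → ℝ} (hφ : IsTestFun Ω φ) :
    HasCompactSupport (gradient φ) :=
  (hφ.compact.fderiv ℝ).comp_left (map_zero (InnerProductSpace.toDual ℝ Plane).symm)

lemma IsTestFun.memLp {φ : Plane → ℝ} (hφ : IsTestFun Ω φ) (p : ℝ≥0∞) (μ : Measure Plane)
    [IsFiniteMeasureOnCompacts μ] : MemLp φ p μ :=
  hφ.smooth.continuous.memLp_of_hasCompactSupport hφ.compact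

lemma IsTestFun.memLp_gradient {φ : Plane → ℝ} (hφ : IsTestFun Ω φ) (p : ℝ≥0∞)
    (μ : Measure Plane) [IsFiniteMeasureOnCompacts μ] : MemLp (gradient φ) p μ :=
  hφ.continuous_gradient.memLp_of_hasCompactSupport hφ.hasCompactSupport_gradient

lemma IsTestFun.eq_zero {φ : Plane → ℝ} (hφ : IsTestFun Ω φ) {x : Plane} (hx : x ∉ Ω) : φ x = 0 :=
  image_eq_zero_of_notMem_tsupport fun h => hx (hφ.support_subset h)

lemma IsTestFun.fderiv_eq_zero {φ : Plane → ℝ} (hφ : IsTestFun Ω φ) {x : Plane} (hx : x ∉ Ω) :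
    fderiv ℝ φ x = 0 :=
  image_eq_zero_of_notMem_tsupport fun h => hx (hφ.support_subset (tsupport_fderiv_subset ℝ h))

lemma IsTestFun.gradient_eq_zero {φ : Plane → ℝ} (hφ : IsTestFun Ω φ) {x : Plane} (hx : x ∉ Ω) :
    gradient φ x = 0 := by
  rw [gradient, hφ.fderiv_eq_zero hx, map_zero]

lemma IsTestFun.mono {Ω' : Set Plane} (h : Ω ⊆ Ω') {φ : Plane → ℝ} (hφ : IsTestFun Ω φ) :
    IsTestFun Ω' φ :=
  ⟨hφ.smooth, hφ.compact, hφ.support_subset.trans h⟩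

/-- The element of `L²(Ω) × L²(Ω; ℝ²)` given by two square integrable functions. -/
def mkPair {u : Plane → ℝ} {w : Plane → Plane} (hu : MemLp u 2 (volume.restrict Ω))
    (hw : MemLp w 2 (volume.restrict Ω)) : L2Pair Ω :=
  WithLp.toLp 2 (hu.toLp u, hw.toLp w)

lemma L2Pair.norm_sq (w : L2Pair Ω) : ‖w‖ ^ 2 = ‖w.fst‖ ^ 2 + ‖w.snd‖ ^ 2 :=
  WithLp.prod_norm_sq_eq_of_L2 w

lemma L2Pair.norm_le (w : L2Pair Ω) : ‖w‖ ≤ ‖w.fst‖ + ‖w.snd‖ := by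
  refine abs_le_of_sq_le_sq' ?_ (by positivity) |>.2
  rw [L2Pair.norm_sq]
  nlinarith [norm_nonneg w.fst, norm_nonneg w.snd]

lemma L2Pair.norm_fst_le (w : L2Pair Ω) : ‖w.fst‖ ≤ ‖w‖ := by
  refine abs_le_of_sq_le_sq' ?_ (by positivity) |>.2
  rw [L2Pair.norm_sq]
  nlinarith [norm_nonneg w.fst, norm_nonneg w.snd]

lemma L2Pair.norm_snd_le (w : L2Pair Ω) : ‖w.snd‖ ≤ ‖w‖ := by
  refine abs_le_of_sq_le_sq' ?_ (by positivity) |>.2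
  rw [L2Pair.norm_sq]
  nlinarith [norm_nonneg w.fst, norm_nonneg w.snd]

lemma IsTestFun.mkPair_mem_testPairs {φ : Plane → ℝ} (hφ : IsTestFun Ω φ) :
    mkPair (hφ.memLp 2 _) (hφ.memLp_gradient 2 _) ∈ testPairs Ω :=
  ⟨φ, hφ, (hφ.memLp 2 _).coeFn_toLp, (hφ.memLp_gradient 2 _).coeFn_toLp⟩

/-- A test function as an element of `H¹₀(Ω)`. -/
def IsTestFun.toH10 {φ : Plane → ℝ} (hφ : IsTestFun Ω φ) : H10 Ω :=
  ⟨mkPair (hφ.memLp 2 _) (hφ.memLp_gradient 2 _),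
    (testPairs Ω).le_topologicalClosure hφ.mkPair_mem_testPairs⟩

lemma mkPair_mem_H10 {u : Plane → ℝ} {w : Plane → Plane} (hu : MemLp u 2 (volume.restrict Ω))
    (hw : MemLp w 2 (volume.restrict Ω))
    (h : ∀ η : ℝ, 0 < η → ∃ v : H10 Ω, eLpNorm (H10val v - u) 2 (volume.restrict Ω) ≤ ENNReal.ofReal η
      ∧ eLpNorm (H10grad v - w) 2 (volume.restrict Ω) ≤ ENNReal.ofReal η) :
    mkPair hu hw ∈ H10 Ω := by
  have hcl : IsClosed (H10 Ω : Set (L2Pair Ω)) := Submodule.isClosed_topologicalClosure _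
  rw [← SetLike.mem_coe, ← hcl.closure_eq, Metric.mem_closure_iff]
  intro ε hε
  obtain ⟨v, h1, h2⟩ := h (ε / 3) (by positivity)
  refine ⟨v, v.2, ?_⟩
  rw [dist_comm, dist_eq_norm]
  refine (L2Pair.norm_le _).trans_lt ?_
  have e1 : ‖((v : L2Pair Ω) - mkPair hu hw).fst‖ ≤ ε / 3 := by
    rw [WithLp.sub_fst, Lp.norm_def]
    refine ENNReal.toReal_le_of_le_ofReal (by positivity) (le_trans (le_of_eq ?_) h1)
    refine eLpNorm_congr_ae ?_
    filter_upwards [Lp.coeFn_sub (v : L2Pair Ω).fst (mkPair hu hw).fst, hu.coeFn_toLp] with x h1 h2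
    rw [h1, Pi.sub_apply, Pi.sub_apply]
    exact congrArg _ h2
  have e2 : ‖((v : L2Pair Ω) - mkPair hu hw).snd‖ ≤ ε / 3 := by
    rw [WithLp.sub_snd, Lp.norm_def]
    refine ENNReal.toReal_le_of_le_ofReal (by positivity) (le_trans (le_of_eq ?_) h2)
    refine eLpNorm_congr_ae ?_
    filter_upwards [Lp.coeFn_sub (v : L2Pair Ω).snd (mkPair hu hw).snd, hw.coeFn_toLp] with x h1 h2
    rw [h1, Pi.sub_apply, Pi.sub_apply]
    exact congrArg _ h2
  linarith

lemma IsTestFun.val_toH10 {φ : Plane → ℝ} (hφ : IsTestFun Ω φ) :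
    H10val hφ.toH10 =ᵐ[volume.restrict Ω] φ := (hφ.memLp 2 _).coeFn_toLp

lemma IsTestFun.grad_toH10 {φ : Plane → ℝ} (hφ : IsTestFun Ω φ) :
    H10grad hφ.toH10 =ᵐ[volume.restrict Ω] gradient φ :=
  (hφ.memLp_gradient 2 _).coeFn_toLp

/-- A closed property of elements of `H¹₀(Ω)` that holds for test functions always holds. -/
lemma H10_induction {p : H10 Ω → Prop} (hcl : IsClosed {u | p u})
    (ht : ∀ (φ : Plane → ℝ) (hφ : IsTestFun Ω φ), p hφ.toH10) (u : H10 Ω) : p u := by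
  have hd : Dense {u : H10 Ω | (u : L2Pair Ω) ∈ testPairs Ω} := by
    intro u
    have hu : (u : L2Pair Ω) ∈ closure (testPairs Ω : Set (L2Pair Ω)) := u.2
    rw [Metric.mem_closure_iff] at hu ⊢
    intro ε hε
    obtain ⟨b, hb, hb'⟩ := hu ε hε
    exact ⟨⟨b, (testPairs Ω).le_topologicalClosure hb⟩, hb, hb'⟩
  refine hcl.closure_subset_iff.2 ?_ (hd u)
  rintro u ⟨φ, hφ, h1, h2⟩
  have : u = hφ.toH10 := by
    refine Subtype.ext (WithLp.ofLp_injective 2 (Prod.ext ?_ ?_))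
    · exact Lp.ext (h1.trans hφ.val_toH10.symm)
    · exact Lp.ext (h2.trans hφ.grad_toH10.symm)
  rw [mem_ofPred_eq, this]
  exact ht φ hφ

/-- The value of an element of `H¹₀(Ω)` in `L²(Ω)`. -/
def valL (Ω : Set Plane) : H10 Ω →L[ℝ] Lp ℝ 2 (volume.restrict Ω : Measure Plane) :=
  (WithLp.fstL 2 ℝ _ _).comp (H10 Ω).subtypeL

/-- The gradient of an element of `H¹₀(Ω)` in `L²(Ω; ℝ²)`. -/
def gradL (Ω : Set Plane) : H10 Ω →L[ℝ] Lp Plane 2 (volume.restrict Ω : Measure Plane) :=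
  (WithLp.sndL 2 ℝ _ _).comp (H10 Ω).subtypeL

lemma valL_coe (u : H10 Ω) : (valL Ω u : Plane → ℝ) = H10val u := rfl

lemma gradL_coe (u : H10 Ω) : (gradL Ω u : Plane → Plane) = H10grad u := rfl

lemma norm_H10_sq (u : H10 Ω) : ‖u‖ ^ 2 = ‖valL Ω u‖ ^ 2 + ‖gradL Ω u‖ ^ 2 :=
  L2Pair.norm_sq (u : L2Pair Ω)

lemma integral_test_gradient {φ ψ : Plane → ℝ} (hφ : ContDiff ℝ 1 φ) (hψ : IsTestFun Ω ψ)
    (v : Plane) :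
    ∫ x in Ω, fderiv ℝ φ x v * ψ x = -∫ x in Ω, φ x * fderiv ℝ ψ x v := by
  have hψ1 : ContDiff ℝ 1 ψ := hψ.smooth.of_le (by simp)
  have c1 := hφ.continuous_fderiv (by norm_num)
  have c2 := hψ1.continuous_fderiv (by norm_num)
  rw [setIntegral_eq_integral_of_forall_compl_eq_zero fun x hx => by rw [hψ.eq_zero hx, mul_zero],
    setIntegral_eq_integral_of_forall_compl_eq_zero fun x hx => by
      rw [hψ.fderiv_eq_zero hx]; simp, eq_comm, neg_eq_iff_eq_neg]
  refine integral_mul_fderiv_eq_neg_fderiv_mul_of_integrable ?_ ?_ ?_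
    (fun x _ => hφ.differentiable (by norm_num) x) (fun x _ => hψ1.differentiable (by norm_num) x)
  · exact ((c1.clm_apply continuous_const).mul hψ1.continuous).integrable_of_hasCompactSupport
      hψ.compact.mul_left
  · exact (hφ.continuous.mul (c2.clm_apply continuous_const)).integrable_of_hasCompactSupport
      (hψ.compact.fderiv_apply ℝ v).mul_left
  · exact (hφ.continuous.mul hψ1.continuous).integrable_of_hasCompactSupport hψ.compact.mul_left

/-- The second component of an element of `H¹₀(Ω)` is the weak gradient of the first one. -/
lemma H10_integral_eq (u : H10 Ω) {φ : Plane → ℝ} (hφ : IsTestFun univ φ) (v : Plane) :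
    ∫ x in Ω, fderiv ℝ φ x v * H10val u x = -∫ x in Ω, φ x * ⟪H10grad u x, v⟫ := by
  have hm1 : MemLp (fun x => fderiv ℝ φ x v) 2 (volume.restrict Ω : Measure Plane) :=
    ((hφ.smooth.continuous_fderiv (by simp)).clm_apply
      continuous_const).memLp_of_hasCompactSupport (hφ.compact.fderiv_apply ℝ v)
  have hm2 : MemLp (fun x => φ x • v) 2 (volume.restrict Ω : Measure Plane) :=
    (hφ.smooth.continuous.smul continuous_const).memLp_of_hasCompactSupport
      hφ.compact.smul_right
  -- Both sides become inner products with fixed elements of L², so the identity is a closed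
  -- condition on u and need only be checked on test functions.
  have e1 : ∀ u : H10 Ω, ∫ x in Ω, fderiv ℝ φ x v * H10val u x = ⟪valL Ω u, hm1.toLp _⟫ := by
    intro u
    rw [L2.inner_def]
    refine integral_congr_ae ?_
    filter_upwards [hm1.coeFn_toLp] with x hx
    rw [hx, valL_coe]
    simp
  have e2 : ∀ u : H10 Ω, ∫ x in Ω, φ x * ⟪H10grad u x, v⟫ = ⟪gradL Ω u, hm2.toLp _⟫ := by
    intro u
    rw [L2.inner_def]
    refine integral_congr_ae ?_
    filter_upwards [hm2.coeFn_toLp] with x hx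
    rw [hx, gradL_coe, real_inner_smul_right]
  refine H10_induction (p := fun u => ∫ x in Ω, fderiv ℝ φ x v * H10val u x
    = -∫ x in Ω, φ x * ⟪H10grad u x, v⟫) ?_ (fun ψ hψ => ?_) u
  · simp_rw [e1, e2]
    exact isClosed_eq (by fun_prop) (by fun_prop)
  · have h := integral_test_gradient (hφ.smooth.of_le (by simp)) hψ v
    rw [integral_congr_ae (g := fun x => fderiv ℝ φ x v * ψ x),
      integral_congr_ae (f := fun x => φ x * ⟪H10grad hψ.toH10 x, v⟫)
        (g := fun x => φ x * fderiv ℝ ψ x v), h]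
    · filter_upwards [hψ.grad_toH10] with x hx
      rw [hx, inner_gradient]
    · filter_upwards [hψ.val_toH10] with x hx
      rw [hx]

lemma ae_restrict_eq_zero_of_integral_test_inner (hΩo : IsOpen Ω) {w : Plane → Plane}
    (hw : LocallyIntegrableOn w Ω)
    (h : ∀ φ, IsTestFun Ω φ → ∀ v : Plane, ∫ x in Ω, φ x * ⟪w x, v⟫ = 0) :
    w =ᵐ[volume.restrict Ω] 0 := by
  have hi : ∀ i : Fin 2, ∀ᵐ x ∂volume, x ∈ Ω → ⟪w x, planeBasis i⟫ = 0 := by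
    intro i
    refine hΩo.ae_eq_zero_of_integral_contDiff_smul_eq_zero ?_ fun φ h1 h2 h3 => ?_
    · intro x hx
      obtain ⟨t, ht, ht'⟩ := hw x hx
      exact ⟨t, ht, ht'.inner_const _⟩
    · have hφ : IsTestFun Ω φ := ⟨h1, h2, h3⟩
      rw [← h φ hφ (planeBasis i)]
      rw [setIntegral_eq_integral_of_forall_compl_eq_zero fun x hx => by
        rw [hφ.eq_zero hx, zero_mul]]
      simp
  rw [Filter.EventuallyEq, ae_restrict_iff' hΩo.measurableSet]
  filter_upwards [hi 0, hi 1] with x h0 h1 hx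
  have h0 := h0 hx
  have h1 := h1 hx
  ext i
  fin_cases i
  · simpa [plane_inner] using h0
  · simpa [plane_inner] using h1

/-- The weak gradient of an element of `H¹₀(Ω)` is unique. -/
lemma H10grad_eq_zero (hΩo : IsOpen Ω) (hΩb : Bornology.IsBounded Ω) {u : H10 Ω}
    (hu : valL Ω u = 0) : gradL Ω u = 0 := by
  have hfin : IsFiniteMeasure (volume.restrict Ω : Measure Plane) :=
    ⟨by simpa using hΩb.measure_lt_top⟩
  refine Lp.ext ((?_ : H10grad u =ᵐ[volume.restrict Ω] 0).trans (Lp.coeFn_zero _ _ _).symm)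
  refine ae_restrict_eq_zero_of_integral_test_inner hΩo ?_ fun φ hφ v => ?_
  · have : IntegrableOn (H10grad u) Ω volume := (Lp.memLp (gradL Ω u)).integrable (by norm_num)
    exact this.locallyIntegrableOn
  · rw [← neg_eq_zero, ← H10_integral_eq u (hφ.mono (subset_univ _))]
    have : H10val u =ᵐ[volume.restrict Ω] 0 := by
      rw [← valL_coe, hu]; exact Lp.coeFn_zero _ _ _
    rw [integral_congr_ae (g := fun _ => (0 : ℝ))]
    · simp
    · filter_upwards [this] with x hx
      rw [hx]; simp

lemma Lp_norm_sq_eq_integral {E : Type*} [NormedAddCommGroup E] [InnerProductSpace ℝ E]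
    {μ : Measure Plane} (f : Lp E 2 μ) : ‖f‖ ^ 2 = ∫ x, ‖f x‖ ^ 2 ∂μ := by
  rw [← real_inner_self_eq_norm_sq, L2.inner_def]
  simp

/-- Poincaré's inequality. -/
lemma exists_poincare (hΩb : Bornology.IsBounded Ω) :
    ∃ C : ℝ, 0 < C ∧ ∀ u : H10 Ω, ‖valL Ω u‖ ≤ C * ‖gradL Ω u‖ := by
  obtain ⟨R, hR0, hR⟩ := hΩb.subset_ball_lt 0 0
  refine ⟨2 * R, by positivity, fun u => ?_⟩
  refine H10_induction (p := fun u => ‖valL Ω u‖ ≤ 2 * R * ‖gradL Ω u‖)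
    (isClosed_le (by fun_prop) (by fun_prop)) (fun φ hφ => ?_) u
  refine abs_le_of_sq_le_sq' ?_ (by positivity) |>.2
  have h := hφ.poincare (R := R) fun x hx => (mem_ball_zero_iff.1 (hR hx)).le
  rw [mul_pow, Lp_norm_sq_eq_integral, Lp_norm_sq_eq_integral]
  rw [integral_congr_ae (g := fun x => φ x ^ 2),
    integral_congr_ae (f := fun x => ‖gradL Ω hφ.toH10 x‖ ^ 2) (g := fun x => ‖gradient φ x‖ ^ 2),
    setIntegral_eq_integral_of_forall_compl_eq_zero fun x hx => by rw [hφ.eq_zero hx]; simp,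
    setIntegral_eq_integral_of_forall_compl_eq_zero fun x hx => by
      rw [hφ.gradient_eq_zero hx]; simp]
  · exact h
  · filter_upwards [hφ.grad_toH10] with x hx
    rw [gradL_coe, hx]
  · filter_upwards [hφ.val_toH10] with x hx
    rw [valL_coe, hx]; simp

lemma eLpNorm_restrict_le_of_abs_le {μ : Measure Plane} [IsFiniteMeasure μ] {ε : ℝ}
    (hε : 0 < ε) : ∃ η : ℝ, 0 < η ∧ η ≤ ε ∧ ∀ f : Plane → ℝ, (∀ᵐ x ∂μ, |f x| ≤ η) →
      eLpNorm f 2 μ ≤ ENNReal.ofReal ε := by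
  have hA : μ univ ^ (2 : ℝ≥0∞).toReal⁻¹ ≠ ⊤ :=
    ENNReal.rpow_ne_top_of_nonneg (by positivity) (measure_ne_top _ _)
  set A := (μ univ ^ (2 : ℝ≥0∞).toReal⁻¹).toReal
  have hA0 : 0 ≤ A := ENNReal.toReal_nonneg
  refine ⟨ε / (A + 1), by positivity, div_le_self hε.le (by linarith), fun f hf => ?_⟩
  refine (eLpNorm_le_of_ae_bound (C := ε / (A + 1)) hf).trans ?_
  rw [← ENNReal.ofReal_toReal hA, ← ENNReal.ofReal_mul hA0]
  refine ENNReal.ofReal_le_ofReal ?_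
  rw [mul_div_assoc', div_le_iff₀ (by positivity)]
  change A * ε ≤ _
  nlinarith

/-- A continuous function with locally square integrable weak gradient vanishing on the boundary of
a bounded open set can be approximated there by test functions, uniformly and with convergence of
the gradients in `L²`. -/
lemma HasWeakGradient.exists_isTestFun {h : Plane → ℝ} {g : Plane → Plane}
    (H : HasWeakGradient h g) (hΩo : IsOpen Ω) (hΩb : Bornology.IsBounded Ω)
    (h0 : ∀ x ∈ frontier Ω, h x = 0) {η : ℝ} (hη : 0 < η) :
    ∃ ψ, IsTestFun Ω ψ ∧ (∀ x ∈ Ω, |ψ x - h x| ≤ η) ∧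
      eLpNorm (gradient ψ - g) 2 (volume.restrict Ω) ≤ ENNReal.ofReal η := by
  have hfin : IsFiniteMeasure (volume.restrict Ω : Measure Plane) :=
    ⟨by simpa using hΩb.measure_lt_top⟩
  have hcl : IsCompact (closure Ω) := hΩb.isCompact_closure
  have hgL : MemLp g 2 (volume.restrict Ω) :=
    (H.memLp _ hcl).mono_measure (Measure.restrict_mono subset_closure le_rfl)
  have hhL : MemLp h 2 (volume.restrict Ω) := by
    obtain ⟨C, hC⟩ := hcl.exists_bound_of_continuousOn H.continuous.continuousOn
    refine MemLp.of_bound H.continuous.aestronglyMeasurable C ?_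
    filter_upwards [ae_restrict_mem hΩo.measurableSet] with x hx using hC x (subset_closure hx)
  have hNm : MeasurableSet {x | h x ≠ 0} :=
    (isOpen_ne_fun H.continuous continuous_const).measurableSet
  have hgL' : MemLp ({x | h x ≠ 0}.indicator g) 2 (volume.restrict Ω) := hgL.indicator hNm
  have hmem : mkPair hhL hgL' ∈ H10 Ω := by
    refine mkPair_mem_H10 hhL hgL' fun ε hε => ?_
    obtain ⟨η, hη0, hηε, hη⟩ :=
      eLpNorm_restrict_le_of_abs_le (μ := (volume.restrict Ω : Measure Plane)) hε
    obtain ⟨ψ, hψ, h1, h2⟩ := H.exists_isTestFun_indicator hΩo hΩb h0 hη0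
    refine ⟨hψ.toH10, ?_, ?_⟩
    · rw [eLpNorm_congr_ae (hψ.val_toH10.sub (ae_eq_refl h))]
      refine hη _ ?_
      filter_upwards [ae_restrict_mem hΩo.measurableSet] with x hx using h1 x hx
    · rw [eLpNorm_congr_ae (hψ.grad_toH10.sub (ae_eq_refl _))]
      exact h2.trans (ENNReal.ofReal_le_ofReal hηε)
  -- Both g and its restriction to {h ≠ 0} are weak gradients of h on Ω, the second by membership in
  -- H¹₀(Ω). Uniqueness of weak gradients makes them equal: the gradient vanishes almost everywhere
  -- on the zero set of h in Ω.
  have hg : g =ᵐ[volume.restrict Ω] {x | h x ≠ 0}.indicator g := by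
    have hi := hgL.integrable (q := 2) (by norm_num)
    have hi' := hgL'.integrable (q := 2) (by norm_num)
    have hz := ae_restrict_eq_zero_of_integral_test_inner (w := g - {x | h x ≠ 0}.indicator g)
      hΩo ?_ fun φ hφ v => ?_
    · filter_upwards [hz] with x hx using sub_eq_zero.1 hx
    · exact IntegrableOn.locallyIntegrableOn (hi.sub hi')
    · have e1 := H.integral_eq φ (hφ.mono (subset_univ _)) v
      have e2 := H10_integral_eq ⟨_, hmem⟩ (hφ.mono (subset_univ _)) v
      have hval : H10val (⟨_, hmem⟩ : H10 Ω) =ᵐ[volume.restrict Ω] h := hhL.coeFn_toLp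
      have hgrad : H10grad (⟨_, hmem⟩ : H10 Ω) =ᵐ[volume.restrict Ω]
        {x | h x ≠ 0}.indicator g := hgL'.coeFn_toLp
      rw [integral_congr_ae (g := fun x => fderiv ℝ φ x v * h x)
          (by filter_upwards [hval] with x hx; rw [hx]),
        integral_congr_ae (f := fun x => φ x * ⟪H10grad _ x, v⟫)
          (g := fun x => φ x * ⟪{x | h x ≠ 0}.indicator g x, v⟫)
          (by filter_upwards [hgrad] with x hx; rw [hx]),
        setIntegral_eq_integral_of_forall_compl_eq_zero fun x hx => by
          rw [hφ.fderiv_eq_zero hx]; simp, e1, neg_inj,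
        ← setIntegral_eq_integral_of_forall_compl_eq_zero (s := Ω) fun x hx => by
          rw [hφ.eq_zero hx]; simp] at e2
      have hb : ∀ {w : Plane → Plane}, Integrable w (volume.restrict Ω) →
          Integrable (fun x => φ x * ⟪w x, v⟫) (volume.restrict Ω) := fun hw => by
        obtain ⟨C, hC⟩ := hφ.smooth.continuous.bounded_above_of_compact_support hφ.compact
        exact (hw.inner_const v).bdd_mul hφ.smooth.continuous.aestronglyMeasurable
          (.of_forall hC)
      simp only [Pi.sub_apply, inner_sub_left, mul_sub]
      rw [integral_sub (hb hi) (hb hi'), e2, sub_self]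
  obtain ⟨ψ, hψ, h1, h2⟩ := H.exists_isTestFun_indicator hΩo hΩb h0 hη
  refine ⟨ψ, hψ, h1, ?_⟩
  rwa [eLpNorm_congr_ae ((ae_eq_refl (gradient ψ)).sub hg)]

end
noncomputable section

/-! ### The change of variables formula -/

variable {Ω : Set Plane}

lemma inner_planeBasis (y : Plane) (i : Fin 2) : ⟪y, planeBasis i⟫ = y i := by
  fin_cases i <;> simp [plane_inner]

lemma planeBasis_inner (y : Plane) (i : Fin 2) : ⟪planeBasis i, y⟫ = y i := by
  rw [real_inner_comm, inner_planeBasis]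

lemma lintegral_enorm_mul_le {α E E' : Type*} [MeasurableSpace α] [NormedAddCommGroup E]
    [NormedAddCommGroup E'] {μ : Measure α} {f : α → E} {g : α → E'}
    (hf : AEStronglyMeasurable f μ) (hg : AEStronglyMeasurable g μ) :
    ∫⁻ x, ‖f x‖ₑ * ‖g x‖ₑ ∂μ ≤ eLpNorm f 2 μ * eLpNorm g 2 μ := by
  have h := ENNReal.lintegral_mul_le_Lp_mul_Lq μ (p := 2) (q := 2)
    (by constructor <;> norm_num) hf.enorm hg.enorm
  simpa [eLpNorm_eq_lintegral_rpow_enorm_toReal] using h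

lemma abs_det_le (A : PlaneMat) : |A.det| ≤ ‖A‖ ^ 2 := by
  have h := abs_det_sub_det_le A 0
  have h0 : (0 : PlaneMat).det = 0 := by simp [plane_det_eq]
  rw [h0] at h
  simpa [pow_two] using h

lemma integrable_det {μ : Measure Plane} {A : Plane → PlaneMat} (hA : MemLp A 2 μ) :
    Integrable (fun x => (A x).det) μ := by
  refine (hA.norm.integrable_sq).mono' (continuous_plane_det.comp_aestronglyMeasurable hA.1) ?_
  exact .of_forall fun x => by simpa using abs_det_le (A x)

/-- Convergence of integrals of products of a boundedly convergent and an `L¹` convergent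
sequence. -/
lemma tendsto_integral_mul {μ : Measure Plane} {c : ℕ → Plane → ℝ} {c' : Plane → ℝ}
    {d : ℕ → Plane → ℝ} {d' : Plane → ℝ} {M : ℝ}
    (hc : ∀ n, AEStronglyMeasurable (c n) μ) (hM : ∀ n, ∀ᵐ x ∂μ, |c n x| ≤ M)
    (hlim : ∀ᵐ x ∂μ, Tendsto (fun n => c n x) atTop (𝓝 (c' x)))
    (hd : ∀ n, Integrable (d n) μ) (hd' : Integrable d' μ)
    (hL : Tendsto (fun n => ∫⁻ x, ‖d n x - d' x‖ₑ ∂μ) atTop (𝓝 0)) :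
    Tendsto (fun n => ∫ x, c n x * d n x ∂μ) atTop (𝓝 (∫ x, c' x * d' x ∂μ)) := by
  have h1 : Tendsto (fun n => ∫ x, c n x * d' x ∂μ) atTop (𝓝 (∫ x, c' x * d' x ∂μ)) := by
    refine tendsto_integral_of_dominated_convergence (fun x => M * ‖d' x‖)
      (fun n => (hc n).mul hd'.1) (hd'.norm.const_mul M) (fun n => ?_) ?_
    · filter_upwards [hM n] with x hx
      rw [norm_mul]
      gcongr
      exact hx
    · filter_upwards [hlim] with x hx using hx.mul_const _
  have hi : ∀ n {e : Plane → ℝ}, Integrable e μ → Integrable (fun x => c n x * e x) μ :=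
    fun n e he => he.bdd_mul (hc n) (hM n)
  have h2 : Tendsto (fun n => ∫ x, c n x * (d n x - d' x) ∂μ) atTop (𝓝 0) := by
    have hz := tendsto_integral_of_L1 (μ := μ) (fun _ => (0 : ℝ)) aestronglyMeasurable_const
      (F := fun n x => c n x * (d n x - d' x)) (l := atTop)
      (.of_forall fun n => hi n ((hd n).sub hd')) ?_
    · simpa using hz
    · have hb : Tendsto (fun n => ENNReal.ofReal M * ∫⁻ x, ‖d n x - d' x‖ₑ ∂μ) atTop (𝓝 0) := by
        simpa using ENNReal.Tendsto.const_mul hL (.inr ENNReal.ofReal_ne_top)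
      refine tendsto_of_tendsto_of_tendsto_of_le_of_le tendsto_const_nhds hb
        (fun n => zero_le) fun n => ?_
      rw [← lintegral_const_mul' _ _ ENNReal.ofReal_ne_top]
      refine lintegral_mono_ae ?_
      filter_upwards [hM n] with x hx
      rw [sub_zero, enorm_mul]
      gcongr
      rw [← ofReal_norm]
      exact ENNReal.ofReal_le_ofReal hx
  have h3 := h2.add h1
  rw [zero_add] at h3
  refine h3.congr fun n => ?_
  have hs : Integrable (fun x => c n x * (d n x - d' x)) μ := hi n ((hd n).sub hd')
  rw [← integral_add hs (hi n hd')]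
  refine integral_congr_ae (.of_forall fun x => ?_)
  simp only
  ring

/-- The determinant is quadratic: |det A - det B| ≤ |A - B|² + 2|A - B||B|, and Cauchy–Schwarz
applies. Square integrability of DF is thus exactly what the Jacobian needs. -/
lemma tendsto_lintegral_det_sub {μ : Measure Plane} {A : ℕ → Plane → PlaneMat}
    {B : Plane → PlaneMat} (hA : ∀ n, AEStronglyMeasurable (A n) μ) (hB : MemLp B 2 μ)
    (hAB : Tendsto (fun n => eLpNorm (A n - B) 2 μ) atTop (𝓝 0)) :
    Tendsto (fun n => ∫⁻ x, ‖(A n x).det - (B x).det‖ₑ ∂μ) atTop (𝓝 0) := by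
  have hb : Tendsto (fun n => eLpNorm (A n - B) 2 μ * (eLpNorm (A n - B) 2 μ + 2 * eLpNorm B 2 μ))
      atTop (𝓝 0) := by
    have h2 : 2 * eLpNorm B 2 μ ≠ ⊤ := ENNReal.mul_ne_top (by norm_num) hB.2.ne
    have h1 := hAB.add_const (2 * eLpNorm B 2 μ)
    rw [zero_add] at h1
    simpa using ENNReal.Tendsto.mul hAB (.inr h2) h1 (.inr (by simp))
  refine tendsto_of_tendsto_of_tendsto_of_le_of_le tendsto_const_nhds hb
        (fun n => zero_le) fun n => ?_
  have hm : AEStronglyMeasurable (A n - B) μ := (hA n).sub hB.1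
  calc ∫⁻ x, ‖(A n x).det - (B x).det‖ₑ ∂μ
      ≤ ∫⁻ x, (‖(A n - B) x‖ₑ * ‖(A n - B) x‖ₑ + 2 * (‖(A n - B) x‖ₑ * ‖B x‖ₑ)) ∂μ := by
        refine lintegral_mono fun x => ?_
        have h1 : ‖(A n x).det - (B x).det‖ ≤ ‖A n x - B x‖ * ‖A n x - B x‖
            + 2 * (‖A n x - B x‖ * ‖B x‖) := by
          have h2 : ‖A n x‖ ≤ ‖A n x - B x‖ + ‖B x‖ := by
            simpa using norm_add_le (A n x - B x) (B x)
          refine (abs_det_sub_det_le _ _).trans ?_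
          nlinarith [norm_nonneg (A n x - B x)]
        rw [← ofReal_norm]
        refine (ENNReal.ofReal_le_ofReal h1).trans (le_of_eq ?_)
        rw [ENNReal.ofReal_add (by positivity) (by positivity),
          ENNReal.ofReal_mul (norm_nonneg _), ENNReal.ofReal_mul (by norm_num),
          ENNReal.ofReal_mul (norm_nonneg _)]
        simp
    _ ≤ _ := by
        have hmm : AEMeasurable (fun x => ‖(A n - B) x‖ₑ * ‖(A n - B) x‖ₑ) μ :=
          hm.enorm.mul hm.enorm
        rw [lintegral_add_left' hmm, lintegral_const_mul' _ _ (by norm_num),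
          mul_add, mul_left_comm _ 2]
        gcongr
        · exact lintegral_enorm_mul_le hm hm
        · exact lintegral_enorm_mul_le hm hB.1

lemma HasW12locDeriv.hasWeakGradient {F : Plane → Plane} {DF : Plane → PlaneMat}
    (H : HasW12locDeriv F DF) (hF : Continuous F) (w : Plane) :
    HasWeakGradient (fun x => ⟪F x, w⟫) fun x => ContinuousLinearMap.adjoint (DF x) w := by
  have hadj : Continuous fun A : PlaneMat => ContinuousLinearMap.adjoint A w :=
    ContinuousLinearMap.adjoint.continuous.clm_apply continuous_const
  refine ⟨hF.inner (𝕜 := ℝ) continuous_const, fun S hS => ?_, fun φ hφ v => ?_⟩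
  · refine (H.memLp_deriv S hS).of_le_mul (c := ‖w‖)
      (hadj.comp_aestronglyMeasurable (H.memLp_deriv S hS).1) (.of_forall fun x => ?_)
    rw [mul_comm]
    exact norm_adjoint_apply_le _ _
  · have h := congrArg (fun z => ⟪z, w⟫) (H.integral_eq φ hφ v)
    have hloc : LocallyIntegrable DF volume := by
      rw [locallyIntegrable_iff]
      intro S hS
      have : IsFiniteMeasure (volume.restrict S) := ⟨by simpa using hS.measure_lt_top⟩
      exact (H.memLp_deriv S hS).integrable (by norm_num)
    have i1 : Integrable fun x => (fderiv ℝ φ x v) • F x :=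
      (((hφ.smooth.continuous_fderiv (by simp)).clm_apply continuous_const).smul
        hF).integrable_of_hasCompactSupport (hφ.compact.fderiv_apply ℝ v).smul_right
    have i2 : Integrable fun x => φ x • DF x v := by
      have := hloc.integrable_smul_left_of_hasCompactSupport hφ.smooth.continuous hφ.compact
      exact ((ContinuousLinearMap.apply ℝ Plane v).integrable_comp this)
    rw [inner_neg_left, real_inner_comm, real_inner_comm w, ← integral_inner i1,
      ← integral_inner i2] at h
    simpa [real_inner_smul_right, ContinuousLinearMap.adjoint_inner_left, real_inner_comm] using h

/-- A test function has its gradient as weak gradient, and so has a smooth function. -/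
lemma ContDiff.hasWeakGradient {h : Plane → ℝ} (hh : ContDiff ℝ 1 h) :
    HasWeakGradient h (gradient h) := by
  have hc : Continuous (gradient h) :=
    (InnerProductSpace.toDual ℝ Plane).symm.continuous.comp (hh.continuous_fderiv (by norm_num))
  refine ⟨hh.continuous, fun S hS => ?_, fun φ hφ v => ?_⟩
  · have : IsFiniteMeasure (volume.restrict S) := ⟨by simpa using hS.measure_lt_top⟩
    obtain ⟨C, hC⟩ := hS.exists_bound_of_continuousOn hc.continuousOn
    refine MemLp.of_bound hc.aestronglyMeasurable C ?_
    filter_upwards [ae_restrict_mem hS.measurableSet] with x hx using hC x hx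
  · have h := integral_test_gradient hh hφ v
    rw [Measure.restrict_univ] at h
    simp_rw [inner_gradient, mul_comm (φ _), mul_comm (fderiv ℝ φ _ v)]
    rw [h, neg_neg]

lemma HasWeakGradient.sub {h h' : Plane → ℝ} {g g' : Plane → Plane} (H : HasWeakGradient h g)
    (H' : HasWeakGradient h' g') :
    HasWeakGradient (fun x => h x - h' x) (fun x => g x - g' x) := by
  refine ⟨H.continuous.sub H'.continuous, fun S hS => (H.memLp S hS).sub (H'.memLp S hS),
    fun φ hφ v => ?_⟩
  have i1 : ∀ {h : Plane → ℝ}, Continuous h → Integrable fun x => fderiv ℝ φ x v * h x :=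
    fun hh => (((hφ.smooth.continuous_fderiv (by simp)).clm_apply continuous_const).mul
      hh).integrable_of_hasCompactSupport (hφ.compact.fderiv_apply ℝ v).mul_right
  have i2 : ∀ {h : Plane → ℝ} {g : Plane → Plane}, HasWeakGradient h g →
      Integrable fun x => φ x * ⟪g x, v⟫ := fun H => by
    have := H.locallyIntegrable.integrable_smul_left_of_hasCompactSupport
      hφ.smooth.continuous hφ.compact
    simpa [real_inner_smul_left] using Integrable.inner_const (𝕜 := ℝ) this v
  simp_rw [mul_sub, inner_sub_left, mul_sub]
  rw [integral_sub (i1 H.continuous) (i1 H'.continuous), integral_sub (i2 H) (i2 H'),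
    H.integral_eq φ hφ v, H'.integral_eq φ hφ v]
  ring

/-- A Sobolev map that is the identity on the boundary of a bounded open set is there the limit of
smooth maps that are the identity near the boundary. -/
lemma HasW12locDeriv.exists_smooth_approx {F : Plane → Plane} {DF : Plane → PlaneMat}
    (H : HasW12locDeriv F DF) (hF : Continuous F) (hΩo : IsOpen Ω) (hΩb : Bornology.IsBounded Ω)
    (hFb : ∀ x ∈ frontier Ω, F x = x) {η : ℝ} (hη : 0 < η) :
    ∃ Φ : Plane → Plane, ContDiff ℝ ∞ Φ ∧ tsupport (fun x => Φ x - x) ⊆ Ω ∧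
      (∀ x ∈ Ω, ‖Φ x - F x‖ ≤ η) ∧
      eLpNorm (fderiv ℝ Φ - DF) 2 (volume.restrict Ω) ≤ ENNReal.ofReal η := by
  -- The coordinates of F(x) - x vanish on ∂Ω, so they are approximated by test functions; adding
  -- these to the identity gives the smooth map.
  have key : ∀ i : Fin 2, ∃ ψ, IsTestFun Ω ψ ∧ (∀ x ∈ Ω, |ψ x - (F x i - x i)| ≤ η / 2) ∧
      eLpNorm (fun x => gradient ψ x
        - (ContinuousLinearMap.adjoint (DF x) (planeBasis i) - planeBasis i)) 2
          (volume.restrict Ω) ≤ ENNReal.ofReal (η / 2) := by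
    intro i
    have hlin : ContDiff ℝ 1 fun x : Plane => ⟪x, planeBasis i⟫ :=
      ContDiff.inner ℝ contDiff_id contDiff_const
    have hg : ∀ x, gradient (fun x : Plane => ⟪x, planeBasis i⟫) x = planeBasis i := by
      intro x
      refine ext_inner_right ℝ fun v => ?_
      have hd : HasFDerivAt (fun x : Plane => ⟪x, planeBasis i⟫) (innerSL ℝ (planeBasis i)) x := by
        simp_rw [real_inner_comm (planeBasis i)]
        exact (innerSL ℝ (planeBasis i)).hasFDerivAt
      rw [inner_gradient, hd.fderiv]
      simp
    have hw := (H.hasWeakGradient hF (planeBasis i)).sub (ContDiff.hasWeakGradient hlin)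
    obtain ⟨ψ, h1, h2, h3⟩ := hw.exists_isTestFun hΩo hΩb
      (fun x hx => by simp only [hFb x hx, sub_self]) (half_pos hη)
    refine ⟨ψ, h1, fun x hx => ?_, ?_⟩
    · have := h2 x hx
      rwa [inner_planeBasis, inner_planeBasis] at this
    · simp_rw [hg] at h3
      exact h3
  choose ψ hψ hc hL using key
  have hd : ∀ i x, HasFDerivAt (ψ i) (fderiv ℝ (ψ i) x) x := fun i x =>
    ((hψ i).smooth.differentiable (by simp) x).hasFDerivAt
  have hΦd : ∀ x, HasFDerivAt (fun x => x + (ψ 0 x • planeBasis 0 + ψ 1 x • planeBasis 1))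
      (ContinuousLinearMap.id ℝ Plane + ((fderiv ℝ (ψ 0) x).smulRight (planeBasis 0)
        + (fderiv ℝ (ψ 1) x).smulRight (planeBasis 1))) x := fun x =>
    (hasFDerivAt_id x).add (((hd 0 x).smul_const _).add ((hd 1 x).smul_const _))
  refine ⟨fun x => x + (ψ 0 x • planeBasis 0 + ψ 1 x • planeBasis 1),
    contDiff_id.add (((hψ 0).smooth.smul contDiff_const).add
      ((hψ 1).smooth.smul contDiff_const)), ?_, fun x hx => ?_, ?_⟩
  · simp only [add_sub_cancel_left]
    refine (tsupport_add _ _).trans (union_subset ?_ ?_)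
    · exact (tsupport_smul_subset_left _ _).trans (hψ 0).support_subset
    · exact (tsupport_smul_subset_left _ _).trans (hψ 1).support_subset
  · have e : x + (ψ 0 x • planeBasis 0 + ψ 1 x • planeBasis 1) - F x
        = (ψ 0 x - (F x 0 - x 0)) • planeBasis 0 + (ψ 1 x - (F x 1 - x 1)) • planeBasis 1 := by
      ext i; fin_cases i <;> simp <;> ring
    rw [e]
    refine (norm_add_le _ _).trans ?_
    rw [norm_smul, norm_smul]
    have h0 := hc 0 x hx
    have h1 := hc 1 x hx
    simp only [PiLp.norm_single, norm_one, mul_one, Real.norm_eq_abs]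
    linarith
  · set G : Fin 2 → Plane → Plane := fun i x => gradient (ψ i) x
        - (ContinuousLinearMap.adjoint (DF x) (planeBasis i) - planeBasis i) with hG
    have hDF : MemLp DF 2 (volume.restrict Ω) := (H.memLp_deriv _ hΩb.isCompact_closure).mono_measure
      (Measure.restrict_mono subset_closure le_rfl)
    have hGm : ∀ i, AEStronglyMeasurable (G i) (volume.restrict Ω) := fun i => by
      have hadj : Continuous fun A : PlaneMat => ContinuousLinearMap.adjoint A (planeBasis i) :=
        ContinuousLinearMap.adjoint.continuous.clm_apply continuous_const
      exact (hψ i).continuous_gradient.aestronglyMeasurable.sub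
        ((hadj.comp_aestronglyMeasurable hDF.1).sub aestronglyMeasurable_const)
    have hle : ∀ x, ‖(fderiv ℝ (fun x => x + (ψ 0 x • planeBasis 0 + ψ 1 x • planeBasis 1)) - DF) x‖
        ≤ ‖‖G 0 x‖ + ‖G 1 x‖‖ := by
      intro x
      rw [Real.norm_of_nonneg (by positivity), Pi.sub_apply, (hΦd x).fderiv]
      refine ContinuousLinearMap.opNorm_le_bound _ (by positivity) fun v => ?_
      have e : (ContinuousLinearMap.id ℝ Plane + ((fderiv ℝ (ψ 0) x).smulRight (planeBasis 0)
          + (fderiv ℝ (ψ 1) x).smulRight (planeBasis 1)) - DF x) v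
          = ⟪G 0 x, v⟫ • planeBasis 0 + ⟪G 1 x, v⟫ • planeBasis 1 := by
        have hGi : ∀ i, ⟪G i x, v⟫ = fderiv ℝ (ψ i) x v - (DF x v i - v i) := fun i => by
          simp only [hG, inner_sub_left, inner_gradient, ContinuousLinearMap.adjoint_inner_left,
            planeBasis_inner]
        rw [hGi, hGi]
        ext i; fin_cases i <;> simp <;> ring
      rw [e]
      refine (norm_add_le _ _).trans ?_
      rw [norm_smul, norm_smul, add_mul]
      simp only [PiLp.norm_single, norm_one, mul_one]
      exact add_le_add (norm_inner_le_norm _ _) (norm_inner_le_norm _ _)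
    refine (eLpNorm_mono_ae (.of_forall hle)).trans ?_
    refine (eLpNorm_add_le (hGm 0).norm (hGm 1).norm (by norm_num)).trans ?_
    rw [eLpNorm_norm, eLpNorm_norm]
    refine (add_le_add (hL 0) (hL 1)).trans ?_
    rw [← ENNReal.ofReal_add (by positivity) (by positivity), add_halves]

end
noncomputable section

/-! ### Passage from smooth maps to F in the Jacobian identities -/

section ChangeOfVariables

lemma two_le_smooth : (2 : ℕ∞ω) ≤ ((⊤ : ℕ∞) : ℕ∞ω) := by
  exact WithTop.coe_le_coe.2 (le_top : (2 : ℕ∞) ≤ ⊤)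

variable {Ω : Set Plane}

lemma HasW12locDeriv.memLp_restrict {F : Plane → Plane} {DF : Plane → PlaneMat}
    (H : HasW12locDeriv F DF) (hΩb : Bornology.IsBounded Ω) :
    MemLp DF 2 (volume.restrict Ω) :=
  (H.memLp_deriv _ hΩb.isCompact_closure).mono_measure (Measure.restrict_mono subset_closure le_rfl)

lemma HasW12locDeriv.exists_smooth_seq {F : Plane → Plane} {DF : Plane → PlaneMat}
    (H : HasW12locDeriv F DF) (hF : Continuous F) (hΩo : IsOpen Ω) (hΩb : Bornology.IsBounded Ω)
    (hFb : ∀ x ∈ frontier Ω, F x = x) :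
    ∃ Φ : ℕ → Plane → Plane, (∀ n, ContDiff ℝ ∞ (Φ n)) ∧
      (∀ n, tsupport (fun x => Φ n x - x) ⊆ Ω) ∧
      (∀ n, ∀ x ∈ Ω, ‖Φ n x - F x‖ ≤ 1 / ((n : ℝ) + 1)) ∧
      Tendsto (fun n => eLpNorm (fderiv ℝ (Φ n) - DF) 2 (volume.restrict Ω)) atTop (𝓝 0) := by
  have h := fun n : ℕ => H.exists_smooth_approx hF hΩo hΩb hFb
    (by positivity : 0 < 1 / ((n : ℝ) + 1))
  choose Φ h1 h2 h3 h4 using h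
  refine ⟨Φ, h1, h2, h3, ?_⟩
  refine tendsto_of_tendsto_of_tendsto_of_le_of_le tendsto_const_nhds ?_ (fun _ => zero_le) h4
  have := (ENNReal.continuous_ofReal.tendsto 0).comp
    (tendsto_one_div_add_atTop_nhds_zero_nat (𝕜 := ℝ))
  rwa [ENNReal.ofReal_zero] at this

/-- One constant serves every map within distance 1 of F on Ω, since all of them send Ω into a
common ball; it supplies the bound for dominated convergence. -/
lemma exists_bound_comp_of_close {F : Plane → Plane} (hF : Continuous F)
    (hΩb : Bornology.IsBounded Ω) {E : Type*} [NormedAddCommGroup E] {c : Plane → E}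
    (hc : Continuous c) :
    ∃ M : ℝ, ∀ Φ : Plane → Plane, (∀ x ∈ Ω, ‖Φ x - F x‖ ≤ 1) → ∀ x ∈ Ω, ‖c (Φ x)‖ ≤ M := by
  obtain ⟨R, hR⟩ := hΩb.isCompact_closure.exists_bound_of_continuousOn hF.continuousOn
  obtain ⟨M, hM⟩ := (isCompact_closedBall (0 : Plane) (R + 1)).exists_bound_of_continuousOn
    hc.continuousOn
  refine ⟨M, fun Φ hΦ x hx => hM _ ?_⟩
  rw [mem_closedBall_zero_iff]
  have h1 := hR x (subset_closure hx)
  have h2 := norm_add_le (Φ x - F x) (F x)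
  rw [sub_add_cancel] at h2
  linarith [hΦ x hx]

lemma one_div_nat_succ_le_one (n : ℕ) : 1 / ((n : ℝ) + 1) ≤ 1 := by
  rw [div_le_one (by positivity)]
  have : (0 : ℝ) ≤ n := by positivity
  linarith

lemma tendsto_of_close {F : Plane → Plane} {Φ : ℕ → Plane → Plane} {x : Plane}
    (h : ∀ n, ‖Φ n x - F x‖ ≤ 1 / ((n : ℝ) + 1)) : Tendsto (fun n => Φ n x) atTop (𝓝 (F x)) := by
  rw [tendsto_iff_norm_sub_tendsto_zero]
  exact squeeze_zero (fun _ => norm_nonneg _) h tendsto_one_div_add_atTop_nhds_zero_nat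

variable {F : Plane → Plane} {DF : Plane → PlaneMat}

lemma memLp_fderiv_restrict {Φ : Plane → Plane} (hΦ : ContDiff ℝ ∞ Φ)
    (hΩb : Bornology.IsBounded Ω) : MemLp (fderiv ℝ Φ) 2 (volume.restrict Ω) := by
  have hfin : IsFiniteMeasure (volume.restrict (closure Ω) : Measure Plane) :=
    ⟨by simpa using hΩb.isCompact_closure.measure_lt_top⟩
  have hc := hΦ.continuous_fderiv (by simp)
  obtain ⟨C, hC⟩ := hΩb.isCompact_closure.exists_bound_of_continuousOn hc.continuousOn
  refine MemLp.mono_measure (Measure.restrict_mono subset_closure le_rfl)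
    (MemLp.of_bound hc.aestronglyMeasurable C ?_)
  filter_upwards [ae_restrict_mem isClosed_closure.measurableSet] with x hx using hC x hx

/-- The change of variables formula for directional derivatives. -/
lemma HasW12locDeriv.setIntegral_fderiv_comp_mul_det
    (H : HasW12locDeriv F DF) (hF : Continuous F) (hΩo : IsOpen Ω) (hΩb : Bornology.IsBounded Ω)
    (hFb : ∀ x ∈ frontier Ω, F x = x) {φ : Plane → ℝ} (hφ : ContDiff ℝ 1 φ) (v : Plane) :
    ∫ x in Ω, fderiv ℝ φ (F x) v * (DF x).det = ∫ x in Ω, fderiv ℝ φ x v := by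
  obtain ⟨Φ, h1, h2, h3, h4⟩ := H.exists_smooth_seq hF hΩo hΩb hFb
  have hDF := H.memLp_restrict hΩb
  have hc : Continuous fun x => fderiv ℝ φ x v :=
    (hφ.continuous_fderiv (by norm_num)).clm_apply continuous_const
  obtain ⟨M, hM⟩ := exists_bound_comp_of_close hF hΩb hc
  have hlim : Tendsto (fun n => ∫ x in Ω, fderiv ℝ φ (Φ n x) v * (fderiv ℝ (Φ n) x).det) atTop
      (𝓝 (∫ x in Ω, fderiv ℝ φ (F x) v * (DF x).det)) := by
    refine tendsto_integral_mul (M := M)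
      (fun n => (hc.comp (h1 n).continuous).aestronglyMeasurable) (fun n => ?_) ?_
      (fun n => integrable_det (memLp_fderiv_restrict (h1 n) hΩb)) (integrable_det hDF)
      (tendsto_lintegral_det_sub (fun n => (memLp_fderiv_restrict (h1 n) hΩb).1) hDF h4)
    · filter_upwards [ae_restrict_mem hΩo.measurableSet] with x hx
      exact hM _ (fun x hx => (h3 n x hx).trans (one_div_nat_succ_le_one n)) x hx
    · filter_upwards [ae_restrict_mem hΩo.measurableSet] with x hx
      exact (hc.tendsto _).comp (tendsto_of_close fun n => h3 n x hx)
  refine tendsto_nhds_unique hlim (tendsto_const_nhds.congr fun n => ?_)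
  exact (_root_.setIntegral_fderiv_comp_mul_det hΩo hΩb ((h1 n).of_le two_le_smooth) (h2 n) hφ v).symm

/-- The weak form of the chain rule for the inverse of `F`. -/
lemma HasW12locDeriv.setIntegral_mul_fderiv_comp_mul_det
    (H : HasW12locDeriv F DF) (hF : Continuous F) (hΩo : IsOpen Ω) (hΩb : Bornology.IsBounded Ω)
    (hFb : ∀ x ∈ frontier Ω, F x = x) {φ : Plane → ℝ} (hφ : ContDiff ℝ 1 φ) {a : Plane → ℝ}
    (ha : IsTestFun Ω a) (v : Plane) :
    ∫ x in Ω, a x * fderiv ℝ φ (F x) v * (DF x).det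
      = -∫ x in Ω, φ (F x) * fderiv ℝ a x (planeAdj (DF x) v) := by
  obtain ⟨Φ, h1, h2, h3, h4⟩ := H.exists_smooth_seq hF hΩo hΩb hFb
  have hfin : IsFiniteMeasure (volume.restrict Ω : Measure Plane) :=
    ⟨by simpa using hΩb.measure_lt_top⟩
  have hDF := H.memLp_restrict hΩb
  have hΦL := fun n => memLp_fderiv_restrict (h1 n) hΩb
  have hc : Continuous fun x => fderiv ℝ φ x v :=
    (hφ.continuous_fderiv (by norm_num)).clm_apply continuous_const
  obtain ⟨M, hM⟩ := exists_bound_comp_of_close hF hΩb hc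
  obtain ⟨M', hM'⟩ := exists_bound_comp_of_close hF hΩb hφ.continuous
  obtain ⟨A, hA⟩ := ha.smooth.continuous.bounded_above_of_compact_support ha.compact
  have ha' : Continuous (fderiv ℝ a) := ha.smooth.continuous_fderiv (by simp)
  obtain ⟨A', hA'⟩ := ha'.bounded_above_of_compact_support (ha.compact.fderiv ℝ)
  have hle : ∀ n x, ‖(fderiv ℝ (Φ n) - DF) x‖ = ‖fderiv ℝ (Φ n) x - DF x‖ := fun _ _ => rfl
  have hlim1 : Tendsto (fun n => ∫ x in Ω, a x * fderiv ℝ φ (Φ n x) v * (fderiv ℝ (Φ n) x).det)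
      atTop (𝓝 (∫ x in Ω, a x * fderiv ℝ φ (F x) v * (DF x).det)) := by
    refine tendsto_integral_mul (M := A * M)
      (fun n => (ha.smooth.continuous.mul (hc.comp (h1 n).continuous)).aestronglyMeasurable)
      (fun n => ?_) ?_
      (fun n => integrable_det (hΦL n)) (integrable_det hDF)
      (tendsto_lintegral_det_sub (fun n => (hΦL n).1) hDF h4)
    · filter_upwards [ae_restrict_mem hΩo.measurableSet] with x hx
      have := hM _ (fun x hx => (h3 n x hx).trans (one_div_nat_succ_le_one n)) x hx
      rw [abs_mul]
      exact mul_le_mul (hA x) this (abs_nonneg _) ((norm_nonneg _).trans (hA x))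
    · filter_upwards [ae_restrict_mem hΩo.measurableSet] with x hx
      exact tendsto_const_nhds.mul ((hc.tendsto _).comp (tendsto_of_close fun n => h3 n x hx))
  have hint : ∀ {B : Plane → PlaneMat}, MemLp B 2 (volume.restrict Ω) →
      Integrable (fun x => fderiv ℝ a x (planeAdj (B x) v)) (volume.restrict Ω) := by
    intro B hB
    have hBi := (hB.integrable (q := 2) (by norm_num)).norm.const_mul (A' * ‖v‖)
    refine hBi.mono' ?_ (.of_forall fun x => ?_)
    · have h1 := ha'.aestronglyMeasurable (μ := volume.restrict Ω)
      have h2 : AEStronglyMeasurable (fun x => planeAdj (B x) v) (volume.restrict Ω) :=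
        (continuous_planeAdj.clm_apply continuous_const).comp_aestronglyMeasurable hB.1
      exact (ContinuousLinearMap.apply ℝ ℝ).flip.aestronglyMeasurable_comp₂ h1 h2
    · calc _ ≤ ‖fderiv ℝ a x‖ * ‖planeAdj (B x) v‖ := ContinuousLinearMap.le_opNorm _ _
        _ ≤ A' * (‖B x‖ * ‖v‖) := by
          refine mul_le_mul (hA' x) (norm_planeAdj_apply_le _ _) (norm_nonneg _)
            ((norm_nonneg _).trans (hA' x))
        _ = _ := by ring
  have hlim2 : Tendsto (fun n => ∫ x in Ω, φ (Φ n x) * fderiv ℝ a x (planeAdj (fderiv ℝ (Φ n) x) v))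
      atTop (𝓝 (∫ x in Ω, φ (F x) * fderiv ℝ a x (planeAdj (DF x) v))) := by
    refine tendsto_integral_mul (M := M')
      (fun n => (hφ.continuous.comp (h1 n).continuous).aestronglyMeasurable) (fun n => ?_) ?_
      (fun n => hint (hΦL n)) (hint hDF) ?_
    · filter_upwards [ae_restrict_mem hΩo.measurableSet] with x hx
      exact hM' _ (fun x hx => (h3 n x hx).trans (one_div_nat_succ_le_one n)) x hx
    · filter_upwards [ae_restrict_mem hΩo.measurableSet] with x hx
      exact (hφ.continuous.tendsto _).comp (tendsto_of_close fun n => h3 n x hx)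
    · have hone : eLpNorm (fun _ : Plane => (1 : ℝ)) 2 (volume.restrict Ω) ≠ ⊤ :=
        (memLp_const (1 : ℝ)).2.ne
      have hb : Tendsto (fun n => ENNReal.ofReal (A' * ‖v‖) * (eLpNorm (fderiv ℝ (Φ n) - DF) 2
          (volume.restrict Ω) * eLpNorm (fun _ : Plane => (1 : ℝ)) 2 (volume.restrict Ω)))
          atTop (𝓝 0) := by
        have := ENNReal.Tendsto.const_mul (ENNReal.Tendsto.mul_const h4 (.inr hone))
          (.inr (ENNReal.ofReal_ne_top (r := A' * ‖v‖)))
        simpa using this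
      refine tendsto_of_tendsto_of_tendsto_of_le_of_le tendsto_const_nhds hb
        (fun _ => zero_le) fun n => ?_
      refine le_trans ?_ (mul_le_mul_right (lintegral_enorm_mul_le ((hΦL n).1.sub hDF.1)
        aestronglyMeasurable_const) _)
      rw [← lintegral_const_mul' _ _ ENNReal.ofReal_ne_top]
      refine lintegral_mono fun x => ?_
      rw [← map_sub, ← sub_apply, ← planeAdj_sub]
      simp only [enorm_one, mul_one]
      rw [← ofReal_norm, ← ofReal_norm, ← ENNReal.ofReal_mul' (norm_nonneg _)]
      refine ENNReal.ofReal_le_ofReal ?_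
      calc _ ≤ ‖fderiv ℝ a x‖ * ‖planeAdj (fderiv ℝ (Φ n) x - DF x) v‖ :=
            ContinuousLinearMap.le_opNorm _ _
        _ ≤ A' * (‖fderiv ℝ (Φ n) x - DF x‖ * ‖v‖) := by
          refine mul_le_mul (hA' x) (norm_planeAdj_apply_le _ _) (norm_nonneg _)
            ((norm_nonneg _).trans (hA' x))
        _ = _ := by rw [hle]; ring
  refine tendsto_nhds_unique hlim1 (hlim2.neg.congr fun n => ?_)
  have h := integral_mul_fderiv_comp_mul_det ((h1 n).of_le two_le_smooth)
    (ha.smooth.of_le (by simp)) ha.compact hφ v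
  rw [setIntegral_eq_integral_of_forall_compl_eq_zero fun x hx => by
      rw [ha.fderiv_eq_zero hx]; simp,
    setIntegral_eq_integral_of_forall_compl_eq_zero fun x hx => by
      rw [ha.eq_zero hx]; simp, ← h]
  simp_rw [mul_assoc]

/-- The change of variables formula: `F` maps the measure `J_F dx` on `Ω` to Lebesgue measure. -/
theorem HasW12locDeriv.map_withDensity_det
    (H : HasW12locDeriv F DF) (hF : Continuous F) (hΩo : IsOpen Ω) (hΩb : Bornology.IsBounded Ω)
    (hFb : ∀ x ∈ frontier Ω, F x = x) (hJ : ∀ᵐ x ∂(volume.restrict Ω), 0 ≤ (DF x).det) :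
    ((volume.restrict Ω).withDensity fun x => ENNReal.ofReal (DF x).det).map F
      = volume.restrict Ω := by
  have hfin : IsFiniteMeasure (volume.restrict Ω : Measure Plane) :=
    ⟨by simpa using hΩb.measure_lt_top⟩
  have hDF := H.memLp_restrict hΩb
  have hJi := integrable_det hDF
  have hfin2 : IsFiniteMeasure ((volume.restrict Ω).withDensity
      fun x => ENNReal.ofReal (DF x).det) := isFiniteMeasure_withDensity_ofReal hJi.2
  -- The characteristic functions of the two measures are compared through real and imaginary parts.
  -- For t ≠ 0, cos⟨t, ·⟩ and sin⟨t, ·⟩ are derivatives along t of bounded functions, to which the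
  -- formula for directional derivatives applies; for t = 0 a linear function yields equality of the
  -- total masses.
  have key : ∀ t : Plane,
      ∫ x in Ω, Real.cos ⟪F x, t⟫ * (DF x).det = ∫ x in Ω, Real.cos ⟪x, t⟫ ∧
      ∫ x in Ω, Real.sin ⟪F x, t⟫ * (DF x).det = ∫ x in Ω, Real.sin ⟪x, t⟫ := by
    intro t
    have hd : ∀ (s : Plane) x, HasFDerivAt (fun x : Plane => ⟪s, x⟫) (innerSL ℝ s) x :=
      fun s x => (innerSL ℝ s).hasFDerivAt
    have hC : ∀ s : Plane, ContDiff ℝ 1 fun x : Plane => ⟪s, x⟫ := fun s =>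
      (innerSL ℝ s).contDiff
    by_cases ht : t = 0
    · have h := H.setIntegral_fderiv_comp_mul_det hF hΩo hΩb hFb (hC (planeBasis 0)) (planeBasis 0)
      simp_rw [(hd _ _).fderiv] at h
      subst ht
      simpa using h
    · have ht2 : ⟪t, t⟫ ≠ 0 := inner_self_ne_zero.2 ht
      constructor
      · have h := H.setIntegral_fderiv_comp_mul_det hF hΩo hΩb hFb
          (φ := fun x => ⟪t, t⟫⁻¹ * Real.sin ⟪t, x⟫) (contDiff_const.mul (hC t).sin) t
        have hf : ∀ x, fderiv ℝ (fun x => ⟪t, t⟫⁻¹ * Real.sin ⟪t, x⟫) x t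
            = Real.cos ⟪x, t⟫ := fun x => by
          rw [((hd t x).sin.const_mul _).fderiv, real_inner_comm t x]
          simp only [smul_apply, innerSL_apply_apply, smul_eq_mul]
          field_simp
        simpa only [hf] using h
      · have h := H.setIntegral_fderiv_comp_mul_det hF hΩo hΩb hFb
          (φ := fun x => -⟪t, t⟫⁻¹ * Real.cos ⟪t, x⟫) (contDiff_const.mul (hC t).cos) t
        have hf : ∀ x, fderiv ℝ (fun x => -⟪t, t⟫⁻¹ * Real.cos ⟪t, x⟫) x t
            = Real.sin ⟪x, t⟫ := fun x => by
          rw [((hd t x).cos.const_mul _).fderiv, real_inner_comm t x]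
          simp only [smul_apply, innerSL_apply_apply, smul_eq_mul]
          field_simp
        simpa only [hf] using h
  have hfin3 : IsFiniteMeasure (((volume.restrict Ω).withDensity
      fun x => ENNReal.ofReal (DF x).det).map F) := Measure.isFiniteMeasure_map _ _
  refine Measure.ext_of_charFun (funext fun t => ?_)
  rw [charFun_apply, charFun_apply, integral_map hF.aemeasurable
    (by exact Continuous.aestronglyMeasurable (by fun_prop)),
    integral_withDensity_eq_integral_toReal_smul₀ hJi.1.aemeasurable.ennreal_ofReal
      (.of_forall fun x => ENNReal.ofReal_lt_top)]
  have e : ∀ θ : ℝ, Complex.exp (θ * Complex.I) = Real.cos θ + Real.sin θ * Complex.I := fun θ => by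
    rw [Complex.exp_mul_I, Complex.ofReal_cos, Complex.ofReal_sin]
  have hb : ∀ {G : Plane → ℝ}, Continuous G → (∀ x, |G x| ≤ 1) →
      Integrable (fun x => G x * (DF x).det) (volume.restrict Ω) := fun hG h1 =>
    hJi.bdd_mul hG.aestronglyMeasurable (.of_forall h1)
  have hb' : ∀ {G : Plane → ℝ}, Continuous G → (∀ x, |G x| ≤ 1) →
      Integrable G (volume.restrict Ω) := fun hG h1 =>
    (integrable_const (1 : ℝ)).mono' hG.aestronglyMeasurable (.of_forall h1)
  have cF : Continuous fun x => ⟪F x, t⟫ := hF.inner continuous_const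
  have cI : Continuous fun x : Plane => ⟪x, t⟫ := continuous_id.inner continuous_const
  have i1 : Integrable (fun x => ((Real.cos ⟪F x, t⟫ * (DF x).det : ℝ) : ℂ)) (volume.restrict Ω) :=
    (hb (Real.continuous_cos.comp cF) (fun x => Real.abs_cos_le_one _)).ofReal (𝕜 := ℂ)
  have i2 : Integrable (fun x => ((Real.sin ⟪F x, t⟫ * (DF x).det : ℝ) : ℂ)) (volume.restrict Ω) :=
    (hb (Real.continuous_sin.comp cF) (fun x => Real.abs_sin_le_one _)).ofReal (𝕜 := ℂ)
  have i3 : Integrable (fun x => ((Real.cos ⟪x, t⟫ : ℝ) : ℂ)) (volume.restrict Ω) :=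
    (hb' (Real.continuous_cos.comp cI) (fun x => Real.abs_cos_le_one _)).ofReal (𝕜 := ℂ)
  have i4 : Integrable (fun x => ((Real.sin ⟪x, t⟫ : ℝ) : ℂ)) (volume.restrict Ω) :=
    (hb' (Real.continuous_sin.comp cI) (fun x => Real.abs_sin_le_one _)).ofReal (𝕜 := ℂ)
  calc _ = ∫ x in Ω, (((Real.cos ⟪F x, t⟫ * (DF x).det : ℝ) : ℂ)
          + ((Real.sin ⟪F x, t⟫ * (DF x).det : ℝ) : ℂ) * Complex.I) := by
        refine integral_congr_ae ?_
        filter_upwards [hJ] with x hx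
        rw [ENNReal.toReal_ofReal hx, e, Complex.real_smul]
        push_cast
        ring
    _ = ∫ x in Ω, (((Real.cos ⟪x, t⟫ : ℝ) : ℂ) + ((Real.sin ⟪x, t⟫ : ℝ) : ℂ) * Complex.I) := by
        rw [integral_add i1 (i2.mul_const _), integral_add i3 (i4.mul_const _)]
        simp_rw [integral_mul_const]
        erw [integral_complex_ofReal, integral_complex_ofReal, integral_complex_ofReal,
          integral_complex_ofReal]
        rw [(key t).1, (key t).2]
    _ = _ := by simp_rw [e]

end ChangeOfVariables

end
noncomputable section

/-! ### Quasiconformal self-maps of a bounded open set that fix its boundary -/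

/-- The quasiconformal map `F` preserves the bounded open set `Ω` and fixes its boundary. -/
structure IsQCSelfMap (K : ℝ) (Ω : Set Plane) (F : Plane ≃ₜ Plane) (DF : Plane → PlaneMat) :
    Prop where
  isOpen : IsOpen Ω
  isBounded : Bornology.IsBounded Ω
  qc : IsQuasiconformal K F DF
  image_eq : F '' Ω = Ω
  fixes : ∀ x ∈ frontier Ω, F x = x

/-- The pull-back `DF(x)ᵗ w(F(x))` of a vector field. -/
def pullVec (F : Plane ≃ₜ Plane) (DF : Plane → PlaneMat) : (Plane → Plane) →ₗ[ℝ] (Plane → Plane) where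
  toFun w x := ContinuousLinearMap.adjoint (DF x) (w (F x))
  map_add' w w' := by ext1 x; simp
  map_smul' c w := by ext1 x; simp

/-- The push-forward `DF(x)⁻ᵗ w(x)`, `x = F⁻¹(y)`, of a vector field. -/
def pushVec (F : Plane ≃ₜ Plane) (DF : Plane → PlaneMat) : (Plane → Plane) →ₗ[ℝ] (Plane → Plane) where
  toFun w y := (DF (F.symm y)).det⁻¹ •
    planeAdj (ContinuousLinearMap.adjoint (DF (F.symm y))) (w (F.symm y))
  map_add' w w' := by ext1 x; simp
  map_smul' c w := by ext1 x; simp [smul_comm c]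

lemma pullVec_apply (F : Plane ≃ₜ Plane) (DF : Plane → PlaneMat) (w : Plane → Plane) (x : Plane) :
    pullVec F DF w x = ContinuousLinearMap.adjoint (DF x) (w (F x)) := rfl

lemma pushVec_apply (F : Plane ≃ₜ Plane) (DF : Plane → PlaneMat) (w : Plane → Plane) (y : Plane) :
    pushVec F DF w y = (DF (F.symm y)).det⁻¹ •
      planeAdj (ContinuousLinearMap.adjoint (DF (F.symm y))) (w (F.symm y)) := rfl

/-- The measure `J_F dx` on `Ω`. -/
abbrev jacMeasure (Ω : Set Plane) (DF : Plane → PlaneMat) : Measure Plane :=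
  (volume.restrict Ω).withDensity fun x => ENNReal.ofReal (DF x).det

namespace IsQCSelfMap

variable {K : ℝ} {Ω : Set Plane} {F : Plane ≃ₜ Plane} {DF : Plane → PlaneMat}

lemma K_pos (H : IsQCSelfMap K Ω F DF) : 0 < K := by linarith [H.qc.one_le]

lemma isFiniteMeasure (H : IsQCSelfMap K Ω F DF) : IsFiniteMeasure (volume.restrict Ω) :=
  ⟨by simpa using H.isBounded.measure_lt_top⟩

lemma distortion (H : IsQCSelfMap K Ω F DF) :
    ∀ᵐ x ∂(volume.restrict Ω), ‖DF x‖ ^ 2 ≤ K * (DF x).det :=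
  ae_restrict_of_ae H.qc.distortion

lemma det_nonneg (H : IsQCSelfMap K Ω F DF) : ∀ᵐ x ∂(volume.restrict Ω), 0 ≤ (DF x).det := by
  filter_upwards [H.distortion] with x hx
  by_contra hneg
  have := mul_neg_of_pos_of_neg H.K_pos (not_le.1 hneg)
  have := sq_nonneg ‖DF x‖
  linarith

lemma memLp (H : IsQCSelfMap K Ω F DF) : MemLp DF 2 (volume.restrict Ω) :=
  H.qc.sobolev.memLp_restrict H.isBounded

lemma aemeasurable_det (H : IsQCSelfMap K Ω F DF) :
    AEMeasurable (fun x => (DF x).det) (volume.restrict Ω) :=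
  (integrable_det H.memLp).1.aemeasurable

lemma map_jacMeasure (H : IsQCSelfMap K Ω F DF) : (jacMeasure Ω DF).map F = volume.restrict Ω :=
  H.qc.sobolev.map_withDensity_det F.continuous H.isOpen H.isBounded H.fixes H.det_nonneg

lemma map_symm (H : IsQCSelfMap K Ω F DF) : (volume.restrict Ω).map F.symm = jacMeasure Ω DF := by
  rw [← H.map_jacMeasure, Measure.map_map F.symm.continuous.measurable F.continuous.measurable]
  simp

/-- This is Lusin's condition (N) for F on Ω: the measure A ↦ |F(A)| has the density J_F. -/
lemma quasiMeasurePreserving_symm (H : IsQCSelfMap K Ω F DF) :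
    Measure.QuasiMeasurePreserving F.symm (volume.restrict Ω) (volume.restrict Ω) :=
  ⟨F.symm.continuous.measurable, by
    rw [H.map_symm]; exact withDensity_absolutelyContinuous _ _⟩

lemma ae_det_symm_pos (H : IsQCSelfMap K Ω F DF) :
    ∀ᵐ y ∂(volume.restrict Ω), 0 < (DF (F.symm y)).det := by
  have h : ∀ᵐ x ∂(jacMeasure Ω DF), 0 < (DF x).det := by
    rw [ae_withDensity_iff' H.aemeasurable_det.ennreal_ofReal]
    refine .of_forall fun x hx => ?_
    by_contra hneg
    exact hx (ENNReal.ofReal_eq_zero.2 (not_lt.1 hneg))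
  rw [← H.map_symm] at h
  exact ae_of_ae_map F.symm.continuous.aemeasurable h

/-- The preimage under F of a null set is null for J_F dx, hence the restriction to points where the
Jacobian is positive. -/
lemma ae_comp (H : IsQCSelfMap K Ω F DF) {p : Plane → Prop}
    (hp : ∀ᵐ y ∂(volume.restrict Ω), p y) :
    ∀ᵐ x ∂(volume.restrict Ω), 0 < (DF x).det → p (F x) := by
  rw [← H.map_jacMeasure] at hp
  have h := ae_of_ae_map F.continuous.aemeasurable hp
  rw [ae_withDensity_iff' H.aemeasurable_det.ennreal_ofReal] at h
  filter_upwards [h] with x hx hpos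
  exact hx (ENNReal.ofReal_pos.2 hpos).ne'

/-- The distortion inequality leaves no degenerate nonzero differentials. This dichotomy replaces
positivity of J_F almost everywhere: where DF = 0, pulled-back fields vanish. -/
lemma ae_eq_zero_or_pos (H : IsQCSelfMap K Ω F DF) :
    ∀ᵐ x ∂(volume.restrict Ω), DF x = 0 ∨ 0 < (DF x).det := by
  filter_upwards [H.distortion, H.det_nonneg] with x hx h0
  rcases h0.eq_or_lt with h | h
  · left
    rw [← h, mul_zero] at hx
    exact norm_eq_zero.1 (pow_eq_zero_iff two_ne_zero |>.1 (le_antisymm hx (sq_nonneg _)))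
  · exact .inr h

lemma integral_eq (H : IsQCSelfMap K Ω F DF) (g : Plane → ℝ) :
    ∫ y in Ω, g y = ∫ x in Ω, (DF x).det * g (F x) := by
  conv_lhs => rw [← H.map_jacMeasure]
  rw [F.measurableEmbedding.integral_map,
    integral_withDensity_eq_integral_toReal_smul₀ H.aemeasurable_det.ennreal_ofReal
      (.of_forall fun x => ENNReal.ofReal_lt_top)]
  refine integral_congr_ae ?_
  filter_upwards [H.det_nonneg] with x hx
  rw [ENNReal.toReal_ofReal hx, smul_eq_mul]

lemma lintegral_eq (H : IsQCSelfMap K Ω F DF) (g : Plane → ℝ≥0∞) :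
    ∫⁻ y in Ω, g y = ∫⁻ x in Ω, ENNReal.ofReal (DF x).det * g (F x) := by
  conv_lhs => rw [← H.map_jacMeasure]
  rw [F.measurableEmbedding.lintegral_map,
    lintegral_withDensity_eq_lintegral_mul_non_measurable₀ _ H.aemeasurable_det.ennreal_ofReal
      (.of_forall fun x => ENNReal.ofReal_lt_top)]
  rfl

lemma pullVec_congr (H : IsQCSelfMap K Ω F DF) {w w' : Plane → Plane}
    (h : w =ᵐ[volume.restrict Ω] w') :
    pullVec F DF w =ᵐ[volume.restrict Ω] pullVec F DF w' := by
  filter_upwards [H.ae_eq_zero_or_pos, H.ae_comp h] with x hx hx'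
  rw [pullVec_apply, pullVec_apply]
  rcases hx with h0 | hpos
  · simp [h0]
  · rw [hx' hpos]

lemma pushVec_congr (H : IsQCSelfMap K Ω F DF) {w w' : Plane → Plane}
    (h : w =ᵐ[volume.restrict Ω] w') :
    pushVec F DF w =ᵐ[volume.restrict Ω] pushVec F DF w' := by
  filter_upwards [H.quasiMeasurePreserving_symm.ae h] with x hx
  rw [pushVec_apply, pushVec_apply, hx]

lemma aestronglyMeasurable_pullVec (H : IsQCSelfMap K Ω F DF) {w : Plane → Plane}
    (hw : AEStronglyMeasurable w (volume.restrict Ω)) :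
    AEStronglyMeasurable (pullVec F DF w) (volume.restrict Ω) := by
  refine AEStronglyMeasurable.congr ?_ (H.pullVec_congr hw.ae_eq_mk).symm
  have h1 : AEStronglyMeasurable (fun x => ContinuousLinearMap.adjoint (DF x)) (volume.restrict Ω) :=
    ContinuousLinearMap.adjoint.continuous.comp_aestronglyMeasurable H.memLp.1
  have h2 : AEStronglyMeasurable (fun x => hw.mk w (F x)) (volume.restrict Ω) :=
    (hw.stronglyMeasurable_mk.comp_measurable F.continuous.measurable).aestronglyMeasurable
  exact (ContinuousLinearMap.id ℝ PlaneMat).aestronglyMeasurable_comp₂ h1 h2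

lemma aestronglyMeasurable_pushVec (H : IsQCSelfMap K Ω F DF) {w : Plane → Plane}
    (hw : AEStronglyMeasurable w (volume.restrict Ω)) :
    AEStronglyMeasurable (pushVec F DF w) (volume.restrict Ω) := by
  have h1 : AEStronglyMeasurable (fun x => planeAdj (ContinuousLinearMap.adjoint (DF x)))
      (volume.restrict Ω) :=
    (continuous_planeAdj.comp ContinuousLinearMap.adjoint.continuous).comp_aestronglyMeasurable
      H.memLp.1
  have h2 : AEStronglyMeasurable (fun x => (DF x).det⁻¹ •
      planeAdj (ContinuousLinearMap.adjoint (DF x)) (w x)) (volume.restrict Ω) :=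
    H.aemeasurable_det.inv.aestronglyMeasurable.smul
      ((ContinuousLinearMap.id ℝ PlaneMat).aestronglyMeasurable_comp₂ h1 hw)
  exact h2.comp_quasiMeasurePreserving H.quasiMeasurePreserving_symm

/-- Pointwise |DFᵗ w(F)|² ≤ K J_F |w(F)|², and the change of variables absorbs J_F. -/
lemma lintegral_pullVec_le (H : IsQCSelfMap K Ω F DF) (w : Plane → Plane) :
    ∫⁻ x in Ω, ‖pullVec F DF w x‖ₑ ^ 2 ≤ ENNReal.ofReal K * ∫⁻ x in Ω, ‖w x‖ₑ ^ 2 := by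
  rw [H.lintegral_eq fun x => ‖w x‖ₑ ^ 2, ← lintegral_const_mul' _ _ ENNReal.ofReal_ne_top]
  refine lintegral_mono_ae ?_
  filter_upwards [H.distortion] with x hx
  rw [← mul_assoc, ← ENNReal.ofReal_mul H.K_pos.le, ← ofReal_norm, ← ofReal_norm,
    ← ENNReal.ofReal_pow (norm_nonneg _), ← ENNReal.ofReal_pow (norm_nonneg _),
    ← ENNReal.ofReal_mul' (by positivity)]
  refine ENNReal.ofReal_le_ofReal ?_
  calc ‖pullVec F DF w x‖ ^ 2 ≤ (‖DF x‖ * ‖w (F x)‖) ^ 2 := by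
        gcongr; exact norm_adjoint_apply_le _ _
    _ = ‖DF x‖ ^ 2 * ‖w (F x)‖ ^ 2 := by ring
    _ ≤ _ := by gcongr

/-- After the change of variables the integrand is at most J_F⁻¹ |DF|² |w|² ≤ K |w|² where J_F > 0;
where J_F = 0 the Jacobian weight kills it. -/
lemma lintegral_pushVec_le (H : IsQCSelfMap K Ω F DF) (w : Plane → Plane) :
    ∫⁻ x in Ω, ‖pushVec F DF w x‖ₑ ^ 2 ≤ ENNReal.ofReal K * ∫⁻ x in Ω, ‖w x‖ₑ ^ 2 := by
  rw [H.lintegral_eq fun x => ‖pushVec F DF w x‖ₑ ^ 2,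
    ← lintegral_const_mul' _ _ ENNReal.ofReal_ne_top]
  refine lintegral_mono_ae ?_
  filter_upwards [H.distortion, H.det_nonneg] with x hx h0
  rw [← ofReal_norm, ← ofReal_norm,
    ← ENNReal.ofReal_pow (norm_nonneg _), ← ENNReal.ofReal_pow (norm_nonneg _),
    ← ENNReal.ofReal_mul h0, ← ENNReal.ofReal_mul H.K_pos.le]
  refine ENNReal.ofReal_le_ofReal ?_
  rw [pushVec_apply, F.symm_apply_apply, norm_smul, norm_inv, Real.norm_of_nonneg h0]
  have h1 : ‖planeAdj (ContinuousLinearMap.adjoint (DF x)) (w x)‖ ≤ ‖DF x‖ * ‖w x‖ := by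
    simpa using norm_planeAdj_apply_le (ContinuousLinearMap.adjoint (DF x)) (w x)
  rcases h0.eq_or_lt with h | h
  · rw [← h, zero_mul]
    have := H.K_pos.le
    positivity
  · set J := (DF x).det
    calc J * (J⁻¹ * ‖planeAdj (ContinuousLinearMap.adjoint (DF x)) (w x)‖) ^ 2
        ≤ J * (J⁻¹ * (‖DF x‖ * ‖w x‖)) ^ 2 := by gcongr
      _ = J⁻¹ * (‖DF x‖ ^ 2 * ‖w x‖ ^ 2) := by field_simp
      _ ≤ J⁻¹ * ((K * J) * ‖w x‖ ^ 2) := by gcongr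
      _ = K * ‖w x‖ ^ 2 := by field_simp

/-- The Jacobian is positive at F⁻¹(y) for almost every y. The opposite composition would require
J_F(x) > 0 for almost every x; it is established later for gradients of elements of H¹₀(Ω) only, in
`pullL_pushL_gradL`. -/
lemma pushVec_pullVec (H : IsQCSelfMap K Ω F DF) (w : Plane → Plane) :
    pushVec F DF (pullVec F DF w) =ᵐ[volume.restrict Ω] w := by
  filter_upwards [H.ae_det_symm_pos] with y hy
  rw [pushVec_apply, pullVec_apply, planeAdj_apply_apply, planeMat_det_adjoint, smul_smul,
    inv_mul_cancel₀ hy.ne', one_smul, F.apply_symm_apply]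

lemma eLpNorm_le_of_lintegral_le {μ : Measure Plane} {f g : Plane → Plane} {K : ℝ} (hK : 0 ≤ K)
    (h : ∫⁻ x, ‖f x‖ₑ ^ 2 ∂μ ≤ ENNReal.ofReal K * ∫⁻ x, ‖g x‖ₑ ^ 2 ∂μ) :
    eLpNorm f 2 μ ≤ ENNReal.ofReal (√K) * eLpNorm g 2 μ := by
  rw [eLpNorm_two_le_iff, mul_pow, eLpNorm_two_sq, ← ENNReal.ofReal_pow (Real.sqrt_nonneg _),
    Real.sq_sqrt hK]
  exact h

end IsQCSelfMap

/-- The bounded operator on `L²(Ω; ℝ²)` induced by an operator on vector fields. -/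
def lpOperator {μ : Measure Plane} (P : (Plane → Plane) →ₗ[ℝ] (Plane → Plane)) (C : ℝ)
    (hcongr : ∀ f g, f =ᵐ[μ] g → P f =ᵐ[μ] P g)
    (hm : ∀ f, AEStronglyMeasurable f μ → AEStronglyMeasurable (P f) μ)
    (hC : ∀ f, eLpNorm (P f) 2 μ ≤ ENNReal.ofReal C * eLpNorm f 2 μ) :
    Lp Plane 2 μ →L[ℝ] Lp Plane 2 μ :=
  have hL : ∀ f, MemLp f 2 μ → MemLp (P f) 2 μ := fun f hf =>
    ⟨hm f hf.1, (hC f).trans_lt (ENNReal.mul_lt_top ENNReal.ofReal_lt_top hf.2)⟩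
  LinearMap.mkContinuous
    { toFun := fun f => (hL f (Lp.memLp f)).toLp (P f)
      map_add' := fun f g => by
        rw [← MemLp.toLp_add]
        refine MemLp.toLp_congr _ _ ((hcongr _ _ (Lp.coeFn_add f g)).trans ?_)
        rw [map_add]
      map_smul' := fun c f => by
        rw [RingHom.id_apply, ← MemLp.toLp_const_smul]
        refine MemLp.toLp_congr _ _ ((hcongr _ _ (Lp.coeFn_smul c f)).trans ?_)
        rw [map_smul] }
    (max C 0) (fun f => by
      have h := hC f
      rw [LinearMap.coe_mk, AddHom.coe_mk, Lp.norm_toLp, Lp.norm_def]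
      refine (ENNReal.toReal_mono (ENNReal.mul_ne_top ENNReal.ofReal_ne_top
        (Lp.eLpNorm_ne_top f)) h).trans ?_
      rw [ENNReal.toReal_mul, ENNReal.toReal_ofReal'])

lemma coeFn_lpOperator {μ : Measure Plane} {P : (Plane → Plane) →ₗ[ℝ] (Plane → Plane)} {C : ℝ}
    {hcongr : ∀ f g, f =ᵐ[μ] g → P f =ᵐ[μ] P g}
    {hm : ∀ f, AEStronglyMeasurable f μ → AEStronglyMeasurable (P f) μ}
    {hC : ∀ f, eLpNorm (P f) 2 μ ≤ ENNReal.ofReal C * eLpNorm f 2 μ} (f : Lp Plane 2 μ) :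
    lpOperator P C hcongr hm hC f =ᵐ[μ] P f :=
  MemLp.coeFn_toLp (f := P f) ⟨hm f (Lp.aestronglyMeasurable f),
    (hC f).trans_lt (ENNReal.mul_lt_top ENNReal.ofReal_lt_top (Lp.memLp f).2)⟩

namespace IsQCSelfMap

variable {K : ℝ} {Ω : Set Plane} {F : Plane ≃ₜ Plane} {DF : Plane → PlaneMat}

/-- The pull-back operator on `L²(Ω; ℝ²)`. -/
def pullL (H : IsQCSelfMap K Ω F DF) :
    Lp Plane 2 (volume.restrict Ω : Measure Plane) →L[ℝ]
      Lp Plane 2 (volume.restrict Ω : Measure Plane) :=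
  lpOperator (pullVec F DF) (√K) (fun _ _ => H.pullVec_congr)
    (fun _ => H.aestronglyMeasurable_pullVec)
    fun f => eLpNorm_le_of_lintegral_le H.K_pos.le (H.lintegral_pullVec_le f)

/-- The push-forward operator on `L²(Ω; ℝ²)`. -/
def pushL (H : IsQCSelfMap K Ω F DF) :
    Lp Plane 2 (volume.restrict Ω : Measure Plane) →L[ℝ]
      Lp Plane 2 (volume.restrict Ω : Measure Plane) :=
  lpOperator (pushVec F DF) (√K) (fun _ _ => H.pushVec_congr)
    (fun _ => H.aestronglyMeasurable_pushVec)
    fun f => eLpNorm_le_of_lintegral_le H.K_pos.le (H.lintegral_pushVec_le f)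

lemma coeFn_pullL (H : IsQCSelfMap K Ω F DF) (f : Lp Plane 2 (volume.restrict Ω : Measure Plane)) :
    H.pullL f =ᵐ[volume.restrict Ω] pullVec F DF f := coeFn_lpOperator f

lemma coeFn_pushL (H : IsQCSelfMap K Ω F DF) (f : Lp Plane 2 (volume.restrict Ω : Measure Plane)) :
    H.pushL f =ᵐ[volume.restrict Ω] pushVec F DF f := coeFn_lpOperator f

lemma pushL_pullL (H : IsQCSelfMap K Ω F DF) (f : Lp Plane 2 (volume.restrict Ω : Measure Plane)) :
    H.pushL (H.pullL f) = f :=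
  Lp.ext ((H.coeFn_pushL _).trans ((H.pushVec_congr (H.coeFn_pullL f)).trans (H.pushVec_pullVec f)))

/-- The push-forward of an element of `M_K(Ω)` belongs to `M_{KK'}(Ω)`. -/
lemma pushForward_mem (H : IsQCSelfMap K Ω F DF) {L : ℝ} (hL : 1 ≤ L) {σ : Plane → PlaneMat}
    (hσ : σ ∈ MK L Ω) : pushForward F DF σ ∈ MK (L * K) Ω := by
  have hK := H.K_pos
  have hL0 : 0 < L := by linarith
  have hqm := H.quasiMeasurePreserving_symm
  refine ⟨?_, ?_⟩
  · obtain ⟨C, hC⟩ : ∃ C : ℝ, ∀ᵐ x ∂(volume.restrict Ω), ‖σ x‖ ≤ C := by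
      refine ⟨(eLpNorm σ ⊤ (volume.restrict Ω)).toReal, ?_⟩
      filter_upwards [ae_le_eLpNormEssSup (f := σ) (μ := volume.restrict Ω)] with x hx
      rw [eLpNorm_exponent_top]
      rw [← toReal_enorm]
      exact ENNReal.toReal_mono (by simpa using hσ.1.2.ne) hx
    refine memLp_top_of_bound (C := K * C) ?_ ?_
    · have h1 : AEStronglyMeasurable (fun x => (DF x).det⁻¹ •
          (DF x ∘L σ x ∘L ContinuousLinearMap.adjoint (DF x))) (volume.restrict Ω) := by
        refine H.aemeasurable_det.inv.aestronglyMeasurable.smul ?_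
        have h2 : AEStronglyMeasurable (fun x => ContinuousLinearMap.adjoint (DF x))
            (volume.restrict Ω) :=
          ContinuousLinearMap.adjoint.continuous.comp_aestronglyMeasurable H.memLp.1
        have h3 := (ContinuousLinearMap.compL ℝ Plane Plane Plane).aestronglyMeasurable_comp₂
          hσ.1.1 h2
        exact (ContinuousLinearMap.compL ℝ Plane Plane Plane).aestronglyMeasurable_comp₂
          H.memLp.1 h3
      exact h1.comp_quasiMeasurePreserving hqm
    · filter_upwards [hqm.ae hC, hqm.ae H.distortion, H.ae_det_symm_pos] with y h1 h2 h3
      rw [pushForward, norm_smul, norm_inv, Real.norm_of_nonneg h3.le, inv_mul_le_iff₀ h3]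
      set A := DF (F.symm y)
      have hC0 : 0 ≤ C := (norm_nonneg _).trans h1
      calc ‖A ∘L σ (F.symm y) ∘L ContinuousLinearMap.adjoint A‖
          ≤ ‖A‖ * (‖σ (F.symm y)‖ * ‖ContinuousLinearMap.adjoint A‖) :=
            (ContinuousLinearMap.opNorm_comp_le _ _).trans
              (by gcongr; exact ContinuousLinearMap.opNorm_comp_le _ _)
        _ ≤ ‖A‖ * (C * ‖A‖) := by
            gcongr
            exact (LinearIsometryEquiv.norm_map _ _).le
        _ = ‖A‖ ^ 2 * C := by ring
        _ ≤ (K * A.det) * C := by gcongr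
        _ = A.det * (K * C) := by ring
  · filter_upwards [hqm.ae hσ.2, hqm.ae H.distortion, H.ae_det_symm_pos] with y h1 h2 h3 ξ
    set A := DF (F.symm y) with hA
    have e : ⟪pushForward F DF σ y ξ, ξ⟫ = A.det⁻¹ * ⟪σ (F.symm y)
        (ContinuousLinearMap.adjoint A ξ), ContinuousLinearMap.adjoint A ξ⟫ := by
      rw [ContinuousLinearMap.adjoint_inner_right]
      simp [pushForward, real_inner_smul_left, hA]
    obtain ⟨h4, h5⟩ := h1 (ContinuousLinearMap.adjoint A ξ)
    have h6 : ‖ContinuousLinearMap.adjoint A ξ‖ ^ 2 ≤ K * A.det * ‖ξ‖ ^ 2 := by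
      calc _ ≤ (‖A‖ * ‖ξ‖) ^ 2 := by gcongr; exact norm_adjoint_apply_le _ _
        _ = ‖A‖ ^ 2 * ‖ξ‖ ^ 2 := by ring
        _ ≤ _ := by gcongr
    -- The adjugate estimate det A |ξ| ≤ |A| |Aᵗξ| is squared and combined with |A|² ≤ K det A; one
    -- factor det A cancels.
    have h7 : A.det * ‖ξ‖ ^ 2 ≤ K * ‖ContinuousLinearMap.adjoint A ξ‖ ^ 2 := by
      have h8 := abs_det_mul_norm_le A ξ
      rw [abs_of_pos h3] at h8
      have h9 : (A.det * ‖ξ‖) ^ 2 ≤ (‖A‖ * ‖ContinuousLinearMap.adjoint A ξ‖) ^ 2 := by gcongr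
      have h10 : A.det * (A.det * ‖ξ‖ ^ 2)
          ≤ A.det * (K * ‖ContinuousLinearMap.adjoint A ξ‖ ^ 2) := by
        calc _ = (A.det * ‖ξ‖) ^ 2 := by ring
          _ ≤ ‖A‖ ^ 2 * ‖ContinuousLinearMap.adjoint A ξ‖ ^ 2 := by rw [← mul_pow]; exact h9
          _ ≤ (K * A.det) * ‖ContinuousLinearMap.adjoint A ξ‖ ^ 2 := by gcongr
          _ = _ := by ring
      exact le_of_mul_le_mul_left h10 h3
    rw [e]
    constructor
    · rw [le_inv_mul_iff₀ h3]
      refine le_trans ?_ h4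
      rw [mul_inv, mul_left_comm, mul_assoc]
      gcongr
      rw [inv_mul_le_iff₀ hK]
      exact h7
    · rw [inv_mul_le_iff₀ h3]
      refine h5.trans ?_
      calc _ ≤ L * (K * A.det * ‖ξ‖ ^ 2) := by gcongr
        _ = _ := by ring

/-- The Jacobian of the change of variables cancels J_F⁻¹, and DF moves across the inner product as
DFᵗ. Where DF = 0 both integrands vanish. Only gradients enter, so u' and v' need not be known to be
u ∘ F and v ∘ F. -/
lemma energyForm_pushForward (H : IsQCSelfMap K Ω F DF) (σ : Plane → PlaneMat) {u v u' v' : H10 Ω}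
    (hu : gradL Ω u' = H.pullL (gradL Ω u)) (hv : gradL Ω v' = H.pullL (gradL Ω v)) :
    energyForm (pushForward F DF σ) u v = energyForm σ u' v' := by
  rw [energyForm, H.integral_eq, energyForm]
  have hu' : H10grad u' =ᵐ[volume.restrict Ω] pullVec F DF (H10grad u) := by
    rw [← gradL_coe, hu]; exact H.coeFn_pullL _
  have hv' : H10grad v' =ᵐ[volume.restrict Ω] pullVec F DF (H10grad v) := by
    rw [← gradL_coe, hv]; exact H.coeFn_pullL _
  refine integral_congr_ae ?_
  filter_upwards [hu', hv', H.ae_eq_zero_or_pos] with x h1 h2 h3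
  rw [h1, h2, pullVec_apply, pullVec_apply]
  rcases h3 with h0 | hpos
  · simp [pushForward, h0]
  · rw [ContinuousLinearMap.adjoint_inner_right]
    simp only [pushForward, F.symm_apply_apply, smul_apply, real_inner_smul_left,
      ContinuousLinearMap.comp_apply]
    rw [mul_inv_cancel_left₀ hpos.ne']

end IsQCSelfMap

end
noncomputable section

/-! ### The isomorphism of `H¹₀(Ω)` induced by a quasiconformal self-map -/

lemma mkPair_mem_H10_of_tendsto {Ω : Set Plane} {u : Plane → ℝ} {w : Plane → Plane}
    (hu : MemLp u 2 (volume.restrict Ω)) (hw : MemLp w 2 (volume.restrict Ω)) (v : ℕ → H10 Ω)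
    (h1 : Tendsto (fun n => eLpNorm (H10val (v n) - u) 2 (volume.restrict Ω)) atTop (𝓝 0))
    (h2 : Tendsto (fun n => eLpNorm (H10grad (v n) - w) 2 (volume.restrict Ω)) atTop (𝓝 0)) :
    mkPair hu hw ∈ H10 Ω := by
  refine mkPair_mem_H10 hu hw fun η hη => ?_
  have hη' : 0 < ENNReal.ofReal η := ENNReal.ofReal_pos.2 hη
  obtain ⟨n, h1, h2⟩ := ((h1.eventually (ge_mem_nhds hη')).and
    (h2.eventually (ge_mem_nhds hη'))).exists
  exact ⟨v n, h1, h2⟩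

lemma gradient_comp {φ : Plane → ℝ} {Φ : Plane → Plane} (hφ : Differentiable ℝ φ)
    (hΦ : Differentiable ℝ Φ) (x : Plane) :
    gradient (fun x => φ (Φ x)) x = ContinuousLinearMap.adjoint (fderiv ℝ Φ x)
      (gradient φ (Φ x)) := by
  refine ext_inner_right ℝ fun v => ?_
  have h : HasFDerivAt (fun x => φ (Φ x)) ((fderiv ℝ φ (Φ x)).comp (fderiv ℝ Φ x)) x :=
    (hφ _).hasFDerivAt.comp x (hΦ x).hasFDerivAt
  rw [inner_gradient, h.fderiv, ContinuousLinearMap.adjoint_inner_left, inner_gradient]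
  rfl

/-- Φ need not map Ω into itself; it suffices that points outside Ω are fixed, since they then
cannot land in the support of φ. -/
lemma IsTestFun.comp_of_tsupport {Ω : Set Plane} (hΩb : Bornology.IsBounded Ω) {φ : Plane → ℝ}
    (hφ : IsTestFun Ω φ) {Φ : Plane → Plane} (hΦ : ContDiff ℝ ∞ Φ)
    (hs : tsupport (fun x => Φ x - x) ⊆ Ω) : IsTestFun Ω fun x => φ (Φ x) := by
  have hid : ∀ x ∉ Ω, Φ x = x := fun x hx =>
    sub_eq_zero.1 (image_eq_zero_of_notMem_tsupport (f := fun x => Φ x - x) fun h => hx (hs h))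
  have hScl : IsClosed (Φ ⁻¹' tsupport φ) := (isClosed_tsupport φ).preimage hΦ.continuous
  have hSΩ : Φ ⁻¹' tsupport φ ⊆ Ω := by
    intro x hx
    by_contra hxΩ
    rw [mem_preimage, hid x hxΩ] at hx
    exact hxΩ (hφ.support_subset hx)
  have hSc : IsCompact (Φ ⁻¹' tsupport φ) :=
    Metric.isCompact_of_isClosed_isBounded hScl (hΩb.subset hSΩ)
  have hz : ∀ x ∉ Φ ⁻¹' tsupport φ, φ (Φ x) = 0 := fun x hx =>
    image_eq_zero_of_notMem_tsupport hx
  refine ⟨hφ.smooth.comp hΦ, HasCompactSupport.intro hSc hz, ?_⟩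
  refine (hScl.closure_subset_iff.2 fun x hx => ?_).trans hSΩ
  by_contra h
  exact hx (hz x h)

/-! ### Composition of test functions with F and with F⁻¹ -/

namespace IsQCSelfMap

variable {K : ℝ} {Ω : Set Plane} {F : Plane ≃ₜ Plane} {DF : Plane → PlaneMat}

lemma memLp_pullVec (H : IsQCSelfMap K Ω F DF) {w : Plane → Plane}
    (hw : MemLp w 2 (volume.restrict Ω)) : MemLp (pullVec F DF w) 2 (volume.restrict Ω) :=
  ⟨H.aestronglyMeasurable_pullVec hw.1,
    (eLpNorm_le_of_lintegral_le H.K_pos.le (H.lintegral_pullVec_le w)).trans_lt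
      (ENNReal.mul_lt_top ENNReal.ofReal_lt_top hw.2)⟩

lemma memLp_pushVec (H : IsQCSelfMap K Ω F DF) {w : Plane → Plane}
    (hw : MemLp w 2 (volume.restrict Ω)) : MemLp (pushVec F DF w) 2 (volume.restrict Ω) :=
  ⟨H.aestronglyMeasurable_pushVec hw.1,
    (eLpNorm_le_of_lintegral_le H.K_pos.le (H.lintegral_pushVec_le w)).trans_lt
      (ENNReal.mul_lt_top ENNReal.ofReal_lt_top hw.2)⟩

lemma tendsto_eLpNorm_comp_sub [IsFiniteMeasure (volume.restrict Ω : Measure Plane)]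
    {φ : Plane → ℝ} (hφ : IsTestFun Ω φ) {Φ : ℕ → Plane → Plane} (hΦ : ∀ n, Continuous (Φ n))
    {G : Plane → Plane} (hG : Continuous G)
    (hlim : ∀ᵐ x ∂(volume.restrict Ω), Tendsto (fun n => Φ n x) atTop (𝓝 (G x))) :
    Tendsto (fun n => eLpNorm (fun x => φ (Φ n x) - φ (G x)) 2 (volume.restrict Ω))
      atTop (𝓝 0) := by
  obtain ⟨A, hA⟩ := hφ.smooth.continuous.bounded_above_of_compact_support hφ.compact
  have hc := hφ.smooth.continuous
  have hm : ∀ n, AEStronglyMeasurable (fun x => φ (Φ n x) - φ (G x)) (volume.restrict Ω) :=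
    fun n => ((hc.comp (hΦ n)).sub (hc.comp hG)).aestronglyMeasurable
  refine tendsto_eLpNorm_two_of_dominated (b := fun _ => A + A) hm (memLp_const _)
    (fun n => .of_forall fun x => ?_) ?_
  · exact (norm_sub_le _ _).trans (add_le_add (hA _) (hA _))
  · filter_upwards [hlim] with x hx
    simpa using ((hc.tendsto _).comp hx).sub_const (φ (G x))

lemma aestronglyMeasurable_adjoint_apply {μ : Measure Plane} {A : Plane → PlaneMat}
    {w : Plane → Plane} (hA : AEStronglyMeasurable A μ) (hw : AEStronglyMeasurable w μ) :
    AEStronglyMeasurable (fun x => ContinuousLinearMap.adjoint (A x) (w x)) μ :=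
  (ContinuousLinearMap.id ℝ PlaneMat).aestronglyMeasurable_comp₂
    (ContinuousLinearMap.adjoint.continuous.comp_aestronglyMeasurable hA) hw

lemma tendsto_eLpNorm_adjoint_sub {μ : Measure Plane} {A : Plane → PlaneMat} (hA : MemLp A 2 μ)
    {w : Plane → Plane} (hw : Continuous w) {B : ℝ} (hB : ∀ x, ‖w x‖ ≤ B)
    {Φ : ℕ → Plane → Plane} (hΦ : ∀ n, Continuous (Φ n)) {G : Plane → Plane} (hG : Continuous G)
    (hlim : ∀ᵐ x ∂μ, Tendsto (fun n => Φ n x) atTop (𝓝 (G x))) :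
    Tendsto (fun n => eLpNorm (fun x => ContinuousLinearMap.adjoint (A x)
      (w (Φ n x) - w (G x))) 2 μ) atTop (𝓝 0) := by
  have hm : ∀ n, AEStronglyMeasurable (fun x => ContinuousLinearMap.adjoint (A x)
      (w (Φ n x) - w (G x))) μ := fun n =>
    aestronglyMeasurable_adjoint_apply hA.1
      ((hw.comp (hΦ n)).sub (hw.comp hG)).aestronglyMeasurable
  have hb : MemLp (fun x => (B + B) * ‖A x‖) 2 μ := hA.norm.const_mul (B + B)
  refine tendsto_eLpNorm_two_of_dominated hm hb (fun n => .of_forall fun x => ?_) ?_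
  · have h1 : ‖w (Φ n x) - w (G x)‖ ≤ B + B :=
      (norm_sub_le _ _).trans (add_le_add (hB _) (hB _))
    have h2 := norm_adjoint_apply_le (A x) (w (Φ n x) - w (G x))
    have h3 := mul_le_mul_of_nonneg_left h1 (norm_nonneg (A x))
    rw [mul_comm (B + B)]
    exact h2.trans h3
  · filter_upwards [hlim] with x hx
    have h6 : Tendsto (fun n => w (Φ n x) - w (G x)) atTop (𝓝 (w (G x) - w (G x))) :=
      ((hw.tendsto _).comp hx).sub_const (w (G x))
    rw [sub_self] at h6
    have h7 := ((ContinuousLinearMap.adjoint (A x)).continuous.tendsto 0).comp h6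
    rwa [map_zero] at h7

lemma eLpNorm_adjoint_apply_le {μ : Measure Plane} {A : Plane → PlaneMat} {w : Plane → Plane}
    {B : ℝ} (hB : ∀ x, ‖w x‖ ≤ B) :
    eLpNorm (fun x => ContinuousLinearMap.adjoint (A x) (w x)) 2 μ ≤
      ENNReal.ofReal B * eLpNorm A 2 μ := by
  refine eLpNorm_le_mul_eLpNorm_of_ae_le_mul (.of_forall fun x => ?_) 2
  have h := mul_le_mul_of_nonneg_left (hB x) (norm_nonneg (A x))
  rw [mul_comm B]
  exact (norm_adjoint_apply_le (A x) (w x)).trans h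

/-- The difference splits as (DΦ_n - DF)ᵗ ∇φ(Φ_n) + DFᵗ(∇φ(Φ_n) - ∇φ(F)). The first term is
controlled by the bound on ∇φ, the second by dominated convergence with a multiple of |DF| as
majorant. -/
lemma tendsto_eLpNorm_gradient_comp_sub {Ω : Set Plane} {φ : Plane → ℝ} (hφ : IsTestFun Ω φ)
    {Φ : ℕ → Plane → Plane} (hΦ : ∀ n, ContDiff ℝ ∞ (Φ n)) {F : Plane ≃ₜ Plane}
    {DF : Plane → PlaneMat} {μ : Measure Plane} (hDF : MemLp DF 2 μ)
    (hΦL : ∀ n, MemLp (fderiv ℝ (Φ n)) 2 μ)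
    (hlim : ∀ᵐ x ∂μ, Tendsto (fun n => Φ n x) atTop (𝓝 (F x)))
    (hL : Tendsto (fun n => eLpNorm (fderiv ℝ (Φ n) - DF) 2 μ) atTop (𝓝 0)) :
    Tendsto (fun n => eLpNorm (gradient (fun x => φ (Φ n x)) - pullVec F DF (gradient φ)) 2 μ)
      atTop (𝓝 0) := by
  obtain ⟨B, hB⟩ := hφ.continuous_gradient.bounded_above_of_compact_support
    hφ.hasCompactSupport_gradient
  have hc := hφ.continuous_gradient
  have h5 := tendsto_eLpNorm_adjoint_sub hDF hc hB (fun n => (hΦ n).continuous) F.continuous hlim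
  have h6 : Tendsto (fun n => ENNReal.ofReal B * eLpNorm (fderiv ℝ (Φ n) - DF) 2 μ)
      atTop (𝓝 0) := by
    simpa using ENNReal.Tendsto.const_mul hL (.inr (ENNReal.ofReal_ne_top (r := B)))
  have h7 := h6.add h5
  rw [add_zero] at h7
  refine tendsto_of_tendsto_of_tendsto_of_le_of_le tendsto_const_nhds h7
    (fun _ => zero_le) fun n => ?_
  have m1 : AEStronglyMeasurable (fun x => ContinuousLinearMap.adjoint
      ((fderiv ℝ (Φ n) - DF) x) (gradient φ (Φ n x))) μ :=
    aestronglyMeasurable_adjoint_apply ((hΦL n).1.sub hDF.1)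
      (hc.comp (hΦ n).continuous).aestronglyMeasurable
  have m2 : AEStronglyMeasurable (fun x => ContinuousLinearMap.adjoint (DF x)
      (gradient φ (Φ n x) - gradient φ (F x))) μ :=
    aestronglyMeasurable_adjoint_apply hDF.1
      ((hc.comp (hΦ n).continuous).sub (hc.comp F.continuous)).aestronglyMeasurable
  have e : gradient (fun x => φ (Φ n x)) - pullVec F DF (gradient φ) =
      (fun x => ContinuousLinearMap.adjoint ((fderiv ℝ (Φ n) - DF) x) (gradient φ (Φ n x)))
      + fun x => ContinuousLinearMap.adjoint (DF x)
        (gradient φ (Φ n x) - gradient φ (F x)) := by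
    funext x
    rw [Pi.sub_apply, gradient_comp (hφ.smooth.differentiable (by simp))
      ((hΦ n).differentiable (by simp)), pullVec_apply, Pi.add_apply, Pi.sub_apply, map_sub,
      map_sub, sub_apply]
    abel
  rw [e]
  exact (eLpNorm_add_le m1 m2 (by norm_num)).trans
    (add_le_add (eLpNorm_adjoint_apply_le fun x => hB (Φ n x)) le_rfl)

/-- The composition of a test function with `F` belongs to `H¹₀(Ω)`. -/
lemma exists_comp_test (H : IsQCSelfMap K Ω F DF) {φ : Plane → ℝ} (hφ : IsTestFun Ω φ) :
    ∃ v : H10 Ω, H10val v =ᵐ[volume.restrict Ω] (fun x => φ (F x)) ∧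
      H10grad v =ᵐ[volume.restrict Ω] pullVec F DF (gradient φ) := by
  have hfin := H.isFiniteMeasure
  obtain ⟨Φ, h1, h2, h3, h4⟩ := H.qc.sobolev.exists_smooth_seq F.continuous H.isOpen H.isBounded
    H.fixes
  obtain ⟨A, hA⟩ := hφ.smooth.continuous.bounded_above_of_compact_support hφ.compact
  have hlim : ∀ᵐ x ∂(volume.restrict Ω), Tendsto (fun n => Φ n x) atTop (𝓝 (F x)) := by
    filter_upwards [ae_restrict_mem H.isOpen.measurableSet] with x hx
    exact tendsto_of_close fun n => h3 n x hx
  have hu : MemLp (fun x => φ (F x)) 2 (volume.restrict Ω) :=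
    MemLp.of_bound (hφ.smooth.continuous.comp F.continuous).aestronglyMeasurable A
      (.of_forall fun x => hA _)
  have hw : MemLp (pullVec F DF (gradient φ)) 2 (volume.restrict Ω) :=
    H.memLp_pullVec (hφ.memLp_gradient 2 _)
  have ht : ∀ n, IsTestFun Ω fun x => φ (Φ n x) := fun n =>
    hφ.comp_of_tsupport H.isBounded (h1 n) (h2 n)
  have hmem : mkPair hu hw ∈ H10 Ω := by
    refine mkPair_mem_H10_of_tendsto hu hw (fun n => (ht n).toH10) ?_ ?_
    · refine (tendsto_eLpNorm_comp_sub hφ (fun n => (h1 n).continuous) F.continuous hlim).congr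
        fun n => (eLpNorm_congr_ae ?_).symm
      exact (ht n).val_toH10.sub (ae_eq_refl _)
    · refine (tendsto_eLpNorm_gradient_comp_sub hφ h1 H.memLp
        (fun n => memLp_fderiv_restrict (h1 n) H.isBounded) hlim h4).congr
        fun n => (eLpNorm_congr_ae ?_).symm
      exact (ht n).grad_toH10.sub (ae_eq_refl _)
  exact ⟨⟨_, hmem⟩, hu.coeFn_toLp, hw.coeFn_toLp⟩

lemma symm_mem_iff (H : IsQCSelfMap K Ω F DF) (y : Plane) : F.symm y ∈ Ω ↔ y ∈ Ω := by
  conv_rhs => rw [← H.image_eq]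
  constructor
  · intro h
    exact ⟨_, h, F.apply_symm_apply y⟩
  · rintro ⟨x, hx, rfl⟩
    rwa [F.symm_apply_apply]

/-- The composition of a test function with `F⁻¹` has a square integrable weak gradient. -/
lemma hasWeakGradient_comp_symm (H : IsQCSelfMap K Ω F DF) {ψ : Plane → ℝ} (hψ : IsTestFun Ω ψ) :
    HasWeakGradient (fun y => ψ (F.symm y)) (Ω.indicator (pushVec F DF (gradient ψ))) := by
  have hP := H.memLp_pushVec (hψ.memLp_gradient 2 _)
  refine ⟨hψ.smooth.continuous.comp F.symm.continuous, fun S hS => ?_, fun φ hφ v => ?_⟩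
  · exact ((memLp_indicator_iff_restrict H.isOpen.measurableSet).2 hP).mono_measure
      Measure.restrict_le_self
  · rw [← setIntegral_eq_integral_of_forall_compl_eq_zero (s := Ω) fun y hy => by
        rw [hψ.eq_zero (mt (H.symm_mem_iff y).1 hy), mul_zero],
      ← setIntegral_eq_integral_of_forall_compl_eq_zero (s := Ω)
        (f := fun x => φ x * ⟪Ω.indicator (pushVec F DF (gradient ψ)) x, v⟫) fun y hy => by
        rw [indicator_of_notMem hy]; simp,
      H.integral_eq (fun y => fderiv ℝ φ y v * ψ (F.symm y)),
      H.integral_eq (fun y => φ y * ⟪Ω.indicator (pushVec F DF (gradient ψ)) y, v⟫)]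
    -- After substituting y = F(x), the defining identity of the weak gradient is the weak chain
    -- rule with a = ψ.
    have h := H.qc.sobolev.setIntegral_mul_fderiv_comp_mul_det F.continuous H.isOpen H.isBounded
      H.fixes (hφ.smooth.of_le (by simp)) hψ v
    rw [integral_congr_ae (g := fun x => ψ x * fderiv ℝ φ (F x) v * (DF x).det)
        (.of_forall fun x => by simp only [F.symm_apply_apply]; ring), h, neg_inj]
    refine integral_congr_ae ?_
    filter_upwards [H.ae_eq_zero_or_pos, ae_restrict_mem H.isOpen.measurableSet] with x hx hxΩ
    have hFx : F x ∈ Ω := by rw [← H.image_eq]; exact ⟨x, hxΩ, rfl⟩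
    rw [indicator_of_mem hFx, pushVec_apply, F.symm_apply_apply, ← adjoint_planeAdj_apply,
      real_inner_smul_left, ContinuousLinearMap.adjoint_inner_left, inner_gradient]
    rcases hx with h0 | hpos
    · have : planeAdj (0 : PlaneMat) v = 0 := by simp [planeAdj_apply]
      simp [h0, this]
    · field_simp

lemma norm_gradL_toH10_sub {φ : Plane → ℝ} (hφ : IsTestFun Ω φ)
    (f : Lp Plane 2 (volume.restrict Ω : Measure Plane)) :
    ‖gradL Ω hφ.toH10 - f‖ =
      (eLpNorm (gradient φ - (f : Plane → Plane)) 2 (volume.restrict Ω)).toReal := by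
  rw [Lp.norm_def]
  exact congrArg ENNReal.toReal
    (eLpNorm_congr_ae ((Lp.coeFn_sub _ _).trans (hφ.grad_toH10.sub (ae_eq_refl _))))

lemma tendsto_ofReal_one_div_add_one :
    Tendsto (fun n : ℕ => ENNReal.ofReal (1 / ((n : ℝ) + 1))) atTop (𝓝 0) := by
  have := (ENNReal.continuous_ofReal.tendsto 0).comp
    (tendsto_one_div_add_atTop_nhds_zero_nat (𝕜 := ℝ))
  rwa [ENNReal.ofReal_zero] at this

lemma tendsto_eLpNorm_sub_of_uniform {μ : Measure Plane} [IsFiniteMeasure μ]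
    {f : ℕ → Plane → ℝ} {g : Plane → ℝ}
    (hfg : ∀ n, ∀ᵐ x ∂μ, |f n x - g x| ≤ 1 / ((n : ℝ) + 1)) :
    Tendsto (fun n => eLpNorm (f n - g) 2 μ) atTop (𝓝 0) := by
  have hA : μ univ ^ (2 : ℝ≥0∞).toReal⁻¹ ≠ ⊤ :=
    ENNReal.rpow_ne_top_of_nonneg (by positivity) (measure_ne_top _ _)
  have hb := ENNReal.Tendsto.const_mul tendsto_ofReal_one_div_add_one (.inr hA)
  rw [mul_zero] at hb
  exact tendsto_of_tendsto_of_tendsto_of_le_of_le tendsto_const_nhds hb (fun _ => zero_le)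
    fun n => eLpNorm_le_of_ae_bound (hfg n)

/-- Test functions approximating the composition of a test function with `F⁻¹`, with gradients
approximating the push-forward of the gradient. -/
lemma exists_test_seq_comp_symm (H : IsQCSelfMap K Ω F DF) {ψ : Plane → ℝ} (hψ : IsTestFun Ω ψ) :
    ∃ (χ : ℕ → Plane → ℝ) (hχ : ∀ n, IsTestFun Ω (χ n)),
      (∀ n, ∀ x ∈ Ω, |χ n x - ψ (F.symm x)| ≤ 1 / ((n : ℝ) + 1)) ∧
      Tendsto (fun n => gradL Ω (hχ n).toH10) atTop (𝓝 (H.pushL (gradL Ω hψ.toH10))) := by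
  have HW := H.hasWeakGradient_comp_symm hψ
  have hw : Ω.indicator (pushVec F DF (gradient ψ)) =ᵐ[volume.restrict Ω]
      (H.pushL (gradL Ω hψ.toH10) : Plane → Plane) := by
    refine EventuallyEq.trans ?_
      ((H.coeFn_pushL _).trans (H.pushVec_congr hψ.grad_toH10)).symm
    filter_upwards [ae_restrict_mem H.isOpen.measurableSet] with x hx using indicator_of_mem hx _
  have h0 : ∀ y ∈ frontier Ω, ψ (F.symm y) = 0 := by
    intro y hy
    refine hψ.eq_zero fun h => ?_
    rw [H.symm_mem_iff] at h
    rw [H.isOpen.frontier_eq] at hy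
    exact hy.2 h
  have hseq := fun n : ℕ => HW.exists_isTestFun H.isOpen H.isBounded h0
    (by positivity : 0 < 1 / ((n : ℝ) + 1))
  choose χ hχ hc hL using hseq
  refine ⟨χ, hχ, hc, ?_⟩
  rw [tendsto_iff_norm_sub_tendsto_zero]
  refine squeeze_zero (fun n => norm_nonneg _) (fun n => ?_)
    (tendsto_one_div_add_atTop_nhds_zero_nat (𝕜 := ℝ))
  rw [norm_gradL_toH10_sub, ← eLpNorm_congr_ae ((ae_eq_refl (gradient (χ n))).sub hw)]
  exact ENNReal.toReal_le_of_le_ofReal (by positivity) (hL n)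

/-- If values and gradients of a sequence in `H¹₀(Ω)` converge, then the limit of the gradients is
the gradient of the limit of the values. -/
lemma exists_H10_of_tendsto {u : Plane → ℝ} (hu : MemLp u 2 (volume.restrict Ω))
    {w : Lp Plane 2 (volume.restrict Ω : Measure Plane)} (v : ℕ → H10 Ω)
    (h1 : Tendsto (fun n => eLpNorm (H10val (v n) - u) 2 (volume.restrict Ω)) atTop (𝓝 0))
    (h2 : Tendsto (fun n => gradL Ω (v n)) atTop (𝓝 w)) :
    ∃ z : H10 Ω, H10val z =ᵐ[volume.restrict Ω] u ∧ gradL Ω z = w := by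
  have hmem : mkPair hu (Lp.memLp w) ∈ H10 Ω := by
    refine mkPair_mem_H10_of_tendsto hu (Lp.memLp w) v h1 ?_
    rw [tendsto_iff_norm_sub_tendsto_zero] at h2
    have ht2 := (ENNReal.continuous_ofReal.tendsto 0).comp h2
    rw [ENNReal.ofReal_zero] at ht2
    refine ht2.congr fun n => ?_
    rw [Function.comp_apply, Lp.norm_def, ENNReal.ofReal_toReal (Lp.eLpNorm_ne_top _)]
    exact eLpNorm_congr_ae (Lp.coeFn_sub _ _)
  exact ⟨⟨_, hmem⟩, hu.coeFn_toLp, Lp.ext (Lp.memLp w).coeFn_toLp⟩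

lemma pushL_gradL_test_mem (H : IsQCSelfMap K Ω F DF) {ψ : Plane → ℝ} (hψ : IsTestFun Ω ψ) :
    H.pushL (gradL Ω hψ.toH10) ∈ (gradL Ω).range := by
  have hfin := H.isFiniteMeasure
  obtain ⟨χ, hχ, hc, hL⟩ := H.exists_test_seq_comp_symm hψ
  have hkL : MemLp (fun y => ψ (F.symm y)) 2 (volume.restrict Ω) := by
    obtain ⟨A, hA⟩ := hψ.smooth.continuous.bounded_above_of_compact_support hψ.compact
    exact MemLp.of_bound (hψ.smooth.continuous.comp F.symm.continuous).aestronglyMeasurable A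
      (.of_forall fun x => hA _)
  obtain ⟨z, -, hz⟩ := exists_H10_of_tendsto hkL (fun n => (hχ n).toH10)
    (tendsto_eLpNorm_sub_of_uniform fun n => by
      filter_upwards [(hχ n).val_toH10, ae_restrict_mem H.isOpen.measurableSet] with x hx hxΩ
      rw [hx]
      exact hc n x hxΩ) hL
  exact ⟨z, hz⟩

/-- Test functions χ_n approximate ψ ∘ F⁻¹, so χ_n ∘ F → ψ uniformly on Ω while the gradients of χ_n
∘ F converge to the pull-back of the push-forward of ∇ψ. Uniqueness of the weak gradient identifies
that limit with ∇ψ, with no positivity of J_F required. -/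
lemma pullL_pushL_gradL_test (H : IsQCSelfMap K Ω F DF) {ψ : Plane → ℝ} (hψ : IsTestFun Ω ψ) :
    H.pullL (H.pushL (gradL Ω hψ.toH10)) = gradL Ω hψ.toH10 := by
  have hfin := H.isFiniteMeasure
  obtain ⟨χ, hχ, hc, hL⟩ := H.exists_test_seq_comp_symm hψ
  choose v hv1 hv2 using fun n => H.exists_comp_test (hχ n)
  have hvL : ∀ n, gradL Ω (v n) = H.pullL (gradL Ω (hχ n).toH10) := fun n =>
    Lp.ext ((hv2 n).trans ((H.pullVec_congr (hχ n).grad_toH10.symm).trans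
      (H.coeFn_pullL _).symm))
  have ht : Tendsto (fun n => gradL Ω (v n)) atTop
      (𝓝 (H.pullL (H.pushL (gradL Ω hψ.toH10)))) :=
    ((H.pullL.continuous.tendsto _).comp hL).congr fun n => (hvL n).symm
  obtain ⟨z, hz, hzg⟩ := exists_H10_of_tendsto (hψ.memLp 2 _) v
    (tendsto_eLpNorm_sub_of_uniform fun n => by
      filter_upwards [hv1 n, ae_restrict_mem H.isOpen.measurableSet] with x hx hxΩ
      have hFx : F x ∈ Ω := by rw [← H.image_eq]; exact ⟨x, hxΩ, rfl⟩
      have := hc n (F x) hFx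
      rwa [F.symm_apply_apply, ← hx] at this) ht
  have h0 : gradL Ω (z - hψ.toH10) = 0 := by
    refine H10grad_eq_zero H.isOpen H.isBounded ?_
    rw [map_sub, sub_eq_zero]
    exact Lp.ext (hz.trans hψ.val_toH10.symm)
  rw [map_sub, sub_eq_zero] at h0
  rw [← hzg, h0]

/-- Poincaré's inequality bounds the full norm by the gradient norm. Elements of H¹₀(Ω) can thus be
recovered continuously from their gradients. -/
lemma antilipschitz_gradL (hΩb : Bornology.IsBounded Ω) :
    ∃ C, AntilipschitzWith C (gradL Ω) := by
  obtain ⟨C, hC0, hC⟩ := exists_poincare hΩb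
  refine ⟨⟨C + 1, by positivity⟩, ContinuousLinearMap.antilipschitz_of_bound _ fun u => ?_⟩
  calc ‖u‖ ≤ ‖valL Ω u‖ + ‖gradL Ω u‖ := L2Pair.norm_le (u : L2Pair Ω)
    _ ≤ C * ‖gradL Ω u‖ + ‖gradL Ω u‖ := by gcongr; exact hC u
    _ = (C + 1) * ‖gradL Ω u‖ := by ring

lemma isClosed_range_gradL (hΩb : Bornology.IsBounded Ω) : IsClosed (range (gradL Ω)) := by
  have : CompleteSpace (H10 Ω) := (Submodule.isClosed_topologicalClosure _).completeSpace_coe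
  obtain ⟨C, hC⟩ := antilipschitz_gradL hΩb
  exact hC.isClosed_range (gradL Ω).uniformContinuous

lemma gradL_injective (hΩb : Bornology.IsBounded Ω) : Function.Injective (gradL Ω) := by
  obtain ⟨C, hC⟩ := antilipschitz_gradL hΩb
  exact hC.injective

lemma pullL_gradL_mem (H : IsQCSelfMap K Ω F DF) (u : H10 Ω) :
    H.pullL (gradL Ω u) ∈ (gradL Ω).range := by
  refine H10_induction (p := fun u => H.pullL (gradL Ω u) ∈ (gradL Ω).range) ?_
    (fun φ hφ => ?_) u
  · exact (isClosed_range_gradL H.isBounded).preimage (H.pullL.continuous.comp (gradL Ω).continuous)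
  · obtain ⟨v, -, hv⟩ := H.exists_comp_test hφ
    exact ⟨v, Lp.ext (hv.trans ((H.pullVec_congr hφ.grad_toH10.symm).trans
        (H.coeFn_pullL _).symm))⟩

lemma pushL_gradL_mem (H : IsQCSelfMap K Ω F DF) (u : H10 Ω) :
    H.pushL (gradL Ω u) ∈ (gradL Ω).range := by
  refine H10_induction (p := fun u => H.pushL (gradL Ω u) ∈ (gradL Ω).range) ?_
    (fun φ hφ => H.pushL_gradL_test_mem hφ) u
  exact (isClosed_range_gradL H.isBounded).preimage (H.pushL.continuous.comp (gradL Ω).continuous)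

lemma pullL_pushL_gradL (H : IsQCSelfMap K Ω F DF) (u : H10 Ω) :
    H.pullL (H.pushL (gradL Ω u)) = gradL Ω u := by
  refine H10_induction (p := fun u => H.pullL (H.pushL (gradL Ω u)) = gradL Ω u) ?_
    (fun φ hφ => H.pullL_pushL_gradL_test hφ) u
  exact isClosed_eq (by fun_prop) (by fun_prop)

end IsQCSelfMap

/-- An operator on gradients that preserves the gradients of elements of `H¹₀(Ω)`, as an operator on
`H¹₀(Ω)`. -/
lemma exists_lift_gradL {Ω : Set Plane} (hΩb : Bornology.IsBounded Ω)
    (P : Lp Plane 2 (volume.restrict Ω : Measure Plane) →L[ℝ]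
      Lp Plane 2 (volume.restrict Ω : Measure Plane))
    (hP : ∀ u : H10 Ω, P (gradL Ω u) ∈ (gradL Ω).range) :
    ∃ T : H10 Ω →L[ℝ] H10 Ω, ∀ u, gradL Ω (T u) = P (gradL Ω u) := by
  have : CompleteSpace (H10 Ω) := (Submodule.isClosed_topologicalClosure _).completeSpace_coe
  let e := (gradL Ω).equivRange (IsQCSelfMap.gradL_injective hΩb)
    (IsQCSelfMap.isClosed_range_gradL hΩb)
  refine ⟨(e.symm : _ →L[ℝ] H10 Ω).comp ((P.comp (gradL Ω)).codRestrict _ hP), fun u => ?_⟩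
  have h := e.apply_symm_apply (((P.comp (gradL Ω)).codRestrict _ hP) u)
  exact congrArg Subtype.val h

/-- The isomorphism of `H¹₀(Ω)` induced by composition with a quasiconformal self-map. -/
lemma IsQCSelfMap.exists_equiv {K : ℝ} {Ω : Set Plane} {F : Plane ≃ₜ Plane} {DF : Plane → PlaneMat}
    (H : IsQCSelfMap K Ω F DF) :
    ∃ T : H10 Ω ≃L[ℝ] H10 Ω, ∀ u, gradL Ω (T u) = H.pullL (gradL Ω u) := by
  obtain ⟨T, hT⟩ := exists_lift_gradL H.isBounded H.pullL H.pullL_gradL_mem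
  obtain ⟨T', hT'⟩ := exists_lift_gradL H.isBounded H.pushL H.pushL_gradL_mem
  have hinj := gradL_injective H.isBounded
  refine ⟨ContinuousLinearEquiv.equivOfInverse T T' (fun u => hinj ?_) (fun u => hinj ?_), hT⟩
  · rw [hT', hT, H.pushL_pullL]
  · rw [hT, hT', H.pullL_pushL_gradL]

end
noncomputable section

/-! ### Rellich's theorem -/

/-- Fundamental theorem of calculus along the segment from x to x + z, then Cauchy–Schwarz in the
parameter. -/
lemma enorm_add_sub_sq_le {φ : Plane → ℝ} (hφ : ContDiff ℝ 1 φ) (x z : Plane) :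
    ‖φ (x + z) - φ x‖ₑ ^ 2 ≤
      ‖z‖ₑ ^ 2 * ∫⁻ t in Ioc (0 : ℝ) 1, ‖fderiv ℝ φ (x + t • z)‖ₑ ^ 2 := by
  have hprob : IsProbabilityMeasure (volume.restrict (Ioc (0 : ℝ) 1)) := ⟨by simp⟩
  have hc : Continuous fun t : ℝ => fderiv ℝ φ (x + t • z) :=
    (hφ.continuous_fderiv (by norm_num)).comp (by fun_prop)
  have hd : ∀ t : ℝ, HasDerivAt (fun t : ℝ => φ (x + t • z)) (fderiv ℝ φ (x + t • z) z) t := by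
    intro t
    have h1 : HasDerivAt (fun t : ℝ => x + t • z) z t := by
      simpa using ((hasDerivAt_id t).smul_const z).const_add x
    exact ((hφ.differentiable (by norm_num)) _).hasFDerivAt.comp_hasDerivAt t h1
  have h := intervalIntegral.integral_eq_sub_of_hasDerivAt (a := (0 : ℝ)) (b := 1)
    (fun t _ => hd t) ((hc.clm_apply continuous_const).intervalIntegrable _ _)
  rw [intervalIntegral.integral_of_le zero_le_one, one_smul, zero_smul, add_zero] at h
  rw [← h]
  have h1 : ‖∫ t in Ioc (0 : ℝ) 1, fderiv ℝ φ (x + t • z) z‖ₑ ≤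
      ‖z‖ₑ * ∫⁻ t in Ioc (0 : ℝ) 1, ‖fderiv ℝ φ (x + t • z)‖ₑ := by
    refine (enorm_integral_le_lintegral_enorm _).trans ?_
    rw [← lintegral_const_mul' _ _ enorm_ne_top]
    refine lintegral_mono fun t => ?_
    rw [mul_comm]
    exact (fderiv ℝ φ (x + t • z)).le_opENorm z
  calc _ ≤ (‖z‖ₑ * ∫⁻ t in Ioc (0 : ℝ) 1, ‖fderiv ℝ φ (x + t • z)‖ₑ) ^ 2 := by gcongr
    _ ≤ _ := by
      rw [mul_pow]
      gcongr
      exact sq_lintegral_le hc.enorm.measurable.aemeasurable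

lemma lintegral_enorm_add_sub_sq_le {φ : Plane → ℝ} (hφ : ContDiff ℝ 1 φ) (z : Plane) :
    ∫⁻ x, ‖φ (x + z) - φ x‖ₑ ^ 2 ≤ ‖z‖ₑ ^ 2 * ∫⁻ x, ‖fderiv ℝ φ x‖ₑ ^ 2 := by
  have hc : Continuous fun p : Plane × ℝ => fderiv ℝ φ (p.1 + p.2 • z) :=
    (hφ.continuous_fderiv (by norm_num)).comp (by fun_prop)
  have hm : AEMeasurable (Function.uncurry fun (x : Plane) (t : ℝ) =>
      ‖fderiv ℝ φ (x + t • z)‖ₑ ^ 2)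
      ((volume : Measure Plane).prod (volume.restrict (Ioc (0 : ℝ) 1))) :=
    (hc.enorm.measurable.pow_const 2).aemeasurable
  calc ∫⁻ x, ‖φ (x + z) - φ x‖ₑ ^ 2
      ≤ ∫⁻ x, ‖z‖ₑ ^ 2 * ∫⁻ t in Ioc (0 : ℝ) 1, ‖fderiv ℝ φ (x + t • z)‖ₑ ^ 2 :=
        lintegral_mono fun x => enorm_add_sub_sq_le hφ x z
    _ = ‖z‖ₑ ^ 2 * ∫⁻ x, (∫⁻ t in Ioc (0 : ℝ) 1, ‖fderiv ℝ φ (x + t • z)‖ₑ ^ 2) :=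
        lintegral_const_mul' _ _ (ENNReal.pow_ne_top enorm_ne_top)
    _ = ‖z‖ₑ ^ 2 * ∫⁻ t in Ioc (0 : ℝ) 1, (∫⁻ x, ‖fderiv ℝ φ (x + t • z)‖ₑ ^ 2) := by
        rw [lintegral_lintegral_swap hm]
    _ = ‖z‖ₑ ^ 2 * ∫⁻ x, ‖fderiv ℝ φ x‖ₑ ^ 2 := by
        congr 1
        rw [lintegral_congr fun t : ℝ => lintegral_add_right_eq_self
          (fun x => ‖fderiv ℝ φ x‖ₑ ^ 2) (t • z)]
        simp

/-- The normalized Lebesgue measure on a disc around the origin. -/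
def discMeasure (ε : ℝ) : Measure Plane :=
  (volume (Metric.ball (0 : Plane) ε))⁻¹ • volume.restrict (Metric.ball 0 ε)

lemma isProbabilityMeasure_discMeasure {ε : ℝ} (hε : 0 < ε) :
    IsProbabilityMeasure (discMeasure ε) := by
  refine ⟨?_⟩
  rw [discMeasure, Measure.smul_apply, Measure.restrict_apply_univ, smul_eq_mul]
  exact ENNReal.inv_mul_cancel (Metric.measure_ball_pos volume _ hε).ne' measure_ball_lt_top.ne

lemma ae_discMeasure (ε : ℝ) : ∀ᵐ z ∂(discMeasure ε), ‖z‖ₑ ≤ ENNReal.ofReal ε := by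
  refine Measure.ae_smul_measure ?_ _
  filter_upwards [ae_restrict_mem Metric.isOpen_ball.measurableSet] with z hz
  rw [← ofReal_norm]
  exact ENNReal.ofReal_le_ofReal (mem_ball_zero_iff.1 hz).le

/-- The distance from a function to its averages over discs is controlled by its gradient. -/
lemma lintegral_average_sub_sq_le {Ω : Set Plane} {φ : Plane → ℝ} (hφ : IsTestFun Ω φ) {ε : ℝ}
    (hε : 0 < ε) :
    ∫⁻ x, ‖(∫ z, φ (x + z) ∂(discMeasure ε)) - φ x‖ₑ ^ 2 ≤
      ENNReal.ofReal ε ^ 2 * ∫⁻ x, ‖fderiv ℝ φ x‖ₑ ^ 2 := by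
  have hprob := isProbabilityMeasure_discMeasure hε
  have hc := hφ.smooth.continuous
  obtain ⟨A, hA⟩ := hc.bounded_above_of_compact_support hφ.compact
  have h1 : ∀ x, ‖(∫ z, φ (x + z) ∂(discMeasure ε)) - φ x‖ₑ ^ 2 ≤
      ∫⁻ z, ‖φ (x + z) - φ x‖ₑ ^ 2 ∂(discMeasure ε) := by
    intro x
    have hcx : Continuous fun z => φ (x + z) := hc.comp (by fun_prop)
    have hi : Integrable (fun z => φ (x + z)) (discMeasure ε) :=
      Integrable.of_bound hcx.aestronglyMeasurable A (.of_forall fun z => hA _)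
    have e : (∫ z, φ (x + z) ∂(discMeasure ε)) - φ x =
        ∫ z, (φ (x + z) - φ x) ∂(discMeasure ε) := by
      rw [integral_sub hi (integrable_const _)]
      simp
    rw [e]
    calc _ ≤ (∫⁻ z, ‖φ (x + z) - φ x‖ₑ ∂(discMeasure ε)) ^ 2 := by
          gcongr
          exact enorm_integral_le_lintegral_enorm _
      _ ≤ _ := sq_lintegral_le (hcx.sub continuous_const).enorm.measurable.aemeasurable
  have hc2 : Continuous fun p : Plane × Plane => φ (p.1 + p.2) - φ p.1 :=
    (hc.comp (by fun_prop)).sub (hc.comp continuous_fst)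
  have hm : AEMeasurable (Function.uncurry fun (x z : Plane) => ‖φ (x + z) - φ x‖ₑ ^ 2)
      ((volume : Measure Plane).prod (discMeasure ε)) :=
    (hc2.enorm.measurable.pow_const 2).aemeasurable
  refine (lintegral_mono h1).trans ?_
  rw [lintegral_lintegral_swap hm]
  calc _ ≤ ∫⁻ _, ENNReal.ofReal ε ^ 2 * (∫⁻ x, ‖fderiv ℝ φ x‖ₑ ^ 2) ∂(discMeasure ε) := by
        refine lintegral_mono_ae ?_
        filter_upwards [ae_discMeasure ε] with z hz
        refine (lintegral_enorm_add_sub_sq_le (hφ.smooth.of_le (by simp)) z).trans ?_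
        gcongr
    _ = _ := by simp

/-- Averaging over a disc is a bounded functional on `L²(Ω)`. -/
lemma average_eq_integral {Ω : Set Plane} {φ : Plane → ℝ} (hφ : IsTestFun Ω φ) (ε : ℝ)
    (x : Plane) :
    ∫ z, φ (x + z) ∂(discMeasure ε) =
      (volume (Metric.ball (0 : Plane) ε))⁻¹.toReal *
        ∫ y in Metric.ball x ε, φ y ∂(volume.restrict Ω) := by
  rw [discMeasure, integral_smul_measure, smul_eq_mul]
  congr 1
  have h0 : ∀ y ∉ Ω, (Metric.ball x ε).indicator φ y = 0 := fun y hy =>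
    indicator_apply_eq_zero.2 fun _ => hφ.eq_zero hy
  rw [← integral_indicator Metric.isOpen_ball.measurableSet,
    ← integral_indicator Metric.isOpen_ball.measurableSet,
    setIntegral_eq_integral_of_forall_compl_eq_zero h0,
    ← integral_add_left_eq_self ((Metric.ball x ε).indicator φ) x]
  refine integral_congr_ae (.of_forall fun z => ?_)
  by_cases hz : z ∈ Metric.ball 0 ε
  · have : x + z ∈ Metric.ball x ε := by simpa using hz
    simp only [indicator_of_mem hz, indicator_of_mem this]
  · have : x + z ∉ Metric.ball x ε := by simpa using hz
    simp only [indicator_of_notMem hz, indicator_of_notMem this]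

/-- The integral over a measurable set as a functional on `H¹₀(Ω)`. -/
lemma exists_functional_setIntegral {Ω : Set Plane} [IsFiniteMeasure (volume.restrict Ω)]
    {s : Set Plane} (hs : MeasurableSet s) :
    ∃ g : Hneg1 Ω, (∀ u, g u = ∫ x in s, H10val u x ∂(volume.restrict Ω)) ∧
      ∀ u, |g u| ≤ (volume.restrict Ω).real univ ^ (1 / 2 : ℝ) * ‖valL Ω u‖ := by
  set e : Lp ℝ 2 (volume.restrict Ω : Measure Plane) :=
    indicatorConstLp 2 hs (measure_ne_top _ _) 1 with he
  refine ⟨(innerSL ℝ e).comp (valL Ω), fun u => ?_, fun u => ?_⟩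
  · exact L2.inner_indicatorConstLp_one hs (measure_ne_top _ _) (valL Ω u)
  · refine (abs_real_inner_le_norm e (valL Ω u)).trans ?_
    gcongr
    refine (norm_indicatorConstLp_le).trans ?_
    rw [norm_one, one_mul]
    simp only [ENNReal.toReal_ofNat]
    exact Real.rpow_le_rpow measureReal_nonneg (measureReal_mono (subset_univ _)) (by norm_num)

lemma H10_dense_test {Ω : Set Plane} (u : H10 Ω) {ε : ℝ} (hε : 0 < ε) :
    ∃ (φ : Plane → ℝ) (hφ : IsTestFun Ω φ), ‖u - hφ.toH10‖ < ε := by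
  have hu : (u : L2Pair Ω) ∈ closure (testPairs Ω : Set (L2Pair Ω)) := u.2
  rw [Metric.mem_closure_iff] at hu
  obtain ⟨b, ⟨φ, hφ, h1, h2⟩, hb⟩ := hu ε hε
  refine ⟨φ, hφ, ?_⟩
  have e : b = (hφ.toH10 : L2Pair Ω) := by
    refine WithLp.ofLp_injective 2 (Prod.ext (Lp.ext ?_) (Lp.ext ?_))
    · exact h1.trans hφ.val_toH10.symm
    · exact h2.trans hφ.grad_toH10.symm
  rw [e, dist_eq_norm] at hb
  exact hb

/-- At a fixed radius, the average around each x is a bounded functional on H¹₀(Ω), so weak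
convergence gives pointwise convergence. The bound is uniform in x and n, and Ω has finite measure,
so dominated convergence applies. -/
lemma tendsto_eLpNorm_average {Ω : Set Plane} [IsFiniteMeasure (volume.restrict Ω : Measure Plane)]
    {φ : ℕ → Plane → ℝ} (hφ : ∀ n, IsTestFun Ω (φ n)) {C : ℝ}
    (hC : ∀ n, ‖valL Ω (hφ n).toH10‖ ≤ C) (hw : WeakTendsto (fun n => (hφ n).toH10) 0) {ε : ℝ}
    (hε : 0 < ε) :
    Tendsto (fun n => eLpNorm (fun x => ∫ z, φ n (x + z) ∂(discMeasure ε)) 2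
      (volume.restrict Ω)) atTop (𝓝 0) := by
  have hprob := isProbabilityMeasure_discMeasure hε
  choose g hg hgle using fun x : Plane => exists_functional_setIntegral (Ω := Ω)
    (Metric.isOpen_ball (x := x) (ε := ε)).measurableSet
  set c := (volume (Metric.ball (0 : Plane) ε))⁻¹.toReal
  have hc0 : 0 ≤ c := ENNReal.toReal_nonneg
  have he : ∀ n x, ∫ z, φ n (x + z) ∂(discMeasure ε) = c * g x (hφ n).toH10 := by
    intro n x
    rw [average_eq_integral (hφ n), hg]
    congr 1
    exact integral_congr_ae (ae_restrict_of_ae (hφ n).val_toH10.symm)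
  refine tendsto_eLpNorm_two_of_dominated
    (b := fun _ => c * ((volume.restrict Ω : Measure Plane).real univ ^ (1 / 2 : ℝ) * C))
    (fun n => ?_) (memLp_const _) (fun n => .of_forall fun x => ?_) (.of_forall fun x => ?_)
  · have : Continuous fun p : Plane × Plane => φ n (p.1 + p.2) :=
      (hφ n).smooth.continuous.comp (by fun_prop)
    exact (this.stronglyMeasurable.integral_prod_right).aestronglyMeasurable
  · rw [he, norm_mul, Real.norm_of_nonneg hc0, Real.norm_eq_abs]
    gcongr
    refine (hgle x _).trans ?_
    gcongr
    exact hC n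
  · simp_rw [he]
    have := (hw (g x)).const_mul c
    rwa [map_zero, mul_zero] at this

lemma eLpNorm_le_average_add {Ω : Set Plane} {φ : Plane → ℝ} (hφ : IsTestFun Ω φ) {ε : ℝ}
    (hε : 0 < ε) :
    eLpNorm φ 2 (volume.restrict Ω) ≤
      eLpNorm (fun x => ∫ z, φ (x + z) ∂(discMeasure ε)) 2 (volume.restrict Ω) +
        ENNReal.ofReal ε * eLpNorm (gradient φ) 2 (volume.restrict Ω) := by
  have hprob := isProbabilityMeasure_discMeasure hε
  set M : Plane → ℝ := fun x => ∫ z, φ (x + z) ∂(discMeasure ε) with hM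
  have hMm : AEStronglyMeasurable M (volume.restrict Ω) := by
    have : Continuous fun p : Plane × Plane => φ (p.1 + p.2) :=
      hφ.smooth.continuous.comp (by fun_prop)
    exact (this.stronglyMeasurable.integral_prod_right).aestronglyMeasurable
  have hφm : AEStronglyMeasurable φ (volume.restrict Ω) :=
    hφ.smooth.continuous.aestronglyMeasurable
  have e : φ = M - (M - φ) := by simp
  have hgrad : ∫⁻ x, ‖fderiv ℝ φ x‖ₑ ^ 2 = eLpNorm (gradient φ) 2 (volume.restrict Ω) ^ 2 := by
    rw [eLpNorm_two_sq, ← setLIntegral_eq_of_support_subset (s := Ω)]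
    · refine lintegral_congr fun x => ?_
      rw [← ofReal_norm, ← ofReal_norm, norm_gradient]
    · intro x hx
      by_contra h
      refine hx ?_
      beta_reduce
      rw [hφ.fderiv_eq_zero h, ← ofReal_norm, norm_zero]
      simp
  calc eLpNorm φ 2 (volume.restrict Ω) = eLpNorm (M - (M - φ)) 2 (volume.restrict Ω) := by
        rw [← e]
    _ ≤ eLpNorm M 2 (volume.restrict Ω) + eLpNorm (M - φ) 2 (volume.restrict Ω) :=
        eLpNorm_sub_le hMm (hMm.sub hφm) (by norm_num)
    _ ≤ _ := by
        gcongr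
        rw [eLpNorm_two_le_iff, mul_pow, ← hgrad]
        exact (setLIntegral_le_lintegral _ _).trans (lintegral_average_sub_sq_le hφ hε)

/-- A function differs from its disc averages by at most ε times the norm of its gradient. The
radius ε is chosen first, uniformly in n by the bound C; the averages at that radius then tend to 0.
-/
lemma rellich_test {Ω : Set Plane} [IsFiniteMeasure (volume.restrict Ω : Measure Plane)]
    {φ : ℕ → Plane → ℝ} (hφ : ∀ n, IsTestFun Ω (φ n)) {C : ℝ}
    (hC : ∀ n, ‖(hφ n).toH10‖ ≤ C) (hw : WeakTendsto (fun n => (hφ n).toH10) 0) :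
    Tendsto (fun n => ‖valL Ω (hφ n).toH10‖) atTop (𝓝 0) := by
  have hC0 : 0 ≤ C := (norm_nonneg _).trans (hC 0)
  have hval : ∀ n, ‖valL Ω (hφ n).toH10‖ = (eLpNorm (φ n) 2 (volume.restrict Ω)).toReal := fun n =>
    congrArg ENNReal.toReal (eLpNorm_congr_ae (hφ n).val_toH10)
  have hgr : ∀ n, eLpNorm (gradient (φ n)) 2 (volume.restrict Ω) ≤ ENNReal.ofReal C := by
    intro n
    rw [← eLpNorm_congr_ae (hφ n).grad_toH10]
    refine (ENNReal.le_ofReal_iff_toReal_le (Lp.eLpNorm_ne_top (gradL Ω (hφ n).toH10)) hC0).2 ?_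
    exact (L2Pair.norm_snd_le ((hφ n).toH10 : L2Pair Ω)).trans (hC n)
  have key : Tendsto (fun n => eLpNorm (φ n) 2 (volume.restrict Ω)) atTop (𝓝 0) := by
    rw [ENNReal.tendsto_nhds_zero]
    intro δ hδ
    obtain ⟨ε, hε, hεδ⟩ : ∃ ε : ℝ, 0 < ε ∧ ENNReal.ofReal ε * ENNReal.ofReal C ≤ δ / 2 := by
      have ht : Tendsto (fun ε : ℝ => ENNReal.ofReal ε * ENNReal.ofReal C) (𝓝[>] 0) (𝓝 0) := by
        have h1 := (ENNReal.continuous_ofReal.tendsto 0).mono_left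
          (nhdsWithin_le_nhds (s := Ioi (0 : ℝ)))
        rw [ENNReal.ofReal_zero] at h1
        simpa using ENNReal.Tendsto.mul_const h1 (.inr (ENNReal.ofReal_ne_top (r := C)))
      have h2 := ht.eventually (ge_mem_nhds (ENNReal.half_pos hδ.ne'))
      obtain ⟨ε, h3, h4⟩ := (h2.and self_mem_nhdsWithin).exists
      exact ⟨ε, h4, h3⟩
    have hav := tendsto_eLpNorm_average hφ
      (fun n => (L2Pair.norm_fst_le ((hφ n).toH10 : L2Pair Ω)).trans (hC n)) hw hε
    filter_upwards [hav.eventually (ge_mem_nhds (ENNReal.half_pos hδ.ne'))] with n hn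
    calc _ ≤ _ := eLpNorm_le_average_add (hφ n) hε
      _ ≤ δ / 2 + ENNReal.ofReal ε * ENNReal.ofReal C := by
        gcongr
        exact hgr n
      _ ≤ δ / 2 + δ / 2 := by gcongr
      _ = δ := ENNReal.add_halves δ
  simp_rw [hval]
  have := (ENNReal.tendsto_toReal ENNReal.zero_ne_top).comp key
  rwa [ENNReal.toReal_zero] at this

lemma WeakTendsto.of_tendsto_sub {Ω : Set Plane} {u v : ℕ → H10 Ω} {w : H10 Ω}
    (hu : WeakTendsto u w) (h : Tendsto (fun n => u n - v n) atTop (𝓝 0)) : WeakTendsto v w := by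
  intro g
  have h2 := (hu g).sub ((g.continuous.tendsto 0).comp h)
  rw [map_zero, sub_zero] at h2
  refine h2.congr fun n => ?_
  rw [Function.comp_apply, map_sub, sub_sub_cancel]

lemma WeakTendsto.sub_const {Ω : Set Plane} {u : ℕ → H10 Ω} {w : H10 Ω}
    (hu : WeakTendsto u w) : WeakTendsto (fun n => u n - w) 0 := by
  intro g
  simpa using (hu g).sub_const (g w)

/-- Rellich's theorem for sequences converging weakly to zero. -/
lemma rellich_zero {Ω : Set Plane} (hΩb : Bornology.IsBounded Ω) {z : ℕ → H10 Ω} {C : ℝ}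
    (hC : ∀ n, ‖z n‖ ≤ C) (hz : WeakTendsto z 0) :
    Tendsto (fun n => ‖valL Ω (z n)‖) atTop (𝓝 0) := by
  have hfin : IsFiniteMeasure (volume.restrict Ω : Measure Plane) :=
    ⟨by simpa using hΩb.measure_lt_top⟩
  -- Replacing z_n by a test function at distance tending to 0 changes neither the weak limit nor
  -- the L² limit.
  choose φ hφ hlt using fun n : ℕ => H10_dense_test (z n) (by positivity : 0 < 1 / ((n : ℝ) + 1))
  have hd : Tendsto (fun n => z n - (hφ n).toH10) atTop (𝓝 0) :=
    squeeze_zero_norm (fun n => (hlt n).le) (tendsto_one_div_add_atTop_nhds_zero_nat (𝕜 := ℝ))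
  have hb : ∀ n, ‖(hφ n).toH10‖ ≤ C + 1 := by
    intro n
    have h1 : 1 / ((n : ℝ) + 1) ≤ 1 := by
      rw [div_le_one (by positivity)]
      linarith [(n.cast_nonneg : (0 : ℝ) ≤ n)]
    have h2 := norm_sub_norm_le (hφ n).toH10 (z n)
    rw [norm_sub_rev] at h2
    linarith [hC n, hlt n]
  have h1 := rellich_test hφ hb (hz.of_tendsto_sub hd)
  have h2 := (((valL Ω).continuous.tendsto 0).comp hd).norm
  rw [map_zero, norm_zero] at h2
  have h3 := h1.add h2
  rw [add_zero] at h3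
  refine squeeze_zero (fun n => norm_nonneg _) (fun n => ?_) h3
  have e : valL Ω (z n) = valL Ω (hφ n).toH10 + valL Ω (z n - (hφ n).toH10) := by
    rw [map_sub, add_sub_cancel]
  rw [e]
  exact norm_add_le _ _

/-- Rellich's theorem: bounded weakly convergent sequences in `H¹₀(Ω)` converge strongly in
`L²(Ω)`. -/
lemma rellich {Ω : Set Plane} (hΩb : Bornology.IsBounded Ω) {w : ℕ → H10 Ω} {w₀ : H10 Ω} {C : ℝ}
    (hC : ∀ n, ‖w n‖ ≤ C) (hw : WeakTendsto w w₀) :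
    Tendsto (fun n => ‖valL Ω (w n - w₀)‖) atTop (𝓝 0) :=
  rellich_zero hΩb (fun n => (norm_sub_le _ _).trans (add_le_add (hC n) le_rfl)) hw.sub_const

end
noncomputable section

/-! ### Weak solutions and G-convergence -/

/-- Multiplication of vector fields by a matrix field. -/
def matVec (σ : Plane → PlaneMat) : (Plane → Plane) →ₗ[ℝ] (Plane → Plane) where
  toFun w x := σ x (w x)
  map_add' w w' := by ext1 x; simp
  map_smul' c w := by ext1 x; simp

lemma exists_matVec_operator {μ : Measure Plane} {σ : Plane → PlaneMat} (hσ : MemLp σ ⊤ μ) :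
    ∃ A : Lp Plane 2 μ →L[ℝ] Lp Plane 2 μ, ∀ f, A f =ᵐ[μ] matVec σ f := by
  obtain ⟨C, hC⟩ : ∃ C : ℝ, ∀ᵐ x ∂μ, ‖σ x‖ ≤ C := by
    refine ⟨(eLpNorm σ ⊤ μ).toReal, ?_⟩
    have h := ae_le_eLpNormEssSup (f := σ) (μ := μ)
    filter_upwards [h] with x hx
    rw [eLpNorm_exponent_top, ← toReal_enorm]
    refine ENNReal.toReal_mono ?_ hx
    rw [← eLpNorm_exponent_top]
    exact hσ.2.ne
  have h1 : ∀ f g : Plane → Plane, f =ᵐ[μ] g → matVec σ f =ᵐ[μ] matVec σ g := fun f g h => by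
    filter_upwards [h] with x hx
    exact congrArg (σ x) hx
  have h2 : ∀ f : Plane → Plane, AEStronglyMeasurable f μ → AEStronglyMeasurable (matVec σ f) μ :=
    fun f hf => (ContinuousLinearMap.id ℝ PlaneMat).aestronglyMeasurable_comp₂ hσ.1 hf
  have h3 : ∀ f : Plane → Plane, eLpNorm (matVec σ f) 2 μ ≤ ENNReal.ofReal C * eLpNorm f 2 μ :=
    fun f => by
      refine eLpNorm_le_mul_eLpNorm_of_ae_le_mul ?_ 2
      filter_upwards [hC] with x hx
      exact (σ x).le_of_opNorm_le hx (f x)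
  exact ⟨lpOperator (matVec σ) C h1 h2 h3, fun f => coeFn_lpOperator f⟩

/-- The inner product of `L²(Ω)` on `H¹₀(Ω)`. -/
lemma integral_mul_eq_inner {Ω : Set Plane} (u v : H10 Ω) :
    ∫ x in Ω, H10val u x * H10val v x = ⟪valL Ω u, valL Ω v⟫ := by
  rw [L2.inner_def]
  refine integral_congr_ae (.of_forall fun x => ?_)
  exact mul_comm _ _

/-- The difference of two forms given by bounded operators is bounded. -/
lemma exists_bilin_of_operators {V X Y : Type*} [NormedAddCommGroup V] [NormedSpace ℝ V]
    [NormedAddCommGroup X] [InnerProductSpace ℝ X] [NormedAddCommGroup Y] [InnerProductSpace ℝ Y]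
    (S : V →L[ℝ] X) (A : X →L[ℝ] X) (R : V →L[ℝ] Y) (lam : ℝ) :
    ∃ B : V →L[ℝ] V →L[ℝ] ℝ, ∀ u v, B u v = ⟪A (S u), S v⟫ - lam * ⟪R u, R v⟫ :=
  ⟨(innerSL ℝ).bilinearComp (A.comp S) S - lam • (innerSL ℝ).bilinearComp R R,
    fun u v => by simp⟩

lemma inner_matVec_eq {Ω : Set Plane} {σ : Plane → PlaneMat} {u v : H10 Ω}
    {w : Lp Plane 2 (volume.restrict Ω : Measure Plane)}
    (hw : w =ᵐ[volume.restrict Ω] matVec σ (gradL Ω u)) :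
    ⟪w, gradL Ω v⟫ = energyForm σ u v := by
  rw [L2.inner_def, energyForm]
  refine integral_congr_ae ?_
  filter_upwards [hw] with x hx
  rw [hx]
  rfl

set_option maxHeartbeats 2000000 in
/-- The bilinear form of `L_σ - lam` on `H¹₀(Ω)` is bounded. -/
lemma exists_bilin {Ω : Set Plane} {σ : Plane → PlaneMat} (hσ : MemLp σ ⊤ (volume.restrict Ω))
    (lam : ℝ) : ∃ B : H10 Ω →L[ℝ] H10 Ω →L[ℝ] ℝ, ∀ u v,
      B u v = energyForm σ u v - lam * ∫ x in Ω, H10val u x * H10val v x := by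
  obtain ⟨A, hA⟩ := exists_matVec_operator hσ
  obtain ⟨B, hB⟩ := exists_bilin_of_operators (gradL Ω) A (valL Ω) lam
  refine ⟨B, fun u v => (hB u v).trans ?_⟩
  rw [integral_mul_eq_inner, inner_matVec_eq (hA _)]

lemma norm_valL_sq {Ω : Set Plane} (u : H10 Ω) : ‖valL Ω u‖ ^ 2 = ∫ x in Ω, H10val u x ^ 2 := by
  rw [Lp_norm_sq_eq_integral]
  refine integral_congr_ae (.of_forall fun x => ?_)
  exact sq_abs (H10val u x)

lemma energyForm_ge {Ω : Set Plane} {K : ℝ} (hK : 0 < K) {σ : Plane → PlaneMat}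
    (hσ : σ ∈ MK K Ω) (u : H10 Ω) : K⁻¹ * ‖gradL Ω u‖ ^ 2 ≤ energyForm σ u u := by
  rw [Lp_norm_sq_eq_integral, ← integral_const_mul, energyForm]
  have hg : Integrable (fun x => ‖gradL Ω u x‖ ^ 2) (volume.restrict Ω) :=
    (Lp.memLp (gradL Ω u)).integrable_norm_pow two_ne_zero
  have hm : AEStronglyMeasurable (fun x => ⟪σ x (H10grad u x), H10grad u x⟫)
      (volume.restrict Ω) :=
    ((ContinuousLinearMap.id ℝ PlaneMat).aestronglyMeasurable_comp₂ hσ.1.1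
      (Lp.aestronglyMeasurable (gradL Ω u))).inner (Lp.aestronglyMeasurable (gradL Ω u))
  refine integral_mono_ae (hg.const_mul _) ((hg.const_mul K).mono' hm ?_) ?_
  · filter_upwards [hσ.2] with x hx
    have h := hx (H10grad u x)
    rw [Real.norm_of_nonneg (le_trans (by positivity) h.1)]
    exact h.2
  · filter_upwards [hσ.2] with x hx
    exact (hx (H10grad u x)).1

lemma exists_spectralLowerBound {Ω : Set Plane} (hΩb : Bornology.IsBounded Ω) {K : ℝ}
    (hK : 0 < K) : ∃ Λ, 0 < Λ ∧ IsSpectralLowerBound K Ω Λ := by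
  obtain ⟨C, hC0, hC⟩ := exists_poincare hΩb
  refine ⟨K⁻¹ * (C ^ 2)⁻¹, by positivity, fun σ hσ u => ?_⟩
  rw [← norm_valL_sq]
  refine le_trans ?_ (energyForm_ge hK hσ u)
  rw [mul_assoc]
  gcongr
  rw [inv_mul_le_iff₀ (by positivity), ← mul_pow]
  gcongr
  exact hC u

/-- Below the spectral bound the forms are uniformly coercive. -/
lemma exists_coercive {Ω : Set Plane} (hΩb : Bornology.IsBounded Ω) {K : ℝ} (hK : 0 < K)
    {Λ lam : ℝ} (hΛ : IsSpectralLowerBound K Ω Λ) (hlam : lam < Λ) :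
    ∃ c, 0 < c ∧ ∀ σ ∈ MK K Ω, ∀ u : H10 Ω,
      c * ‖u‖ ^ 2 ≤ energyForm σ u u - lam * ∫ x in Ω, H10val u x * H10val u x := by
  obtain ⟨C, hC0, hC⟩ := exists_poincare hΩb
  -- A fixed fraction of the energy survives the subtraction: θ = 1 if lam ≤ 0, and θ = 1 - lam/Λ
  -- otherwise.
  obtain ⟨θ, hθ0, hθ⟩ : ∃ θ : ℝ, 0 < θ ∧ ∀ σ ∈ MK K Ω, ∀ u : H10 Ω,
      θ * energyForm σ u u ≤ energyForm σ u u - lam * ‖valL Ω u‖ ^ 2 := by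
    rcases le_or_gt lam 0 with h0 | h0
    · refine ⟨1, one_pos, fun σ hσ u => ?_⟩
      have := mul_nonneg (neg_nonneg.2 h0) (sq_nonneg ‖valL Ω u‖)
      linarith
    · have hΛ0 : 0 < Λ := h0.trans hlam
      refine ⟨1 - lam / Λ, by rw [sub_pos, div_lt_one hΛ0]; exact hlam, fun σ hσ u => ?_⟩
      have h1 := hΛ σ hσ u
      rw [← norm_valL_sq] at h1
      have h2 := mul_le_mul_of_nonneg_left h1 (div_pos h0 hΛ0).le
      rw [← mul_assoc, div_mul_cancel₀ _ hΛ0.ne'] at h2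
      linarith
  -- The factors come from the gap between lam and Λ, from ellipticity, and from Poincaré's
  -- inequality in the form ‖u‖² ≤ (C² + 1)‖∇u‖².
  refine ⟨θ * K⁻¹ * (C ^ 2 + 1)⁻¹, by positivity, fun σ hσ u => ?_⟩
  rw [integral_mul_eq_inner, real_inner_self_eq_norm_sq]
  refine le_trans ?_ (hθ σ hσ u)
  rw [mul_assoc, mul_assoc]
  refine mul_le_mul_of_nonneg_left (le_trans ?_ (energyForm_ge hK hσ u)) hθ0.le
  gcongr
  rw [inv_mul_le_iff₀ (by positivity), norm_H10_sq, add_mul, one_mul, ← mul_pow]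
  gcongr
  exact hC u

/-! ### Existence, uniqueness and stability of weak solutions -/

section Solutions

variable {Ω : Set Plane} {K lam c : ℝ} {σ : Plane → PlaneMat}

lemma exists_isWeakSol (hσ : σ ∈ MK K Ω) (hc : 0 < c)
    (hcoer : ∀ u : H10 Ω, c * ‖u‖ ^ 2 ≤
      energyForm σ u u - lam * ∫ x in Ω, H10val u x * H10val u x) (f : Hneg1 Ω) :
    ∃ u, IsWeakSol σ lam f u := by
  have : CompleteSpace (H10 Ω) := (Submodule.isClosed_topologicalClosure _).completeSpace_coe
  obtain ⟨B, hB⟩ := exists_bilin hσ.1 lam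
  have hBc : IsCoercive B := ⟨c, hc, fun u => by
    rw [hB, mul_assoc, ← pow_two]; exact hcoer u⟩
  refine ⟨hBc.continuousLinearEquivOfBilin.symm ((InnerProductSpace.toDual ℝ (H10 Ω)).symm f),
    fun v => ?_⟩
  rw [← hB, ← hBc.continuousLinearEquivOfBilin_apply, ContinuousLinearEquiv.apply_symm_apply,
    InnerProductSpace.toDual_symm_apply]

lemma norm_le_of_coercive {u : H10 Ω} (hc : 0 < c)
    (hcoer : c * ‖u‖ ^ 2 ≤ energyForm σ u u - lam * ∫ x in Ω, H10val u x * H10val u x) {M : ℝ}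
    (hM : 0 ≤ M)
    (hf : energyForm σ u u - lam * ∫ x in Ω, H10val u x * H10val u x ≤ M * ‖u‖) :
    ‖u‖ ≤ c⁻¹ * M := by
  rw [le_inv_mul_iff₀ hc]
  rcases (norm_nonneg u).eq_or_lt with h | h
  · rw [← h, mul_zero]; exact hM
  · refine le_of_mul_le_mul_right ?_ h
    calc c * ‖u‖ * ‖u‖ = c * ‖u‖ ^ 2 := by ring
      _ ≤ _ := hcoer.trans hf

lemma IsWeakSol.form_sub (hσ : σ ∈ MK K Ω) {f g : Hneg1 Ω} {u v : H10 Ω}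
    (hu : IsWeakSol σ lam f u) (hv : IsWeakSol σ lam g v) (w : H10 Ω) :
    energyForm σ (u - v) w - lam * ∫ x in Ω, H10val (u - v) x * H10val w x = f w - g w := by
  obtain ⟨B, hB⟩ := exists_bilin hσ.1 lam
  rw [← hB, map_sub, sub_apply, hB, hB, hu w, hv w]

lemma IsWeakSol.eq (hσ : σ ∈ MK K Ω) {f : Hneg1 Ω} {u v : H10 Ω} (hu : IsWeakSol σ lam f u)
    (hv : IsWeakSol σ lam f v) (hc : 0 < c)
    (hcoer : ∀ u : H10 Ω, c * ‖u‖ ^ 2 ≤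
      energyForm σ u u - lam * ∫ x in Ω, H10val u x * H10val u x) : u = v := by
  have h := norm_le_of_coercive hc (hcoer (u - v)) le_rfl
    ((hu.form_sub hσ hv (u - v)).trans_le (by rw [sub_self, zero_mul]))
  rw [mul_zero] at h
  exact sub_eq_zero.1 (norm_le_zero_iff.1 h)

/-- The functional `v ↦ ∫ u v`. -/
def l2Functional (u : H10 Ω) : Hneg1 Ω := (innerSL ℝ (valL Ω u)).comp (valL Ω)

lemma Hneg1.exists_bound (f : Hneg1 Ω) : ∃ M : ℝ, 0 ≤ M ∧ ∀ v, f v ≤ M * ‖v‖ :=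
  ⟨‖f‖, norm_nonneg f, fun v => (le_abs_self _).trans (f.le_opNorm v)⟩

lemma add_l2Functional_apply (f : Hneg1 Ω) (lam : ℝ) (u v : H10 Ω) :
    (f + lam • l2Functional u) v = f v + lam * ⟪valL Ω u, valL Ω v⟫ := rfl

/-- Solutions for the spectral parameter zero. -/
lemma isWeakSol_zero_iff {f : Hneg1 Ω} {u : H10 Ω} :
    IsWeakSol σ 0 (f + lam • l2Functional u) u ↔ IsWeakSol σ lam f u := by
  refine forall_congr' fun v => ?_
  rw [add_l2Functional_apply, zero_mul, sub_zero, integral_mul_eq_inner, sub_eq_iff_eq_add]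

set_option maxHeartbeats 2000000 in
/-- Stability of solutions under a change of the spectral parameter. -/
lemma IsWeakSol.norm_sub_le (hσ : σ ∈ MK K Ω) {f : Hneg1 Ω} {u v w : H10 Ω}
    (hw : IsWeakSol σ 0 (f + lam • l2Functional v) w) (hu : IsWeakSol σ lam f u) (hc : 0 < c)
    (hcoer : ∀ u : H10 Ω, c * ‖u‖ ^ 2 ≤
      energyForm σ u u - lam * ∫ x in Ω, H10val u x * H10val u x) :
    ‖w - u‖ ≤ c⁻¹ * (|lam| * ‖valL Ω (w - v)‖) := by
  refine norm_le_of_coercive hc (hcoer _) (by positivity) ?_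
  have h2 := hw.form_sub hσ (isWeakSol_zero_iff.2 hu) (w - u)
  rw [zero_mul, sub_zero, add_l2Functional_apply, add_l2Functional_apply] at h2
  -- Subtracting the equations gives (L_σ - lam)(w - u) = lam(v - w), tested here with w - u.
  have h3 : energyForm σ (w - u) (w - u) -
      lam * ∫ x in Ω, H10val (w - u) x * H10val (w - u) x =
      -(lam * ⟪valL Ω (w - v), valL Ω (w - u)⟫) := by
    rw [h2, integral_mul_eq_inner, map_sub (valL Ω) w v, map_sub (valL Ω) w u]
    simp only [inner_sub_left, inner_sub_right]
    ring
  rw [h3, mul_assoc]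
  refine (neg_le_abs _).trans ?_
  rw [abs_mul]
  refine mul_le_mul_of_nonneg_left ((abs_real_inner_le_norm _ _).trans ?_) (abs_nonneg _)
  exact mul_le_mul_of_nonneg_left (L2Pair.norm_fst_le ((w - u : H10 Ω) : L2Pair Ω)) (norm_nonneg _)

end Solutions

/-- G-convergence is equivalent to weak convergence of the solutions of `L_σ u = f`. -/
lemma gConverges_iff {Ω : Set Plane} (hΩb : Bornology.IsBounded Ω) {K : ℝ} (hK : 0 < K)
    {σn : ℕ → Plane → PlaneMat} {σ : Plane → PlaneMat} (hσn : ∀ n, σn n ∈ MK K Ω)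
    (hσ : σ ∈ MK K Ω) :
    GConverges K Ω σn σ ↔ ∀ f : Hneg1 Ω, ∃ (u : ℕ → H10 Ω) (v : H10 Ω),
      (∀ n, IsWeakSol (σn n) 0 f (u n)) ∧ IsWeakSol σ 0 f v ∧ WeakTendsto u v := by
  obtain ⟨Λ₀, hΛ₀, hb₀⟩ := exists_spectralLowerBound hΩb hK
  -- The parameter 0 is admissible because Poincaré's inequality provides a positive spectral lower
  -- bound.
  refine ⟨fun h => h Λ₀ hb₀ 0 hΛ₀, fun h Λ hΛ lam hlam f => ?_⟩
  obtain ⟨c₀, hc₀, hcoer₀⟩ := exists_coercive hΩb hK hb₀ hΛ₀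
  obtain ⟨c, hc, hcoer⟩ := exists_coercive hΩb hK hΛ hlam
  obtain ⟨v, hv⟩ := exists_isWeakSol hσ hc (hcoer σ hσ) f
  choose u hu using fun n => exists_isWeakSol (hσn n) hc (hcoer _ (hσn n)) f
  -- The term lam v of the limit equation is moved into the source, which is then independent of n;
  -- by uniqueness the limit problem at parameter 0 has the same solution v.
  obtain ⟨w, v', hw, hv', hwv⟩ := h (f + lam • l2Functional v)
  obtain rfl : v' = v := hv'.eq hσ (isWeakSol_zero_iff.2 hv) hc₀ (hcoer₀ σ hσ)
  refine ⟨u, v', hu, hv, hwv.of_tendsto_sub ?_⟩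
  obtain ⟨M, hM0, hM⟩ := Hneg1.exists_bound (f + lam • l2Functional v')
  -- The bound on w_n needed for Rellich's theorem comes from coercivity at parameter 0, uniform
  -- over the class.
  have hR := rellich hΩb (fun n => norm_le_of_coercive hc₀ (hcoer₀ _ (hσn n) (w n)) hM0
    ((hw n (w n)).trans_le (hM _))) hwv
  refine squeeze_zero_norm (fun n => (hw n).norm_sub_le (hσn n) (hu n) hc (hcoer _ (hσn n))) ?_
  simpa using (hR.const_mul |lam|).const_mul c⁻¹

lemma WeakTendsto.map {Ω : Set Plane} {u : ℕ → H10 Ω} {v : H10 Ω} (h : WeakTendsto u v)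
    (T : H10 Ω →L[ℝ] H10 Ω) : WeakTendsto (fun n => T (u n)) (T v) :=
  fun g => h (g.comp T)

/-! ### Transport of weak solutions by the isomorphism of H¹₀(Ω) -/

namespace IsQCSelfMap

variable {K : ℝ} {Ω : Set Plane} {F : Plane ≃ₜ Plane} {DF : Plane → PlaneMat}

/-- Solutions for the push-forward of `σ` correspond to solutions for `σ`. -/
lemma isWeakSol_pushForward_iff (H : IsQCSelfMap K Ω F DF) {T : H10 Ω ≃L[ℝ] H10 Ω}
    (hT : ∀ u, gradL Ω (T u) = H.pullL (gradL Ω u)) (σ : Plane → PlaneMat) {f g : Hneg1 Ω}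
    (hfg : ∀ v, g (T v) = f v) (u : H10 Ω) :
    IsWeakSol (pushForward F DF σ) 0 f u ↔ IsWeakSol σ 0 g (T u) := by
  have e : ∀ v, energyForm (pushForward F DF σ) u v = energyForm σ (T u) (T v) := fun v =>
    H.energyForm_pushForward σ (hT u) (hT v)
  simp only [IsWeakSol, zero_mul, sub_zero, e]
  constructor
  · intro h v
    obtain ⟨v, rfl⟩ := T.surjective v
    exact (h v).trans (hfg v).symm
  · exact fun h v => (h (T v)).trans (hfg v)

end IsQCSelfMap

theorem lemma5p1 (Ω : Set Plane) (hΩo : IsOpen Ω) (hΩc : IsConnected Ω)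
    (hΩb : Bornology.IsBounded Ω)
    (K K' : ℝ) (hK : 1 ≤ K)
    (F : Plane ≃ₜ Plane) (DF : Plane → PlaneMat) (hF : IsQuasiconformal K' F DF)
    (hFΩ : F '' Ω = Ω) (hFb : ∀ x ∈ frontier Ω, F x = x)
    (σn : ℕ → Plane → PlaneMat) (σ : Plane → PlaneMat)
    (hσn : ∀ n, σn n ∈ MK K Ω) (hσ : σ ∈ MK K Ω) :
    (∀ n, pushForward F DF (σn n) ∈ MK (K * K') Ω) ∧
    pushForward F DF σ ∈ MK (K * K') Ω ∧
    (GConverges K Ω σn σ ↔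
      GConverges (K * K') Ω (fun n => pushForward F DF (σn n)) (pushForward F DF σ)) := by
  have H : IsQCSelfMap K' Ω F DF := ⟨hΩo, hΩb, hF, hFΩ, hFb⟩
  have hK0 : 0 < K := by linarith
  have hpn := fun n => H.pushForward_mem hK (hσn n)
  have hp := H.pushForward_mem hK hσ
  obtain ⟨T, hT⟩ := H.exists_equiv
  refine ⟨hpn, hp, ?_⟩
  -- At parameter 0 the L² term drops out and the different spectral bounds of the two classes no
  -- longer matter; only the energy forms, which T intertwines, remain.
  rw [gConverges_iff hΩb hK0 hσn hσ, gConverges_iff hΩb (mul_pos hK0 H.K_pos) hpn hp]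
  constructor
  · intro h f
    -- Sources are transported contragrediently to solutions: f ∘ T⁻¹ for σ corresponds to f for the
    -- push-forward.
    obtain ⟨u, v, hu, hv, huv⟩ := h (f.comp (T.symm : H10 Ω →L[ℝ] H10 Ω))
    have e : ∀ v, (f.comp (T.symm : H10 Ω →L[ℝ] H10 Ω)) (T v) = f v := fun v =>
      congrArg f (T.symm_apply_apply v)
    refine ⟨fun n => T.symm (u n), T.symm v, fun n => ?_, ?_,
      huv.map (T.symm : H10 Ω →L[ℝ] H10 Ω)⟩
    · rw [H.isWeakSol_pushForward_iff hT (σn n) e, T.apply_symm_apply]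
      exact hu n
    · rw [H.isWeakSol_pushForward_iff hT σ e, T.apply_symm_apply]
      exact hv
  · intro h f
    obtain ⟨u, v, hu, hv, huv⟩ := h (f.comp (T : H10 Ω →L[ℝ] H10 Ω))
    have e : ∀ v, f (T v) = (f.comp (T : H10 Ω →L[ℝ] H10 Ω)) v := fun v => rfl
    exact ⟨fun n => T (u n), T v, fun n => (H.isWeakSol_pushForward_iff hT (σn n) e _).1 (hu n),
      (H.isWeakSol_pushForward_iff hT σ e _).1 hv, huv.map (T : H10 Ω →L[ℝ] H10 Ω)⟩

end
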